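/- **Setting.** Let $M$ be a proper metric space (bounded sets are precompact) and let $\mathcal H$ be an $M$-module: a separable complex Hilbert space with a nondegenerate $*$-representation of $C_0(M)$, extended by the spectral theorem to bounded Borel functions. A bounded Borel function, or the indicator function of a Borel set, and its multiplication operator on $\mathcal H$ are denoted by the same letter. *Operators.* $T\in\mathscr L(\mathcal H)$ has finite propagation if for some $R$ one has $fTg=0$ for all bounded Borel $f,g$ whose supports are at distance at least $R$; it is locally trace-class if $fT$ and $Tf$ are trace-class for every compactly supported bounded Borel $f$. Let $\mathscr B(M)$ be the algebra of locally trace-class, finite propagation operators, and $\mathscr B(M)^+=\mathbb C\oplus\mathscr B(M)$ its unitization; $M_k(\mathscr B(M)^+)$ acts on $\mathcal H^{\oplus k}$ (with $(\lambda,T)$ acting as $\lambda+T$). Let $\mathrm{GL}_k(\mathscr B(M))^+$ be the group of invertible elements of $M_k(\mathscr B(M)^+)$ with scalar part $1$. *Coarse data.* Write $Y_R=\{x: d(x,Y)\le R\}$. A coarsely transverse partition is a list of pairwise disjoint Borel sets $A_0,\dots,A_n$ with union $M$ such that $\bigcap_i (A_i)_R$ is bounded for all $R$. A coarsely transverse collection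 of half spaces is a list of Borel sets $X_1,\dots,X_n$ such that $\bigcap_i (X_i)_R\cap(X_i^c)_R$ is bounded for all $R$ (the empty intersection is $M$). *Pairings.* For $P=P^2\in M_k(\mathscr B(M)^+)$, $$[P;A_0,\dots,A_n]=\mathrm{Tr}\Big(\sum_{\sigma\in S_{n+1}}\mathrm{sgn}(\sigma)\,A_{\sigma_0}P\cdots A_{\sigma_n}P\Big),$$ and for $n$ odd and $U\in \mathrm{GL}_k(\mathscr B(M))^+$, $$[U;A_0,\dots,A_n]=\mathrm{Tr}\Big(\sum_{\sigma\in S_{n+1}}\mathrm{sgn}(\sigma)\,A_{\sigma_0}UA_{\sigma_1}U^{-1}\cdots A_{\sigma_{n-1}}UA_{\sigma_n}U^{-1}\Big)$$ (Kitaev pairings). The Kubo pairings $[P;X_1,\dots,X_n]$ and $[U;X_1,\dots,X_n]$ are given by the same formulas with $X_0=\mathbf 1,X_1,\dots,X_n$ in place of $A_0,\dots,A_n$. For $n=0$ the trace is by convention that of the non-scalar part of $P$. *Homology.* For an algebra $\mathscr A$, $HC_\bullet(\mathscr A)$ is the homology of the quotient of the Hochschild complex $\mathscr A^{\otimes(n+1)}$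 by the image of $1-\lambda$, where $\lambda(a_0\otimes\cdots\otimes a_n)=(-1)^n a_n\otimes a_0\otimes\cdots\otimes a_{n-1}$. With $\mathrm{tr}(S_0\otimes\cdots\otimes S_n)=\sum_{a_0,\dots,a_n}(S_0)_{a_0a_1}\otimes\cdots\otimes(S_n)_{a_na_0}$, put $$\mathrm{ch}(P)=(-1)^m\tfrac{(2m)!}{m!}\big[\mathrm{tr}(P^{\otimes(2m+1)})\big]\in HC_{2m}(\mathscr B(M)^+),$$ $$\mathrm{ch}(U)=m!\,\big[\mathrm{tr}\big(((U-1)\otimes(U^{-1}-1))^{\otimes(m+1)}\big)\big]\in HC_{2m+1}(\mathscr B(M)).$$ Let $\Delta_R$ be the $R$-thickening of the diagonal in $M^{n+1}$ (maximum distance). Coarse $n$-chains are locally finite complex Borel measures on $M^{n+1}$ supported in some $\Delta_R$, modulo signed permutations of the variables, with differential $\sum_i(-1)^i(\pi_i)_*$, where $\pi_i$ omits the $i$-th coordinate; the homology is $HX_\bullet(M)$. Coarse $n$-cochains are antisymmetric locally bounded Borel functions $\theta$ on $M^{n+1}$ with $\mathrm{supp}\,\theta\cap\Delta_R$ bounded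 for all $R$, with differential $\sum_i(-1)^i\pi_i^*$; the cohomology is $HX^\bullet(M)$. Let $\langle\theta,\mu\rangle=\int\theta\,d\mu$, inducing a pairing of $HX^n(M)$ with $HX_n(M)$. The coarse character map $\chi_*:HC_n(\mathscr B(M))\to HX_n(M)$ is induced by sending $T_0\otimes\cdots\otimes T_n$ to the measure $\mu$ with $\int f_0\otimes\cdots\otimes f_n\,d\mu=\mathrm{Tr}(f_0T_0\cdots f_nT_n)$ for all $f_i\in C_c(M)$; $\widetilde\chi_*:HC_n(\mathscr B(M)^+)\to HX_n(M)$ is induced by $(\lambda_0+T_0)\otimes\cdots\otimes(\lambda_n+T_n)\mapsto\chi(T_0\otimes\cdots\otimes T_n)$. Finally $f_0\wedge\cdots\wedge f_n=\sum_{\sigma\in S_{n+1}}\mathrm{sgn}(\sigma) f_{\sigma_0}\otimes\cdots\otimes f_{\sigma_n}$. **Lemma.** The maps $\chi_*$, $\widetilde\chi_*$ and the pairing of classes are well defined. Let $k,m\ge 0$, let $A_0,\dots,A_n$ be a coarsely transverse partition of $M$ and $X_1,\dots,X_n$ a coarsely transverse collection of half spaces, and let $P=P^2\in M_k(\mathscr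 B(M)^+)$ and $U\in\mathrm{GL}_k(\mathscr B(M))^+$. Then the operators under the traces below are trace-class, the chains defining $\mathrm{ch}(P)$, $\mathrm{ch}(U)$ are cycles, $A_0\wedge\cdots\wedge A_n$ and $\mathbf 1\wedge X_1\wedge\cdots\wedge X_n$ are coarse cocycles, and $$[P;A_0,\dots,A_n]=(-1)^m\frac{m!}{(2m)!}\,\langle\widetilde\chi_*\mathrm{ch}(P),A_0\wedge\cdots\wedge A_n\rangle\qquad(n=2m),$$ $$[U;A_0,\dots,A_n]=\frac1{m!}\,\langle\chi_*\mathrm{ch}(U),A_0\wedge\cdots\wedge A_n\rangle\qquad(n=2m+1),$$ $$[P;X_1,\dots,X_n]=(-1)^m\frac{m!}{(2m)!}\,\langle\widetilde\chi_*\mathrm{ch}(P),\mathbf 1\wedge X_1\wedge\cdots\wedge X_n\rangle\qquad(n=2m),$$ $$[U;X_1,\dots,X_n]=\frac1{m!}\,\langle\chi_*\mathrm{ch}(U),\mathbf 1\wedge X_1\wedge\cdots\wedge X_n\rangle\qquad(n=2m+1).$$ -/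

import Mathlib

open scoped TensorProduct ZeroAtInfty InnerProductSpace Nat

noncomputable section

namespace CoarsePairing

/-! ### Trace-class operators -/

section TraceClass

variable {E : Type*} [NormedAddCommGroup E] [InnerProductSpace ℂ E] [CompleteSpace E]

/-- Trace-class (equivalently, nuclear) operators on a Hilbert space:
`T = ∑ᵢ ⟪yᵢ, ·⟫ xᵢ` with `∑ᵢ ‖xᵢ‖ ‖yᵢ‖ < ∞`. -/
def IsTraceClass (T : E →L[ℂ] E) : Prop :=
  ∃ x y : ℕ → E, (Summable fun i => ‖x i‖ * ‖y i‖) ∧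
    ∀ v, HasSum (fun i => ⟪y i, v⟫_ℂ • x i) (T v)

/-- The trace `∑ ⟪e, T e⟫` over an orthonormal basis (used for trace-class operators, where the
value does not depend on the basis). -/
def trace (T : E →L[ℂ] E) : ℂ :=
  let b := (exists_hilbertBasis ℂ E).choose_spec.choose
  ∑' e, ⟪b e, T (b e)⟫_ℂ

/-- A `k × k` matrix of operators on `E`, acting on the Hilbert space `E ⊕ ⋯ ⊕ E`. -/
def matrixOp {k : ℕ} (T : Matrix (Fin k) (Fin k) (E →L[ℂ] E)) :
    PiLp 2 (fun _ : Fin k => E) →L[ℂ] PiLp 2 (fun _ : Fin k => E) :=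
  ((PiLp.continuousLinearEquiv 2 ℂ (fun _ : Fin k => E)).symm :
      (Fin k → E) →L[ℂ] PiLp 2 (fun _ : Fin k => E)) ∘L
    (ContinuousLinearMap.pi fun a => ∑ b, T a b ∘L ContinuousLinearMap.proj b) ∘L
    (PiLp.continuousLinearEquiv 2 ℂ (fun _ : Fin k => E) :
      PiLp 2 (fun _ : Fin k => E) →L[ℂ] (Fin k → E))

end TraceClass

/-! ### Modules over a proper metric space and finite propagation operators -/

section Modules

variable {M : Type*} [MetricSpace M] [MeasurableSpace M] [BorelSpace M]
variable {H : Type*} [NormedAddCommGroup H] [InnerProductSpace ℂ H] [CompleteSpace H]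
variable (ρ : C₀(M, ℂ) →⋆ₙₐ[ℂ] (H →L[ℂ] H))

/-- Bounded Borel functions. -/
def IsBoundedBorel (g : M → ℂ) : Prop := Measurable g ∧ ∃ C : ℝ, ∀ x, ‖g x‖ ≤ C

/-- `ν` is the finite Borel measure with `⟪v, ρ(f) v⟫ = ∫ f dν` for all `f ∈ C₀(M)`. -/
def IsSpectralMeasure (v : H) (ν : MeasureTheory.Measure M) : Prop :=
  MeasureTheory.IsFiniteMeasure ν ∧ ∀ f : C₀(M, ℂ), ⟪v, ρ f v⟫_ℂ = ∫ x, f x ∂ν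

open Classical in
/-- The extension of the representation `ρ` of `C₀(M)` to bounded Borel functions `g`: the operator
with `⟪v, g v⟫ = ∫ g dν` for every `v`, where `ν` is the spectral measure of `v`.
(It exists by the spectral theorem, and it is determined by its quadratic form.) -/
def borelOp (g : M → ℂ) : H →L[ℂ] H :=
  if h : ∃ T : H →L[ℂ] H, ∀ v ν, IsSpectralMeasure ρ v ν → ⟪v, T v⟫_ℂ = ∫ x, g x ∂ν
  then h.choose else 0

/-- The multiplication operator by the indicator function of a Borel set. -/
def setOp (Y : Set M) : H →L[ℂ] H := borelOp ρ (Y.indicator fun _ => 1)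

/-- Propagation bound `R`: `f T g = 0` when the supports of `f`, `g` have distance at least `R`. -/
def HasPropagationBound (T : H →L[ℂ] H) (R : ℝ) : Prop :=
  ∀ f g : M → ℂ, IsBoundedBorel f → IsBoundedBorel g →
    (∀ x ∈ tsupport f, ∀ y ∈ tsupport g, R ≤ dist x y) →
    borelOp ρ f * T * borelOp ρ g = 0

def IsLocallyTraceClass (T : H →L[ℂ] H) : Prop :=
  ∀ f : M → ℂ, IsBoundedBorel f → HasCompactSupport f →
    IsTraceClass (borelOp ρ f * T) ∧ IsTraceClass (T * borelOp ρ f)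

/-- The algebra `ℬ(M)` of locally trace-class, finite propagation operators. These operators are
closed under the algebra operations, so that the subalgebra they generate has no other element. -/
def algB : NonUnitalSubalgebra ℂ (H →L[ℂ] H) :=
  NonUnitalAlgebra.adjoin ℂ {T | IsLocallyTraceClass ρ T ∧ ∃ R, HasPropagationBound ρ T R}

/-- The unitization `ℬ(M)⁺`. -/
abbrev algBPlus : Type _ := Unitization ℂ (algB ρ)

instance : IsScalarTower ℂ (algBPlus ρ) (algBPlus ρ) :=
  @IsScalarTower.right ℂ (algBPlus ρ) _ _ _

instance : SMulCommClass ℂ (algBPlus ρ) (algBPlus ρ) :=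
  @Algebra.to_smulCommClass ℂ (algBPlus ρ) _ _ _

/-- The action of `M_k(ℬ(M)⁺)` by matrices of operators on `H`, `(λ, T) ↦ λ + T` entrywise. -/
def actMatrix {k : ℕ} (P : Matrix (Fin k) (Fin k) (algBPlus ρ)) :
    Matrix (Fin k) (Fin k) (H →L[ℂ] H) :=
  P.map (NonUnitalSubalgebra.unitization (algB ρ))

/-- The non-scalar part in `M_k(ℬ(M))` of a matrix in `M_k(ℬ(M)⁺)`. -/
def nonscalarPart {k : ℕ} (P : Matrix (Fin k) (Fin k) (algBPlus ρ)) :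
    Matrix (Fin k) (Fin k) (algB ρ) :=
  P.map fun x => x.snd

/-! ### Partitions, half spaces, and the Kitaev and Kubo pairings -/

/-- Coarsely transverse partitions `A₀, …, Aₙ`. -/
structure IsCoarselyTransversePartition {n : ℕ} (A : Fin (n + 1) → Set M) : Prop where
  measurableSet : ∀ i, MeasurableSet (A i)
  disjoint : Pairwise fun i j => Disjoint (A i) (A j)
  iUnion_eq : ⋃ i, A i = Set.univ
  bounded : ∀ R : ℝ, Bornology.IsBounded (⋂ i, Metric.cthickening R (A i))

/-- Coarsely transverse collections of half spaces `X₁, …, Xₙ`. -/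
structure IsCoarselyTransverseHalfSpaces {n : ℕ} (X : Fin n → Set M) : Prop where
  measurableSet : ∀ i, MeasurableSet (X i)
  bounded : ∀ R : ℝ, Bornology.IsBounded
    (⋂ i, Metric.cthickening R (X i) ∩ Metric.cthickening R (X i)ᶜ)

/-- `∑_σ sgn(σ) Y_{σ 0} S₀ Y_{σ 1} S₁ ⋯ Y_{σ n} Sₙ`, where the `Y i` act diagonally. -/
def altSum {n k : ℕ} (Y : Fin (n + 1) → Set M)
    (S : Fin (n + 1) → Matrix (Fin k) (Fin k) (H →L[ℂ] H)) :
    Matrix (Fin k) (Fin k) (H →L[ℂ] H) :=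
  ∑ σ : Equiv.Perm (Fin (n + 1)), (Equiv.Perm.sign σ : ℤ) •
    (List.ofFn fun i => Matrix.diagonal (fun _ : Fin k => setOp ρ (Y (σ i))) * S i).prod

/-- The operator whose trace is the pairing of `P` with `Y₀, …, Yₙ`. For `n = 0` the trace is by
convention extended to `T + scalar` by ignoring the scalar part, so that the operator is the
non-scalar part of `P` (there `Y₀` is all of `M`). -/
def idemOperator {n k : ℕ} (Y : Fin (n + 1) → Set M) (P : Matrix (Fin k) (Fin k) (algBPlus ρ)) :
    PiLp 2 (fun _ : Fin k => H) →L[ℂ] PiLp 2 (fun _ : Fin k => H) :=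
  if n = 0 then matrixOp ((nonscalarPart ρ P).map fun T => (T : H →L[ℂ] H))
  else matrixOp (altSum ρ Y fun _ => actMatrix ρ P)

/-- The operator whose trace is the pairing of `U` with `Y₀, …, Yₙ` (`n` odd); the factors are
`U, U⁻¹, U, U⁻¹, …`. -/
def invOperator {n k : ℕ} (Y : Fin (n + 1) → Set M)
    (U : (Matrix (Fin k) (Fin k) (algBPlus ρ))ˣ) :
    PiLp 2 (fun _ : Fin k => H) →L[ℂ] PiLp 2 (fun _ : Fin k => H) :=
  matrixOp (altSum ρ Y fun i =>
    if Even (i : ℕ) then actMatrix ρ (U : Matrix (Fin k) (Fin k) (algBPlus ρ))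
    else actMatrix ρ ((U⁻¹ : (Matrix (Fin k) (Fin k) (algBPlus ρ))ˣ) :
      Matrix (Fin k) (Fin k) (algBPlus ρ)))

/-- The list `1, X₁, …, Xₙ` (as subsets, `X₀ = M`). -/
def withOne {n : ℕ} (X : Fin n → Set M) : Fin (n + 1) → Set M := Fin.cons Set.univ X

/-- `[P; A₀, …, Aₙ]`. -/
def kitaevIdem {n k : ℕ} (P : Matrix (Fin k) (Fin k) (algBPlus ρ)) (A : Fin (n + 1) → Set M) : ℂ :=
  trace (idemOperator ρ A P)

/-- `[U; A₀, …, Aₙ]`. -/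
def kitaevInv {n k : ℕ} (U : (Matrix (Fin k) (Fin k) (algBPlus ρ))ˣ)
    (A : Fin (n + 1) → Set M) : ℂ :=
  trace (invOperator ρ A U)

/-- `[P; X₁, …, Xₙ]`. -/
def kuboIdem {n k : ℕ} (P : Matrix (Fin k) (Fin k) (algBPlus ρ)) (X : Fin n → Set M) : ℂ :=
  trace (idemOperator ρ (withOne X) P)

/-- `[U; X₁, …, Xₙ]`. -/
def kuboInv {n k : ℕ} (U : (Matrix (Fin k) (Fin k) (algBPlus ρ))ˣ) (X : Fin n → Set M) : ℂ :=
  trace (invOperator ρ (withOne X) U)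

end Modules

/-! ### Cyclic homology and Chern characters -/

section Cyclic

variable (A : Type*) [NonUnitalRing A] [Module ℂ A] [IsScalarTower ℂ A A] [SMulCommClass ℂ A A]

/-- `Cₙ(A) = A^{⊗(n+1)}`. -/
abbrev Chains (n : ℕ) : Type _ := ⨂[ℂ] _ : Fin (n + 1), A

variable {A} in
theorem contractNth_update {n : ℕ} (i : Fin (n + 1)) (a : Fin (n + 2) → A) (j : Fin (n + 2)) :
    ∃ L : A →ₗ[ℂ] A, ∀ x,
      Fin.contractNth i.castSucc (· * ·) (Function.update a j x) =
        Function.update (Fin.contractNth i.castSucc (· * ·) a) (i.predAbove j) (L x) := by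
  have key : ∀ k : Fin (n + 1), (k = i.predAbove j ↔
      (k : ℕ) = if (i : ℕ) < j then (j : ℕ) - 1 else j) := by
    intro k
    rw [Fin.ext_iff]
    by_cases h : i.castSucc < j
    · rw [Fin.predAbove_of_castSucc_lt _ _ h]
      have h' : (i : ℕ) < j := h
      simp [h']
    · rw [Fin.predAbove_of_le_castSucc _ _ (not_lt.1 h)]
      have h' : ¬ (i : ℕ) < j := h
      simp [h']
  rcases lt_trichotomy (j : ℕ) (i : ℕ) with h | h | h
  · refine ⟨LinearMap.id, fun x => ?_⟩
    ext k
    simp only [Fin.contractNth, Function.update_apply, key, Fin.ext_iff, Fin.val_castSucc,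
      Fin.val_succ, LinearMap.id_apply]
    grind
  · refine ⟨(LinearMap.mul ℂ A).flip (a i.succ), fun x => ?_⟩
    have hj : j = i.castSucc := Fin.ext h
    subst hj
    ext k
    simp only [Fin.contractNth, Function.update_apply, key, Fin.ext_iff, Fin.val_castSucc,
      Fin.val_succ, LinearMap.flip_apply, LinearMap.mul_apply']
    by_cases hk : (k : ℕ) = i
    · have : k = i := Fin.ext hk
      subst this
      simp
    · grind
  · by_cases h2 : (j : ℕ) = i + 1
    · refine ⟨LinearMap.mul ℂ A (a i.castSucc), fun x => ?_⟩
      have hj : j = i.succ := Fin.ext h2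
      subst hj
      ext k
      simp only [Fin.contractNth, Function.update_apply, key, Fin.ext_iff, Fin.val_castSucc,
        Fin.val_succ, LinearMap.mul_apply']
      by_cases hk : (k : ℕ) = i
      · have : k = i := Fin.ext hk
        subst this
        simp
      · grind
    · refine ⟨LinearMap.id, fun x => ?_⟩
      ext k
      simp only [Fin.contractNth, Function.update_apply, key, Fin.ext_iff, Fin.val_castSucc,
        Fin.val_succ, LinearMap.id_apply]
      grind

/-- `a₀ ⊗ ⋯ ⊗ aₙ₊₁ ↦ a₀ ⊗ ⋯ ⊗ aᵢ aᵢ₊₁ ⊗ ⋯ ⊗ aₙ₊₁`, `0 ≤ i ≤ n`. -/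
def faceMap (n : ℕ) (i : Fin (n + 1)) : Chains A (n + 1) →ₗ[ℂ] Chains A n :=
  PiTensorProduct.lift
    (MultilinearMap.mk' (fun a : Fin (n + 2) → A =>
        PiTensorProduct.tprod ℂ (Fin.contractNth i.castSucc (· * ·) a))
      (fun a j x y => by
        obtain ⟨L, hL⟩ := contractNth_update i a j
        simp only [hL, map_add, MultilinearMap.map_update_add])
      (fun a j c x => by
        obtain ⟨L, hL⟩ := contractNth_update i a j
        simp only [hL, map_smul, MultilinearMap.map_update_smul]))

/-- `a₀ ⊗ ⋯ ⊗ aₙ ↦ aₙ ⊗ a₀ ⊗ ⋯ ⊗ aₙ₋₁`. -/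
def rotateMap (n : ℕ) : Chains A n →ₗ[ℂ] Chains A n :=
  (PiTensorProduct.reindex ℂ (fun _ : Fin (n + 1) => A) (finRotate (n + 1))).toLinearMap

/-- The signed cyclic permutation operator `λ`. -/
def cyclicOp (n : ℕ) : Chains A n →ₗ[ℂ] Chains A n := (-1 : ℂ) ^ n • rotateMap A n

/-- The Hochschild differential `b : Cₙ₊₁(A) → Cₙ(A)`. -/
def hochschild (n : ℕ) : Chains A (n + 1) →ₗ[ℂ] Chains A n :=
  (∑ i : Fin (n + 1), (-1 : ℂ) ^ (i : ℕ) • faceMap A n i) +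
    (-1 : ℂ) ^ (n + 1) • (faceMap A n 0 ∘ₗ rotateMap A (n + 1))

/-- The image of `1 - λ`, by which `Cₙ(A)` is divided in the cyclic complex. -/
def cyclicNull (n : ℕ) : Submodule ℂ (Chains A n) := LinearMap.range (LinearMap.id - cyclicOp A n)

/-- Chains that represent cycles of the cyclic complex `C^λ(A)`. -/
def cyclicCycles : (n : ℕ) → Submodule ℂ (Chains A n)
  | 0 => ⊤
  | n + 1 => (cyclicNull A n).comap (hochschild A n)

/-- Chains that represent boundaries of the cyclic complex `C^λ(A)`. -/
def cyclicBoundaries (n : ℕ) : Submodule ℂ (Chains A n) :=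
  LinearMap.range (hochschild A n) ⊔ cyclicNull A n

/-- Cyclic homology. -/
def HC (n : ℕ) : Type _ :=
  cyclicCycles A n ⧸ (cyclicBoundaries A n).submoduleOf (cyclicCycles A n)

instance (n : ℕ) : AddCommGroup (HC A n) :=
  inferInstanceAs
    (AddCommGroup (cyclicCycles A n ⧸ (cyclicBoundaries A n).submoduleOf (cyclicCycles A n)))

instance (n : ℕ) : Module ℂ (HC A n) :=
  inferInstanceAs
    (Module ℂ (cyclicCycles A n ⧸ (cyclicBoundaries A n).submoduleOf (cyclicCycles A n)))

variable {A}

/-- The class in cyclic homology of a cycle. -/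
def HC.mk {n : ℕ} (z : Chains A n) (hz : z ∈ cyclicCycles A n) : HC A n :=
  Submodule.Quotient.mk (p := (cyclicBoundaries A n).submoduleOf (cyclicCycles A n)) ⟨z, hz⟩

/-- `tr(S₀ ⊗ ⋯ ⊗ Sₙ) = ∑ (S₀)_{a₀ a₁} ⊗ (S₁)_{a₁ a₂} ⊗ ⋯ ⊗ (Sₙ)_{aₙ a₀}` (the index `i + 1` is
cyclic). -/
def trTensor {n k : ℕ} (S : Fin (n + 1) → Matrix (Fin k) (Fin k) A) : Chains A n :=
  ∑ a : Fin (n + 1) → Fin k, PiTensorProduct.tprod ℂ fun i => S i (a i) (a (i + 1))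

/-- The cycle `(-1)^m (2m)!/m! tr(P ⊗ ⋯ ⊗ P)` that represents `ch(P)` in degree `2m`. -/
def chernIdem {k : ℕ} (m : ℕ) (P : Matrix (Fin k) (Fin k) A) : Chains A (2 * m) :=
  ((-1 : ℂ) ^ m * ((2 * m)! / m ! : ℂ)) • trTensor fun _ => P

/-- The cycle `m! tr((U - 1) ⊗ (U⁻¹ - 1) ⊗ ⋯ ⊗ (U - 1) ⊗ (U⁻¹ - 1))` that represents `ch(U)` in
degree `2m + 1`, where `u = U - 1` and `v = U⁻¹ - 1`. -/
def chernInv {k : ℕ} (m : ℕ) (u v : Matrix (Fin k) (Fin k) A) : Chains A (2 * m + 1) :=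
  (m ! : ℂ) • trTensor fun i => if Even (i : ℕ) then u else v

end Cyclic

/-! ### Locally finite complex measures -/

section Measures

variable (X : Type*) [MetricSpace X] [MeasurableSpace X]

/-- Complex-valued locally finite Borel measures on `X`: countably additive set functions on the
bounded Borel sets (with value `0` assigned to all other sets). Regularity is automatic on
proper metric spaces. -/
def locFinMeasure : Submodule ℂ (Set X → ℂ) where
  carrier := {μ | (∀ s, ¬ (MeasurableSet s ∧ Bornology.IsBounded s) → μ s = 0) ∧
    ∀ s : ℕ → Set X, (∀ i, MeasurableSet (s i)) → Pairwise (fun i j => Disjoint (s i) (s j)) →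
      Bornology.IsBounded (⋃ i, s i) → HasSum (fun i => μ (s i)) (μ (⋃ i, s i))}
  zero_mem' := ⟨fun _ _ => rfl, fun _ _ _ _ => hasSum_zero⟩
  add_mem' := fun {μ ν} hμ hν => ⟨fun s hs => by simp [hμ.1 s hs, hν.1 s hs],
    fun s h1 h2 h3 => (hμ.2 s h1 h2 h3).add (hν.2 s h1 h2 h3)⟩
  smul_mem' := fun c μ hμ => ⟨fun s hs => by simp [hμ.1 s hs],
    fun s h1 h2 h3 => (hμ.2 s h1 h2 h3).const_smul c⟩

variable {X}

theorem locFinMeasure_empty {μ : Set X → ℂ} (hμ : μ ∈ locFinMeasure X) : μ ∅ = 0 := by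
  have h := hμ.2 (fun _ => ∅) (fun _ => MeasurableSet.empty) (fun _ _ _ => by simp) (by simp)
  exact (summable_const_iff _).1 h.summable

open Classical in
/-- The restriction of a locally finite complex measure to a bounded Borel set `B`, as a complex
measure. -/
def restrictTo (μ : locFinMeasure X) (B : Set X) : MeasureTheory.ComplexMeasure X where
  measureOf' s := if MeasurableSet s ∧ MeasurableSet B ∧ Bornology.IsBounded B
    then (μ : Set X → ℂ) (s ∩ B) else 0
  empty' := by simp [locFinMeasure_empty μ.2]
  not_measurable' s hs := by simp [hs]
  m_iUnion' s h1 h2 := by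
    by_cases hB : MeasurableSet B ∧ Bornology.IsBounded B
    · have h3 : (⋃ i, s i) ∩ B = ⋃ i, s i ∩ B := Set.iUnion_inter _ _
      simp only [h1, MeasurableSet.iUnion h1, hB, and_self, if_true, h3]
      exact μ.2.2 (fun i => s i ∩ B) (fun i => (h1 i).inter hB.1)
        (fun i j hij => (h2 hij).mono Set.inter_subset_left Set.inter_subset_left)
        (hB.2.subset (Set.iUnion_subset fun _ => Set.inter_subset_right))
    · simp [hB]

/-- `∫_B g dμ` for a bounded Borel set `B`. -/
def integralOn (μ : locFinMeasure X) (B : Set X) (g : X → ℂ) : ℂ :=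
  (restrictTo μ B).integral g (ContinuousLinearMap.mul ℝ ℂ)

end Measures

/-! ### Coarse homology and cohomology (antisymmetric versions) -/

section Coarse

variable (M : Type*) [MetricSpace M] [MeasurableSpace M] (n : ℕ)

/-- The `R`-thickening of the multi-diagonal in `M^{n+1}` (with the maximum distance). -/
def diagThickening (R : ℝ) : Set (Fin (n + 1) → M) :=
  Metric.cthickening R (Set.range fun (x : M) (_ : Fin (n + 1)) => x)

/-- `CXₙ(M)`: locally finite complex Borel measures on `M^{n+1}` that are supported in a thickening
of the multi-diagonal. -/
def coarseChains : Submodule ℂ (Set (Fin (n + 1) → M) → ℂ) where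
  carrier := {μ | μ ∈ locFinMeasure (Fin (n + 1) → M) ∧
    ∃ R : ℝ, ∀ s, Disjoint s (diagThickening M n R) → μ s = 0}
  zero_mem' := ⟨zero_mem _, 0, fun _ _ => rfl⟩
  add_mem' := by
    rintro μ ν ⟨h1, R, hR⟩ ⟨h2, S, hS⟩
    refine ⟨add_mem h1 h2, max R S, fun s hs => ?_⟩
    have h3 := hR s (hs.mono_right (Metric.cthickening_mono (le_max_left R S) _))
    have h4 := hS s (hs.mono_right (Metric.cthickening_mono (le_max_right R S) _))
    simp [h3, h4]
  smul_mem' := by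
    rintro c μ ⟨h1, R, hR⟩
    exact ⟨Submodule.smul_mem _ c h1, R, fun s hs => by simp [hR s hs]⟩

/-- The differences `μ - sgn(σ) σ_* μ`, by which `CXₙ(M)` is divided in the antisymmetric
complex. -/
def antisymNull : Submodule ℂ (Set (Fin (n + 1) → M) → ℂ) :=
  Submodule.span ℂ {ν | ∃ μ ∈ coarseChains M n, ∃ σ : Equiv.Perm (Fin (n + 1)),
    ν = fun s => μ s - ((Equiv.Perm.sign σ : ℤ) : ℂ) * μ ((fun x i => x (σ i)) ⁻¹' s)}

variable {M n} in
/-- `ν = ∂μ = ∑ᵢ (-1)^i (πᵢ)_* μ`, where `πᵢ` omits the `i`-th coordinate. Since `μ` is supported in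
some `Δ_R`, the value of `(πᵢ)_* μ` on a bounded Borel set `s` is `μ(πᵢ⁻¹(s) ∩ Δ_R)` for
all large `R` (these sets are bounded). -/
def IsBoundaryOf (μ : Set (Fin (n + 2) → M) → ℂ) (ν : Set (Fin (n + 1) → M) → ℂ) : Prop :=
  ∀ s, MeasurableSet s → Bornology.IsBounded s → ∀ᶠ R : ℝ in Filter.atTop,
    ν s = ∑ i : Fin (n + 2), (-1 : ℂ) ^ (i : ℕ) *
      μ ((fun x j => x (i.succAbove j)) ⁻¹' s ∩ diagThickening M (n + 1) R)

variable {M n} in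
theorem IsBoundaryOf.zero : IsBoundaryOf (0 : Set (Fin (n + 2) → M) → ℂ) 0 :=
  fun s _ _ => Filter.Eventually.of_forall fun R => by simp

variable {M n} in
theorem IsBoundaryOf.add {μ μ' : Set (Fin (n + 2) → M) → ℂ} {ν ν' : Set (Fin (n + 1) → M) → ℂ}
    (h : IsBoundaryOf μ ν) (h' : IsBoundaryOf μ' ν') : IsBoundaryOf (μ + μ') (ν + ν') := by
  intro s h1 h2
  filter_upwards [h s h1 h2, h' s h1 h2] with R e e'
  simp only [Pi.add_apply, e, e', mul_add, Finset.sum_add_distrib]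

variable {M n} in
theorem IsBoundaryOf.smul {μ : Set (Fin (n + 2) → M) → ℂ} {ν : Set (Fin (n + 1) → M) → ℂ} (c : ℂ)
    (h : IsBoundaryOf μ ν) : IsBoundaryOf (c • μ) (c • ν) := by
  intro s h1 h2
  filter_upwards [h s h1 h2] with R e
  simp only [Pi.smul_apply, e, smul_eq_mul, Finset.mul_sum]
  exact Finset.sum_congr rfl fun i _ => by ring

/-- Coarse chains that represent cycles of the antisymmetric complex. -/
def coarseCycles : (n : ℕ) → Submodule ℂ (Set (Fin (n + 1) → M) → ℂ)
  | 0 => coarseChains M 0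
  | n + 1 =>
    { carrier := {μ | μ ∈ coarseChains M (n + 1) ∧ ∃ ν ∈ antisymNull M n, IsBoundaryOf μ ν}
      zero_mem' := ⟨zero_mem _, 0, zero_mem _, .zero⟩
      add_mem' := by
        rintro μ μ' ⟨h, ν, hν, b⟩ ⟨h', ν', hν', b'⟩
        exact ⟨add_mem h h', ν + ν', add_mem hν hν', b.add b'⟩
      smul_mem' := by
        rintro c μ ⟨h, ν, hν, b⟩
        exact ⟨Submodule.smul_mem _ c h, c • ν, Submodule.smul_mem _ c hν, b.smul c⟩ }

/-- Coarse chains that represent boundaries of the antisymmetric complex. -/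
def coarseBoundaries : Submodule ℂ (Set (Fin (n + 1) → M) → ℂ) :=
  { carrier := {ν | ν ∈ coarseChains M n ∧ ∃ μ ∈ coarseChains M (n + 1), IsBoundaryOf μ ν}
    zero_mem' := ⟨zero_mem _, 0, zero_mem _, .zero⟩
    add_mem' := by
      rintro ν ν' ⟨h, μ, hμ, b⟩ ⟨h', μ', hμ', b'⟩
      exact ⟨add_mem h h', μ + μ', add_mem hμ hμ', b.add b'⟩
    smul_mem' := by
      rintro c ν ⟨h, μ, hμ, b⟩
      exact ⟨Submodule.smul_mem _ c h, c • μ, Submodule.smul_mem _ c hμ, b.smul c⟩ } ⊔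
  antisymNull M n

/-- Coarse homology `HXₙ(M)`. -/
def HXHom : Type _ :=
  coarseCycles M n ⧸ (coarseBoundaries M n).submoduleOf (coarseCycles M n)

instance : AddCommGroup (HXHom M n) :=
  inferInstanceAs
    (AddCommGroup (coarseCycles M n ⧸ (coarseBoundaries M n).submoduleOf (coarseCycles M n)))

instance : Module ℂ (HXHom M n) :=
  inferInstanceAs
    (Module ℂ (coarseCycles M n ⧸ (coarseBoundaries M n).submoduleOf (coarseCycles M n)))

variable {M n} in
/-- The class in coarse homology of a coarse cycle. -/
def HXHom.mk (μ : coarseCycles M n) : HXHom M n :=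
  Submodule.Quotient.mk (p := (coarseBoundaries M n).submoduleOf (coarseCycles M n)) μ

/-- Antisymmetric coarse `n`-cochains: antisymmetric, locally bounded Borel functions on `M^{n+1}`
whose support meets every thickening of the multi-diagonal in a bounded set. -/
def coarseCochains : Submodule ℂ ((Fin (n + 1) → M) → ℂ) where
  carrier := {θ | Measurable θ ∧ (∀ x, ∃ U ∈ nhds x, ∃ C : ℝ, ∀ y ∈ U, ‖θ y‖ ≤ C) ∧
    (∀ R : ℝ, Bornology.IsBounded (tsupport θ ∩ diagThickening M n R)) ∧
    ∀ (σ : Equiv.Perm (Fin (n + 1))) (x : Fin (n + 1) → M),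
      θ (fun i => x (σ i)) = ((Equiv.Perm.sign σ : ℤ) : ℂ) * θ x}
  zero_mem' := ⟨measurable_const, fun x => ⟨Set.univ, Filter.univ_mem, 0, fun y _ => by simp⟩,
    fun R => by simp [tsupport], fun σ x => by simp⟩
  add_mem' := by
    rintro θ η ⟨h1, h2, h3, h4⟩ ⟨k1, k2, k3, k4⟩
    refine ⟨h1.add k1, fun x => ?_, fun R => ?_, fun σ x => ?_⟩
    · obtain ⟨U, hU, C, hC⟩ := h2 x
      obtain ⟨V, hV, D, hD⟩ := k2 x
      exact ⟨U ∩ V, Filter.inter_mem hU hV, C + D, fun y hy =>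
        (norm_add_le _ _).trans (add_le_add (hC y hy.1) (hD y hy.2))⟩
    · refine ((h3 R).union (k3 R)).subset ?_
      rw [← Set.union_inter_distrib_right]
      exact Set.inter_subset_inter_left _ (tsupport_add θ η)
    · simp only [Pi.add_apply, h4, k4, mul_add]
  smul_mem' := by
    rintro c θ ⟨h1, h2, h3, h4⟩
    refine ⟨h1.const_smul c, fun x => ?_, fun R => ?_, fun σ x => ?_⟩
    · obtain ⟨U, hU, C, hC⟩ := h2 x
      exact ⟨U, hU, ‖c‖ * C, fun y hy => by
        simpa using mul_le_mul_of_nonneg_left (hC y hy) (norm_nonneg c)⟩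
    · refine (h3 R).subset (Set.inter_subset_inter_left _ ?_)
      exact closure_mono (Function.support_const_smul_subset c θ)
    · simp only [Pi.smul_apply, h4, smul_eq_mul]
      ring

/-- The Alexander-Spanier differential `δθ = ∑ᵢ (-1)^i πᵢ^* θ`. -/
def coboundary : ((Fin (n + 1) → M) → ℂ) →ₗ[ℂ] ((Fin (n + 2) → M) → ℂ) where
  toFun θ := fun x => ∑ i : Fin (n + 2), (-1 : ℂ) ^ (i : ℕ) * θ fun j => x (i.succAbove j)
  map_add' θ η := by
    ext x
    simp [mul_add, Finset.sum_add_distrib]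
  map_smul' c θ := by
    ext x
    simp only [Pi.smul_apply, smul_eq_mul, Finset.mul_sum, RingHom.id_apply]
    exact Finset.sum_congr rfl fun i _ => by ring

def coarseCocycles : Submodule ℂ ((Fin (n + 1) → M) → ℂ) :=
  coarseCochains M n ⊓ LinearMap.ker (coboundary M n)

def coarseCoboundaries : (n : ℕ) → Submodule ℂ ((Fin (n + 1) → M) → ℂ)
  | 0 => ⊥
  | n + 1 => (coarseCochains M n).map (coboundary M n)

/-- Coarse cohomology `HXⁿ(M)`. -/
def HXCoh : Type _ :=
  coarseCocycles M n ⧸ (coarseCoboundaries M n).submoduleOf (coarseCocycles M n)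

instance : AddCommGroup (HXCoh M n) :=
  inferInstanceAs
    (AddCommGroup (coarseCocycles M n ⧸ (coarseCoboundaries M n).submoduleOf (coarseCocycles M n)))

instance : Module ℂ (HXCoh M n) :=
  inferInstanceAs
    (Module ℂ (coarseCocycles M n ⧸ (coarseCoboundaries M n).submoduleOf (coarseCocycles M n)))

variable {M n}

/-- The class in coarse cohomology of a coarse cocycle. -/
def HXCoh.mk (θ : (Fin (n + 1) → M) → ℂ) (hθ : θ ∈ coarseCocycles M n) : HXCoh M n :=
  Submodule.Quotient.mk (p := (coarseCoboundaries M n).submoduleOf (coarseCocycles M n)) ⟨θ, hθ⟩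

/-- `f₀ ∧ ⋯ ∧ fₙ = ∑_σ sgn(σ) f_{σ 0} ⊗ ⋯ ⊗ f_{σ n}`, for the indicator functions of `Y₀, …, Yₙ`. -/
def wedge (Y : Fin (n + 1) → Set M) : (Fin (n + 1) → M) → ℂ := fun x =>
  ∑ σ : Equiv.Perm (Fin (n + 1)), ((Equiv.Perm.sign σ : ℤ) : ℂ) *
    ∏ i, (Y (σ i)).indicator (fun _ => (1 : ℂ)) (x i)

theorem coarseCycles_le : ∀ n, coarseCycles M n ≤ coarseChains M n
  | 0 => le_rfl
  | _ + 1 => fun _ h => h.1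

theorem mem_locFin (μ : coarseCycles M n) :
    (μ : Set (Fin (n + 1) → M) → ℂ) ∈ locFinMeasure (Fin (n + 1) → M) :=
  (coarseCycles_le n μ.2).1

/-- A coarse cycle as a locally finite measure. -/
def toLocFin (μ : coarseCycles M n) : locFinMeasure (Fin (n + 1) → M) := ⟨μ, mem_locFin μ⟩

/-- `⟨θ, μ⟩ = ∫ θ dμ`: with `μ` supported in `Δ_R`, the integral extends over the bounded
set `supp θ ∩ Δ_R`. -/
def cochainPairing (θ : coarseCocycles M n) (μ : coarseCycles M n) : ℂ :=
  integralOn (toLocFin μ)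
    (tsupport (θ : (Fin (n + 1) → M) → ℂ) ∩
      diagThickening M n (coarseCycles_le n μ.2).2.choose) θ

/-- `F` is the bilinear pairing of cohomology and homology classes induced by `∫ θ dμ`. -/
def IsInducedPairing (F : HXCoh M n →ₗ[ℂ] HXHom M n →ₗ[ℂ] ℂ) : Prop :=
  ∀ (θ : coarseCocycles M n) (μ : coarseCycles M n),
    F (HXCoh.mk θ θ.2) (HXHom.mk μ) = cochainPairing θ μ

variable (M n)

open Classical in
/-- The pairing `HXⁿ(M) × HXₙ(M) → ℂ` induced by `∫ θ dμ`. -/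
def classPairing : HXCoh M n →ₗ[ℂ] HXHom M n →ₗ[ℂ] ℂ :=
  if h : ∃ F : HXCoh M n →ₗ[ℂ] HXHom M n →ₗ[ℂ] ℂ, IsInducedPairing F then h.choose else 0

end Coarse

/-! ### The coarse character map -/

section Character

variable {M : Type*} [MetricSpace M] [MeasurableSpace M] [BorelSpace M]
variable {H : Type*} [NormedAddCommGroup H] [InnerProductSpace ℂ H] [CompleteSpace H]
variable (ρ : C₀(M, ℂ) →⋆ₙₐ[ℂ] (H →L[ℂ] H)) {n : ℕ}

/-- The linear map `T₀ ⊗ ⋯ ⊗ Tₙ ↦ f₀ T₀ f₁ T₁ ⋯ fₙ Tₙ`. -/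
def sandwich (f : Fin (n + 1) → M → ℂ) : Chains (algB ρ) n →ₗ[ℂ] (H →L[ℂ] H) :=
  PiTensorProduct.lift ((MultilinearMap.mkPiAlgebraFin ℂ (n + 1) (H →L[ℂ] H)).compLinearMap
    fun i => LinearMap.mulLeft ℂ (borelOp ρ (f i)) ∘ₗ (algB ρ).toSubmodule.subtype)

/-- `μ = χ(z)`: for `z = T₀ ⊗ ⋯ ⊗ Tₙ` this says that
`∫ f₀ ⊗ ⋯ ⊗ fₙ dμ = Tr(f₀ T₀ ⋯ fₙ Tₙ)` for all compactly supported continuous `f₀, …, fₙ`. -/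
def IsCharacterMeasure (z : Chains (algB ρ) n) (μ : locFinMeasure (Fin (n + 1) → M)) : Prop :=
  ∀ f : Fin (n + 1) → M → ℂ, (∀ i, Continuous (f i) ∧ HasCompactSupport (f i)) →
    integralOn μ (tsupport fun x => ∏ i, f i (x i)) (fun x => ∏ i, f i (x i)) =
      trace (sandwich ρ f z)

/-- `F` is the map on homology induced by `χ`. -/
def IsInducedCharacter (F : HC (algB ρ) n →ₗ[ℂ] HXHom M n) : Prop :=
  ∀ (z : Chains (algB ρ) n) (hz : z ∈ cyclicCycles (algB ρ) n), ∃ μ : coarseCycles M n,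
    IsCharacterMeasure ρ z (toLocFin μ) ∧ F (HC.mk z hz) = HXHom.mk μ

/-- The linear map `(λ₀ + T₀) ⊗ ⋯ ⊗ (λₙ + Tₙ) ↦ T₀ ⊗ ⋯ ⊗ Tₙ`. -/
def dropScalars (n : ℕ) : Chains (algBPlus ρ) n →ₗ[ℂ] Chains (algB ρ) n :=
  PiTensorProduct.map fun _ => Unitization.sndHom ℂ ℂ (algB ρ)

/-- `F` is the map on homology induced by the trivial extension of `χ` to the unitization. -/
def IsInducedCharacterPlus (F : HC (algBPlus ρ) n →ₗ[ℂ] HXHom M n) : Prop :=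
  ∀ (z : Chains (algBPlus ρ) n) (hz : z ∈ cyclicCycles (algBPlus ρ) n), ∃ μ : coarseCycles M n,
    IsCharacterMeasure ρ (dropScalars ρ n z) (toLocFin μ) ∧ F (HC.mk z hz) = HXHom.mk μ

variable (n)

open Classical in
/-- The coarse character map `χ_* : HCₙ(ℬ(M)) → HXₙ(M)`. -/
def coarseCharacter : HC (algB ρ) n →ₗ[ℂ] HXHom M n :=
  if h : ∃ F : HC (algB ρ) n →ₗ[ℂ] HXHom M n, IsInducedCharacter ρ F then h.choose else 0

open Classical in
/-- The coarse character map of the unitization, `HCₙ(ℬ(M)⁺) → HXₙ(M)`. -/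
def coarseCharacterPlus : HC (algBPlus ρ) n →ₗ[ℂ] HXHom M n :=
  if h : ∃ F : HC (algBPlus ρ) n →ₗ[ℂ] HXHom M n, IsInducedCharacterPlus ρ F then h.choose else 0

end Character

end CoarsePairing

end

/-!
The identities compare two finite sums of traces `Tr(B₀ T₀ B₁ T₁ ⋯ Bₙ Tₙ)` with bounded Borel sets
`Bᵢ` and locally trace-class operators `Tᵢ` of finite propagation.

*The character.* For bounded `Bᵢ` all the factors `Bᵢ Tᵢ` are trace-class. Expanding them into
rank-one operators and the matrix coefficients of Borel functions into spectral measures writes the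
trace as an absolutely convergent sum of products of finite measures, hence as the value on
`B₀ × ⋯ × Bₙ` of a complex measure (`exists_complexMeasure_trace`). These measures glue to a locally
finite measure `χ(T₀ ⊗ ⋯ ⊗ Tₙ)` (`exists_locFinMeasure_of_box`), which finite propagation supports
near the diagonal. As measures are determined by their values on boxes, identities for `χ` are
identities of traces: cyclicity of the trace is equivariance under rotations, and replacing `Bᵢ` by
`M` multiplies adjacent operators. So `χ` is a chain map modulo antisymmetry, and so is its composite
with the map that drops scalar parts, because the failure of the latter to commute with the
differentials comes from chains in the image of `1 - λ` (`exists_isBoundaryOf_chi`, `dropUnit`).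
Stokes' theorem `pairingBilin_coboundary` makes the pairing of classes well defined.

*The cocycles.* Partitions and half spaces are treated alike, the latter as the list `M, X₁, …, Xₙ`
(`IsTransverse`). The sets `Yⱼ` cut `M` into atoms, on which the membership pattern is constant, and
`Y₀ ∧ ⋯ ∧ Yₙ` at a point is the determinant of the incidence matrix of the patterns of its
coordinates (`wedge_eq_patternDet`). If the determinant is nonzero then the atoms in question are
distinct and their thickenings have bounded intersection, so that the wedge is a coarse cocycle.

*The comparison.* Expanding the indicator functions of the `Yⱼ` into those of atoms turns the
alternating sum into `∑ₑ det(e) N_{e₀} S₀ ⋯ N_{eₙ} Sₙ` over families `e` of patterns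
(`altSum_eq_sum_patternDet`). Where `det(e) ≠ 0` the atoms are disjoint, so that only the nonscalar
parts of the `Sᵢ` contribute, and by finite propagation every atom can be cut off by one bounded set
(`IsProjectionValued.chainProd_inter`). Hence the operator is trace-class, and its trace is a sum of
values of `χ` on bounded boxes (`trace_altSum`). The integral of the wedge, which is constant on
products of atoms, is the same sum (`exists_pairing_wedge_eq_sum`).

*The Chern cycles.* The faces of `tr(P ⊗ ⋯ ⊗ P)` are all equal, and those of
`tr((U - 1) ⊗ (U⁻¹ - 1) ⊗ ⋯)` telescope by `(U - 1)(U⁻¹ - 1) = -(U - 1) - (U⁻¹ - 1)`, up to the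
image of `1 - λ` (`chernIdem_mem`, `chernInv_mem`).
-/

set_option linter.unusedSectionVars false

noncomputable section

namespace CoarsePairing

open MeasureTheory Filter Topology

/-! ### Trace-class operators -/

section Nuclear

variable {E F G : Type*} [NormedAddCommGroup E] [InnerProductSpace ℂ E] [CompleteSpace E]
  [NormedAddCommGroup F] [InnerProductSpace ℂ F] [CompleteSpace F]
  [NormedAddCommGroup G] [InnerProductSpace ℂ G] [CompleteSpace G]

/-- The families `x`, `y` represent `T` as the absolutely convergent sum `∑ᵢ ⟪yᵢ, ·⟫ xᵢ` of
rank-one operators. -/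
structure IsNuclearRep {ι : Type*} (T : E →L[ℂ] F) (x : ι → F) (y : ι → E) : Prop where
  summable : Summable fun i => ‖x i‖ * ‖y i‖
  hasSum : ∀ v, HasSum (fun i => ⟪y i, v⟫_ℂ • x i) (T v)

theorem IsNuclearRep.comp_left {ι : Type*} {T : E →L[ℂ] F} {x : ι → F} {y : ι → E}
    (h : IsNuclearRep T x y) (S : F →L[ℂ] G) : IsNuclearRep (S ∘L T) (fun i => S (x i)) y where
  summable := by
    refine Summable.of_nonneg_of_le (fun i => by positivity) (fun i => ?_)
      (h.summable.mul_left ‖S‖)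
    rw [← mul_assoc]
    exact mul_le_mul_of_nonneg_right (S.le_opNorm _) (norm_nonneg _)
  hasSum v := by
    simpa using (h.hasSum v).mapL S

theorem IsNuclearRep.comp_right {ι : Type*} {T : E →L[ℂ] F} {x : ι → F} {y : ι → E}
    (h : IsNuclearRep T x y) (S : G →L[ℂ] E) :
    IsNuclearRep (T ∘L S) x (fun i => ContinuousLinearMap.adjoint S (y i)) where
  summable := by
    refine Summable.of_nonneg_of_le (fun i => by positivity) (fun i => ?_)
      (h.summable.mul_left ‖ContinuousLinearMap.adjoint S‖)
    calc ‖x i‖ * ‖ContinuousLinearMap.adjoint S (y i)‖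
        ≤ ‖x i‖ * (‖ContinuousLinearMap.adjoint S‖ * ‖y i‖) :=
          mul_le_mul_of_nonneg_left (ContinuousLinearMap.le_opNorm _ _) (norm_nonneg _)
      _ = _ := by ring
  hasSum v := by
    simpa [ContinuousLinearMap.adjoint_inner_left] using h.hasSum (S v)

theorem IsNuclearRep.isTraceClass {ι : Type*} [Countable ι] {T : E →L[ℂ] E} {x y : ι → E}
    (h : IsNuclearRep T x y) : IsTraceClass T := by
  obtain ⟨e, he⟩ := exists_injective_nat ι
  have hx : ∀ i, Function.extend e x (0 : ℕ → E) (e i) = x i := fun i => he.extend_apply x _ i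
  have hy : ∀ i, Function.extend e y (0 : ℕ → E) (e i) = y i := fun i => he.extend_apply y _ i
  have h0 : ∀ k, k ∉ Set.range e → Function.extend e x (0 : ℕ → E) k = 0 := fun k hk =>
    Function.extend_apply' x (0 : ℕ → E) k (by simpa using hk)
  refine ⟨Function.extend e x (0 : ℕ → E), Function.extend e y (0 : ℕ → E), ?_, fun v => ?_⟩
  · rw [← he.summable_iff (fun k hk => by simp [h0 k hk])]
    simpa [Function.comp_def, hx, hy] using h.summable
  · rw [← he.hasSum_iff (fun k hk => by simp [h0 k hk])]
    simpa [Function.comp_def, hx, hy] using h.hasSum v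

theorem IsTraceClass.exists_rep {T : E →L[ℂ] E} (h : IsTraceClass T) :
    ∃ x y : ℕ → E, IsNuclearRep T x y := by
  obtain ⟨x, y, h1, h2⟩ := h
  exact ⟨x, y, h1, h2⟩

theorem isTraceClass_zero : IsTraceClass (0 : E →L[ℂ] E) :=
  ⟨0, 0, by simp, fun v => by simp⟩

theorem IsTraceClass.add {S T : E →L[ℂ] E} (hS : IsTraceClass S) (hT : IsTraceClass T) :
    IsTraceClass (S + T) := by
  obtain ⟨x, y, h⟩ := hS.exists_rep
  obtain ⟨x', y', h'⟩ := hT.exists_rep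
  refine IsNuclearRep.isTraceClass (ι := ℕ ⊕ ℕ) (x := Sum.elim x x') (y := Sum.elim y y')
    ⟨?_, fun v => ?_⟩
  · exact Summable.sum _ (by simpa [Function.comp_def] using h.summable)
      (by simpa [Function.comp_def] using h'.summable)
  · exact HasSum.sum (by simpa [Function.comp_def] using h.hasSum v)
      (by simpa [Function.comp_def] using h'.hasSum v)

theorem IsTraceClass.mul_left {T : E →L[ℂ] E} (hT : IsTraceClass T) (S : E →L[ℂ] E) :
    IsTraceClass (S * T) := by
  obtain ⟨x, y, h⟩ := hT.exists_rep
  exact (h.comp_left S).isTraceClass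

theorem IsTraceClass.mul_right {T : E →L[ℂ] E} (hT : IsTraceClass T) (S : E →L[ℂ] E) :
    IsTraceClass (T * S) := by
  obtain ⟨x, y, h⟩ := hT.exists_rep
  exact (h.comp_right S).isTraceClass

theorem IsTraceClass.smul {T : E →L[ℂ] E} (hT : IsTraceClass T) (c : ℂ) :
    IsTraceClass (c • T) := by
  simpa using hT.mul_left (c • (1 : E →L[ℂ] E))

theorem isTraceClass_sum {ι : Type*} (s : Finset ι) {T : ι → E →L[ℂ] E}
    (h : ∀ i ∈ s, IsTraceClass (T i)) : IsTraceClass (∑ i ∈ s, T i) :=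
  Finset.sum_induction _ IsTraceClass (fun _ _ => .add) isTraceClass_zero h

/-- Bessel's inequality and the Cauchy-Schwarz inequality bound the sum over the basis. -/
theorem summable_norm_inner_mul_inner {ι : Type*} (b : HilbertBasis ι ℂ E) (x y : E) :
    (Summable fun e => ‖⟪y, b e⟫_ℂ‖ * ‖⟪b e, x⟫_ℂ‖) ∧
      ∑' e, ‖⟪y, b e⟫_ℂ‖ * ‖⟪b e, x⟫_ℂ‖ ≤ ‖x‖ * ‖y‖ := by
  have hs : ∀ z : E, Summable fun e => ‖⟪b e, z⟫_ℂ‖ ^ (2 : ℝ) := fun z => by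
    simpa using b.orthonormal.inner_products_summable (𝕜 := ℂ) (x := z)
  have hle : ∀ z : E, (∑' e, ‖⟪b e, z⟫_ℂ‖ ^ (2 : ℝ)) ^ (1 / (2 : ℝ)) ≤ ‖z‖ := fun z => by
    have h := b.orthonormal.tsum_inner_products_le (𝕜 := ℂ) (x := z)
    rw [← Real.sqrt_eq_rpow]
    exact Real.sqrt_le_iff.2 ⟨norm_nonneg _, by simpa using h⟩
  have hpq : (2 : ℝ).HolderConjugate 2 := Real.HolderConjugate.two_two
  have hk := Real.summable_and_inner_le_Lp_mul_Lq_tsum_of_nonneg hpq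
    (f := fun e => ‖⟪b e, y⟫_ℂ‖) (g := fun e => ‖⟪b e, x⟫_ℂ‖)
    (fun _ => norm_nonneg _) (fun _ => norm_nonneg _) (hs y) (hs x)
  have hc : ∀ e, ‖⟪y, b e⟫_ℂ‖ = ‖⟪b e, y⟫_ℂ‖ := fun e => norm_inner_symm _ _
  simp only [hc]
  refine ⟨hk.1, hk.2.trans ?_⟩
  rw [mul_comm ‖x‖]
  exact mul_le_mul (hle y) (hle x) (Real.rpow_nonneg (tsum_nonneg fun _ => by positivity) _)
    (norm_nonneg _)

/-- The double sum `∑ᵢ ∑ₑ ⟪yᵢ, e⟫ ⟪e, xᵢ⟫` converges absolutely, so it may be reordered. -/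
theorem IsNuclearRep.hasSum_inner_basis {ι w : Type*} {T : E →L[ℂ] E} {x y : ι → E}
    (h : IsNuclearRep T x y) (b : HilbertBasis w ℂ E) :
    HasSum (fun e => ⟪b e, T (b e)⟫_ℂ) (∑' i, ⟪y i, x i⟫_ℂ) := by
  have h1 : ∀ e, ⟪b e, T (b e)⟫_ℂ = ∑' i, ⟪y i, b e⟫_ℂ * ⟪b e, x i⟫_ℂ := fun e => by
    have := (h.hasSum (b e)).mapL (innerSL ℂ (b e))
    simpa [inner_smul_right] using this.tsum_eq.symm
  have h2 : ∀ i, ⟪y i, x i⟫_ℂ = ∑' e, ⟪y i, b e⟫_ℂ * ⟪b e, x i⟫_ℂ := fun i =>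
    (b.tsum_inner_mul_inner _ _).symm
  simp_rw [h1, h2]
  have hs : Summable (Function.uncurry fun (i : ι) (e : w) => ⟪y i, b e⟫_ℂ * ⟪b e, x i⟫_ℂ) := by
    apply Summable.of_norm
    rw [summable_prod_of_nonneg (fun _ => norm_nonneg _)]
    simp only [Function.uncurry, norm_mul]
    refine ⟨fun i => (summable_norm_inner_mul_inner b (x i) (y i)).1,
      Summable.of_nonneg_of_le (fun i => tsum_nonneg fun _ => by positivity) (fun i =>
        (summable_norm_inner_mul_inner b (x i) (y i)).2) h.summable⟩
  rw [← hs.tsum_comm]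
  exact hs.prod_symm.prod.hasSum

/-- The trace of `∑ᵢ ⟪yᵢ, ·⟫ xᵢ` is `∑ᵢ ⟪yᵢ, xᵢ⟫`. -/
theorem IsNuclearRep.trace_eq {ι : Type*} {T : E →L[ℂ] E} {x y : ι → E}
    (h : IsNuclearRep T x y) : trace T = ∑' i, ⟪y i, x i⟫_ℂ :=
  (h.hasSum_inner_basis _).tsum_eq

theorem IsNuclearRep.trace_comp_comm {ι : Type*} {T : E →L[ℂ] F} {x : ι → F} {y : ι → E}
    (h : IsNuclearRep T x y) (S : F →L[ℂ] E) : trace (S ∘L T) = trace (T ∘L S) := by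
  rw [(h.comp_left S).trace_eq, (h.comp_right S).trace_eq]
  simp [ContinuousLinearMap.adjoint_inner_left]

theorem IsTraceClass.trace_mul_comm {T : E →L[ℂ] E} (h : IsTraceClass T) (S : E →L[ℂ] E) :
    trace (S * T) = trace (T * S) := by
  obtain ⟨x, y, h⟩ := h.exists_rep
  exact h.trace_comp_comm S

theorem IsTraceClass.hasSum_trace {T : E →L[ℂ] E} (h : IsTraceClass T) :
    HasSum (fun e => ⟪(exists_hilbertBasis ℂ E).choose_spec.choose e,
      T ((exists_hilbertBasis ℂ E).choose_spec.choose e)⟫_ℂ) (trace T) := by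
  obtain ⟨x, y, h⟩ := h.exists_rep
  rw [h.trace_eq]
  exact h.hasSum_inner_basis _

theorem IsTraceClass.trace_add {S T : E →L[ℂ] E} (hS : IsTraceClass S) (hT : IsTraceClass T) :
    trace (S + T) = trace S + trace T := by
  refine ((hS.add hT).hasSum_trace).unique ?_
  simpa [inner_add_right] using hS.hasSum_trace.add hT.hasSum_trace

theorem trace_zero : trace (0 : E →L[ℂ] E) = 0 := by simp [trace]

theorem trace_smul (c : ℂ) (T : E →L[ℂ] E) : trace (c • T) = c * trace T := by
  simp [trace, tsum_mul_left]

theorem trace_sum {ι : Type*} (s : Finset ι) {T : ι → E →L[ℂ] E}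
    (h : ∀ i ∈ s, IsTraceClass (T i)) : trace (∑ i ∈ s, T i) = ∑ i ∈ s, trace (T i) := by
  classical
  induction s using Finset.induction_on with
  | empty => simp [trace_zero]
  | insert a s ha ih =>
    rw [Finset.sum_insert ha, Finset.sum_insert ha, IsTraceClass.trace_add, ih]
    · exact fun i hi => h i (Finset.mem_insert_of_mem hi)
    · exact h a (Finset.mem_insert_self _ _)
    · exact isTraceClass_sum s fun i hi => h i (Finset.mem_insert_of_mem hi)

/-- A representation of a trace-class operator with vectors in the unit ball and summable
coefficients. -/
theorem IsTraceClass.exists_normalized {T : E →L[ℂ] E} (h : IsTraceClass T) :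
    ∃ (c : ℕ → ℝ) (x y : ℕ → E), Summable (fun j => |c j|) ∧ (∀ j, ‖x j‖ ≤ 1) ∧ (∀ j, ‖y j‖ ≤ 1) ∧
      IsNuclearRep T (fun j => (c j : ℂ) • x j) y := by
  obtain ⟨x, y, h⟩ := h.exists_rep
  have key : ∀ z : E, ∃ w : E, ‖w‖ ≤ 1 ∧ z = (‖z‖ : ℂ) • w := fun z => by
    rcases eq_or_ne z 0 with rfl | hz
    · exact ⟨0, by simp, by simp⟩
    · have hz' : (‖z‖ : ℂ) ≠ 0 := by simpa using hz
      refine ⟨(‖z‖ : ℂ)⁻¹ • z, by simp [norm_smul, hz], by rw [smul_inv_smul₀ hz']⟩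
  choose w hw1 hw2 using key
  refine ⟨fun j => ‖x j‖ * ‖y j‖, fun j => w (x j), fun j => w (y j), ?_, fun j => hw1 _,
    fun j => hw1 _, ?_, fun v => ?_⟩
  · simpa [abs_mul] using h.summable
  · refine Summable.of_nonneg_of_le (fun i => by positivity) (fun i => ?_) h.summable
    simp only [norm_smul, Complex.norm_real, Real.norm_eq_abs, abs_mul, abs_norm]
    calc ‖x i‖ * ‖y i‖ * ‖w (x i)‖ * ‖w (y i)‖ ≤ ‖x i‖ * ‖y i‖ * 1 * 1 := by
          gcongr <;> exact hw1 _
      _ = _ := by ring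
  · convert h.hasSum v using 2 with j
    rw [Complex.ofReal_mul, mul_comm, mul_smul, ← hw2 (x j), smul_comm, ← smul_assoc]
    congr 1
    conv_rhs => rw [hw2 (y j), inner_smul_left]
    simp

end Nuclear

/-! ### Matrices of trace-class operators -/

section MatrixOp

variable {E : Type*} [NormedAddCommGroup E] [InnerProductSpace ℂ E] [CompleteSpace E] {k : ℕ}

/-- The inclusion of the `a`-th summand of `E ⊕ ⋯ ⊕ E`. -/
noncomputable def inclCLM (E : Type*) [NormedAddCommGroup E] [InnerProductSpace ℂ E]
    (a : Fin k) : E →L[ℂ] PiLp 2 (fun _ : Fin k => E) :=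
  ((PiLp.continuousLinearEquiv 2 ℂ (fun _ : Fin k => E)).symm :
      (Fin k → E) →L[ℂ] PiLp 2 (fun _ : Fin k => E)) ∘L
    ContinuousLinearMap.single ℂ (fun _ : Fin k => E) a

/-- The projection onto the `a`-th summand of `E ⊕ ⋯ ⊕ E`. -/
noncomputable def projCLM (E : Type*) [NormedAddCommGroup E] [InnerProductSpace ℂ E]
    (a : Fin k) : PiLp 2 (fun _ : Fin k => E) →L[ℂ] E :=
  ContinuousLinearMap.proj a ∘L (PiLp.continuousLinearEquiv 2 ℂ (fun _ : Fin k => E) :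
      PiLp 2 (fun _ : Fin k => E) →L[ℂ] (Fin k → E))

theorem projCLM_comp_inclCLM (a b : Fin k) :
    projCLM E a ∘L inclCLM E b = if a = b then 1 else 0 := by
  ext v
  by_cases h : a = b
  · subst h; simp [projCLM, inclCLM]
  · simp [projCLM, inclCLM, h]

theorem matrixOp_eq_sum (T : Matrix (Fin k) (Fin k) (E →L[ℂ] E)) :
    matrixOp T = ∑ a, ∑ b, inclCLM E a ∘L (T a b ∘L projCLM E b) := by
  ext v i
  simp [matrixOp, inclCLM, projCLM, Finset.sum_apply, Pi.single_apply]

theorem isTraceClass_matrixOp {T : Matrix (Fin k) (Fin k) (E →L[ℂ] E)}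
    (h : ∀ a b, IsTraceClass (T a b)) : IsTraceClass (matrixOp T) := by
  rw [matrixOp_eq_sum]
  refine isTraceClass_sum _ fun a _ => isTraceClass_sum _ fun b _ => ?_
  obtain ⟨x, y, h⟩ := (h a b).exists_rep
  exact ((h.comp_right (projCLM E b)).comp_left (inclCLM E a)).isTraceClass

theorem trace_matrixOp {T : Matrix (Fin k) (Fin k) (E →L[ℂ] E)}
    (h : ∀ a b, IsTraceClass (T a b)) : trace (matrixOp T) = ∑ a, trace (T a a) := by
  have htc : ∀ a b, IsTraceClass (inclCLM E a ∘L (T a b ∘L projCLM E b)) := fun a b => by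
    obtain ⟨x, y, h⟩ := (h a b).exists_rep
    exact ((h.comp_right (projCLM E b)).comp_left (inclCLM E a)).isTraceClass
  rw [matrixOp_eq_sum, trace_sum _ fun a _ => isTraceClass_sum _ fun b _ => htc a b]
  refine Finset.sum_congr rfl fun a _ => ?_
  rw [trace_sum _ fun b _ => htc a b]
  have : ∀ b, trace (inclCLM E a ∘L (T a b ∘L projCLM E b)) = if b = a then trace (T a b) else 0 := by
    intro b
    obtain ⟨x, y, h⟩ := (h a b).exists_rep
    rw [(h.comp_right (projCLM E b)).trace_comp_comm, ContinuousLinearMap.comp_assoc,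
      projCLM_comp_inclCLM]
    split_ifs
    · rfl
    · simp [trace_zero]
  simp [this]

end MatrixOp

/-! ### Bounded Borel functions -/

section BoundedBorel

variable {M : Type*} [MetricSpace M] [MeasurableSpace M] [BorelSpace M]

theorem IsBoundedBorel.add {f g : M → ℂ} (hf : IsBoundedBorel f) (hg : IsBoundedBorel g) :
    IsBoundedBorel (f + g) := by
  obtain ⟨h1, C, hC⟩ := hf
  obtain ⟨h2, D, hD⟩ := hg
  exact ⟨h1.add h2, C + D, fun x => (norm_add_le _ _).trans (add_le_add (hC x) (hD x))⟩

theorem IsBoundedBorel.mul {f g : M → ℂ} (hf : IsBoundedBorel f) (hg : IsBoundedBorel g) :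
    IsBoundedBorel (f * g) := by
  obtain ⟨h1, C, hC⟩ := hf
  obtain ⟨h2, D, hD⟩ := hg
  refine ⟨h1.mul h2, C * D, fun x => ?_⟩
  rw [Pi.mul_apply, norm_mul]
  exact mul_le_mul (hC x) (hD x) (norm_nonneg _) ((norm_nonneg _).trans (hC x))

theorem IsBoundedBorel.smul {f : M → ℂ} (hf : IsBoundedBorel f) (c : ℂ) :
    IsBoundedBorel (c • f) := by
  obtain ⟨h1, C, hC⟩ := hf
  refine ⟨h1.const_smul c, ‖c‖ * C, fun x => ?_⟩
  rw [Pi.smul_apply, norm_smul]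
  exact mul_le_mul_of_nonneg_left (hC x) (norm_nonneg _)

theorem isBoundedBorel_indicator {s : Set M} (hs : MeasurableSet s) :
    IsBoundedBorel (s.indicator fun _ => (1 : ℂ)) :=
  ⟨measurable_const.indicator hs, 1, fun x => by
    by_cases h : x ∈ s <;> simp [h]⟩

theorem isBoundedBorel_one : IsBoundedBorel (1 : M → ℂ) :=
  ⟨measurable_const, 1, fun x => by simp⟩

theorem isBoundedBorel_of_hasCompactSupport {f : M → ℂ} (hc : Continuous f)
    (hs : HasCompactSupport f) : IsBoundedBorel f :=
  ⟨hc.measurable, hc.bounded_above_of_compact_support hs⟩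

theorem IsBoundedBorel.integrable {f : M → ℂ} (hf : IsBoundedBorel f) (ν : Measure M)
    [IsFiniteMeasure ν] : Integrable f ν := by
  obtain ⟨h1, C, hC⟩ := hf
  exact Integrable.of_bound h1.aestronglyMeasurable C (ae_of_all _ hC)

/-- A bounded Borel function is a bounded pointwise limit of simple functions, so that a class of
functions which is linear, is closed under bounded sequential limits, and contains the indicator
functions contains all bounded Borel functions. -/
theorem IsBoundedBorel.induction_indicator {P : (M → ℂ) → Prop}
    (hind : ∀ s, MeasurableSet s → P (s.indicator fun _ => 1))
    (hadd : ∀ f g, IsBoundedBorel f → IsBoundedBorel g → P f → P g → P (f + g))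
    (hsmul : ∀ (c : ℂ) f, IsBoundedBorel f → P f → P (c • f))
    (hlim : ∀ (f : ℕ → M → ℂ) (g : M → ℂ) (C : ℝ), (∀ n, Measurable (f n)) → Measurable g →
      (∀ n x, ‖f n x‖ ≤ C) → (∀ x, ‖g x‖ ≤ C) →
      (∀ x, Tendsto (fun n => f n x) atTop (𝓝 (g x))) → (∀ n, P (f n)) → P g)
    {g : M → ℂ} (hg : IsBoundedBorel g) : P g := by
  have hsimple : ∀ f : SimpleFunc M ℂ, P f := by
    intro f
    induction f using SimpleFunc.induction with
    | const c hs =>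
      convert hsmul c _ (isBoundedBorel_indicator hs) (hind _ hs) using 1
      ext x
      simp [Set.piecewise, Set.indicator]
    | add _ hf hg =>
      refine hadd _ _ ?_ ?_ hf hg
      all_goals
        refine ⟨SimpleFunc.measurable _, ?_⟩
        exact SimpleFunc.exists_forall_norm_le _
  obtain ⟨h1, C, hC⟩ := hg
  have hC' : ∀ x, ‖g x‖ ≤ max C 0 := fun x => (hC x).trans (le_max_left _ _)
  have hsm : StronglyMeasurable g := h1.stronglyMeasurable
  exact hlim (fun n => hsm.approxBounded (max C 0) n) g (max C 0)
    (fun n => SimpleFunc.measurable _) h1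
    (fun n x => hsm.norm_approxBounded_le (le_max_right _ _) n x) hC'
    (fun x => hsm.tendsto_approxBounded_of_norm_le (hC' x)) fun n => hsimple _

/-- The indicator function of an open set is a bounded pointwise limit of continuous functions with
compact supports. -/
theorem exists_tendsto_indicator_of_isOpen [ProperSpace M] {U : Set M} (hU : IsOpen U) :
    ∃ f : ℕ → M → ℂ, (∀ n, Continuous (f n)) ∧ (∀ n, HasCompactSupport (f n)) ∧
      (∀ n x, ‖f n x‖ ≤ 1) ∧ (∀ n, ∀ x ∉ U, f n x = 0) ∧
      ∀ x, Tendsto (fun n => f n x) atTop (𝓝 (U.indicator (fun _ => 1) x)) := by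
  obtain ⟨F, hF1, hF2, hF3, hF4⟩ := hU.exists_iUnion_isClosed
  have key : ∀ n, ∃ f : C(M, ℝ), Set.EqOn f 1 (compactCovering M n ∩ F n) ∧ Set.EqOn f 0 Uᶜ ∧
      HasCompactSupport f ∧ ∀ x, f x ∈ Set.Icc (0 : ℝ) 1 := fun n =>
    exists_continuous_one_zero_of_isCompact ((isCompact_compactCovering M n).inter_right (hF1 n))
      hU.isClosed_compl
      (Set.disjoint_compl_right_iff_subset.2 (Set.inter_subset_right.trans (hF2 n)))
  choose f h1 h2 h3 h4 using key
  refine ⟨fun n x => f n x, fun n => by fun_prop, fun n => ?_, fun n x => ?_, fun n x hx => ?_,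
    fun x => ?_⟩
  · exact (h3 n).comp_left (g := fun r : ℝ => (r : ℂ)) (by simp)
  · simpa [abs_of_nonneg (h4 n x).1] using (h4 n x).2
  · have := h2 n hx
    simpa using this
  · by_cases hx : x ∈ U
    · have hx' := hx
      rw [← hF3] at hx'
      obtain ⟨i, hi⟩ := Set.mem_iUnion.1 hx'
      obtain ⟨j, hj⟩ := exists_mem_compactCovering x
      refine tendsto_const_nhds.congr' ?_
      filter_upwards [eventually_ge_atTop (max i j)] with n hn
      have : x ∈ compactCovering M n ∩ F n :=
        ⟨compactCovering_subset M ((le_max_right _ _).trans hn) hj,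
          hF4 ((le_max_left _ _).trans hn) hi⟩
      have := h1 n this
      simp [hx, this]
    · have : ∀ n, f n x = 0 := fun n => h2 n hx
      simp [hx, this]

/-- A class of functions that is linear, closed under bounded sequential limits, and contains the
continuous functions with compact supports contains all bounded Borel functions. -/
theorem IsBoundedBorel.induction [ProperSpace M] {P : (M → ℂ) → Prop}
    (hcont : ∀ f, Continuous f → HasCompactSupport f → P f)
    (hadd : ∀ f g, IsBoundedBorel f → IsBoundedBorel g → P f → P g → P (f + g))
    (hsmul : ∀ (c : ℂ) f, IsBoundedBorel f → P f → P (c • f))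
    (hlim : ∀ (f : ℕ → M → ℂ) (g : M → ℂ) (C : ℝ), (∀ n, Measurable (f n)) → Measurable g →
      (∀ n x, ‖f n x‖ ≤ C) → (∀ x, ‖g x‖ ≤ C) →
      (∀ x, Tendsto (fun n => f n x) atTop (𝓝 (g x))) → (∀ n, P (f n)) → P g)
    {g : M → ℂ} (hg : IsBoundedBorel g) : P g := by
  have hopen : ∀ U : Set M, IsOpen U → P (U.indicator fun _ => 1) := fun U hU => by
    obtain ⟨f, h1, h2, h3, -, h4⟩ := exists_tendsto_indicator_of_isOpen hU
    refine hlim f _ 1 (fun n => (h1 n).measurable) (measurable_const.indicator hU.measurableSet)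
      h3 (fun x => ?_) h4 fun n => hcont _ (h1 n) (h2 n)
    by_cases h : x ∈ U <;> simp [h]
  have hone : P 1 := by
    have := hopen _ isOpen_univ
    rwa [Set.indicator_univ] at this
  refine IsBoundedBorel.induction_indicator (fun s hs => ?_) hadd hsmul hlim hg
  induction s, hs using MeasurableSpace.induction_on_inter
    (s := {s : Set M | IsOpen s}) BorelSpace.measurable_eq isPiSystem_isOpen with
  | empty => exact hopen _ isOpen_empty
  | basic t ht => exact hopen t ht
  | compl t htm ht =>
    convert hadd _ _ isBoundedBorel_one ((isBoundedBorel_indicator htm).smul (-1)) hone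
      (hsmul (-1) _ (isBoundedBorel_indicator htm) ht) using 1
    ext x
    by_cases h : x ∈ t <;> simp [h]
  | iUnion A hd hm hA =>
    have hpart : ∀ n, IsBoundedBorel (∑ i ∈ Finset.range n, (A i).indicator fun _ => (1 : ℂ)) ∧
        P (∑ i ∈ Finset.range n, (A i).indicator fun _ => (1 : ℂ)) := fun n => by
      induction n with
      | zero =>
        have := hopen _ isOpen_empty
        have hb := isBoundedBorel_indicator (MeasurableSet.empty (α := M))
        rw [Set.indicator_empty] at this hb
        exact ⟨hb, this⟩
      | succ n ih =>
        rw [Finset.sum_range_succ]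
        exact ⟨ih.1.add (isBoundedBorel_indicator (hm n)),
          hadd _ _ ih.1 (isBoundedBorel_indicator (hm n)) ih.2 (hA n)⟩
    have heq : ∀ n, (∑ i ∈ Finset.range n, (A i).indicator fun _ => (1 : ℂ)) =
        (⋃ i ∈ Finset.range n, A i).indicator fun _ => 1 := fun n => by
      ext x
      rw [Finset.indicator_biUnion _ _ (fun i _ j _ hij => hd hij), Finset.sum_apply]
    refine hlim _ _ 1 (fun n => (hpart n).1.1) (measurable_const.indicator (.iUnion hm))
      (fun n x => ?_) (fun x => ?_) (fun x => ?_) fun n => (hpart n).2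
    · rw [heq]
      by_cases h : x ∈ ⋃ i ∈ Finset.range n, A i <;> simp only [h, Set.indicator_of_mem,
        Set.indicator_of_notMem, not_false_eq_true, norm_one, norm_zero, le_refl, zero_le_one]
    · by_cases h : x ∈ ⋃ i, A i <;> simp only [h, Set.indicator_of_mem,
        Set.indicator_of_notMem, not_false_eq_true, norm_one, norm_zero, le_refl, zero_le_one]
    · simp only [heq]
      by_cases h : x ∈ ⋃ i, A i
      · obtain ⟨i, hi⟩ := Set.mem_iUnion.1 h
        refine tendsto_const_nhds.congr' ?_
        filter_upwards [eventually_gt_atTop i] with n hn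
        have : x ∈ ⋃ i ∈ Finset.range n, A i := by
          simp only [Set.mem_iUnion]
          exact ⟨i, by simpa using hn, hi⟩
        simp only [h, this, Set.indicator_of_mem]
      · have : ∀ n, x ∉ ⋃ i ∈ Finset.range n, A i := fun n hx => h (by
          simp only [Set.mem_iUnion] at hx ⊢
          obtain ⟨i, -, hi⟩ := hx
          exact ⟨i, hi⟩)
        simp only [h, this, not_false_eq_true, Set.indicator_of_notMem]
        exact tendsto_const_nhds

/-- Linear functionals on the bounded Borel functions that are continuous for bounded sequential
limits. -/
structure IsSigmaFunctional (Φ : (M → ℂ) → ℂ) : Prop where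
  add : ∀ f g, IsBoundedBorel f → IsBoundedBorel g → Φ (f + g) = Φ f + Φ g
  smul : ∀ (c : ℂ) f, IsBoundedBorel f → Φ (c • f) = c * Φ f
  lim : ∀ (f : ℕ → M → ℂ) (g : M → ℂ) (C : ℝ), (∀ n, Measurable (f n)) → Measurable g →
      (∀ n x, ‖f n x‖ ≤ C) → (∀ x, ‖g x‖ ≤ C) →
      (∀ x, Tendsto (fun n => f n x) atTop (𝓝 (g x))) →
      Tendsto (fun n => Φ (f n)) atTop (𝓝 (Φ g))

theorem IsSigmaFunctional.ext [ProperSpace M] {Φ Ψ : (M → ℂ) → ℂ} (hΦ : IsSigmaFunctional Φ)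
    (hΨ : IsSigmaFunctional Ψ) (h : ∀ f, Continuous f → HasCompactSupport f → Φ f = Ψ f)
    {g : M → ℂ} (hg : IsBoundedBorel g) : Φ g = Ψ g := by
  refine IsBoundedBorel.induction (P := fun g => Φ g = Ψ g) h (fun f g hf hg h1 h2 => ?_)
    (fun c f hf h1 => ?_) (fun f g C h1 h2 h3 h4 h5 h6 => ?_) hg
  · rw [hΦ.add _ _ hf hg, hΨ.add _ _ hf hg, h1, h2]
  · rw [hΦ.smul _ _ hf, hΨ.smul _ _ hf, h1]
  · have := hΦ.lim f g C h1 h2 h3 h4 h5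
    simp_rw [h6] at this
    exact tendsto_nhds_unique this (hΨ.lim f g C h1 h2 h3 h4 h5)

theorem IsSigmaFunctional.add' {Φ Ψ : (M → ℂ) → ℂ} (hΦ : IsSigmaFunctional Φ)
    (hΨ : IsSigmaFunctional Ψ) : IsSigmaFunctional fun g => Φ g + Ψ g where
  add f g hf hg := by rw [hΦ.add f g hf hg, hΨ.add f g hf hg]; ring
  smul c f hf := by rw [hΦ.smul c f hf, hΨ.smul c f hf]; ring
  lim f g C h1 h2 h3 h4 h5 := (hΦ.lim f g C h1 h2 h3 h4 h5).add (hΨ.lim f g C h1 h2 h3 h4 h5)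

theorem IsSigmaFunctional.const_mul {Φ : (M → ℂ) → ℂ} (hΦ : IsSigmaFunctional Φ) (a : ℂ) :
    IsSigmaFunctional fun g => a * Φ g where
  add f g hf hg := by rw [hΦ.add f g hf hg]; ring
  smul c f hf := by rw [hΦ.smul c f hf]; ring
  lim f g C h1 h2 h3 h4 h5 := (hΦ.lim f g C h1 h2 h3 h4 h5).const_mul a

theorem IsSigmaFunctional.comp_mul {Φ : (M → ℂ) → ℂ} (hΦ : IsSigmaFunctional Φ) {h : M → ℂ}
    (hh : IsBoundedBorel h) : IsSigmaFunctional fun g => Φ (g * h) where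
  add f g hf hg := by rw [add_mul, hΦ.add _ _ (hf.mul hh) (hg.mul hh)]
  smul c f hf := by rw [smul_mul_assoc, hΦ.smul c _ (hf.mul hh)]
  lim f g C h1 h2 h3 h4 h5 := by
    obtain ⟨k1, D, hD⟩ := hh
    have hb : ∀ a x, ‖a‖ ≤ C → ‖a * h x‖ ≤ C * D := fun a x ha => by
      rw [norm_mul]
      exact mul_le_mul ha (hD x) (norm_nonneg _) ((norm_nonneg _).trans ha)
    exact hΦ.lim _ _ (C * D) (fun n => (h1 n).mul k1) (h2.mul k1) (fun n x => hb _ _ (h3 n x))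
      (fun x => hb _ _ (h4 x)) fun x => (h5 x).mul_const _

theorem isSigmaFunctional_integral (ν : Measure M) [IsFiniteMeasure ν] :
    IsSigmaFunctional fun g => ∫ x, g x ∂ν where
  add _ _ hf hg := integral_add (hf.integrable ν) (hg.integrable ν)
  smul c f _ := integral_const_mul c f
  lim _ _ C h1 _ h3 _ h5 :=
    tendsto_integral_of_dominated_convergence (fun _ => C)
      (fun n => (h1 n).aestronglyMeasurable) (integrable_const C) (fun n => ae_of_all _ (h3 n))
      (ae_of_all _ h5)

end BoundedBorel

/-! ### The Borel functional calculus of a representation -/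

section Spectral

variable {M : Type*} [MetricSpace M] [ProperSpace M] [MeasurableSpace M] [BorelSpace M]
variable {H : Type*} [NormedAddCommGroup H] [InnerProductSpace ℂ H] [CompleteSpace H]
variable (ρ : C₀(M, ℂ) →⋆ₙₐ[ℂ] (H →L[ℂ] H))

/-- A continuous function with compact support as an element of `C₀(M)`. -/
def ofCompactSupport (f : M → ℂ) (hc : Continuous f) (hs : HasCompactSupport f) : C₀(M, ℂ) :=
  ⟨⟨f, hc⟩, hs.is_zero_at_infty⟩

/-- A real continuous function with compact support as an element of `C₀(M)`. -/
def ofCcReal : CompactlySupportedContinuousMap M ℝ →ₗ[ℝ] C₀(M, ℂ) where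
  toFun f := ofCompactSupport (fun x => (f x : ℂ)) (by fun_prop)
    (f.hasCompactSupport.comp_left (g := fun r : ℝ => (r : ℂ)) (by simp))
  map_add' f g := by ext x; simp [ofCompactSupport]
  map_smul' c f := by ext x; simp [ofCompactSupport]

/-- `ρ(f)` is positive for `f ≥ 0`, since `ρ(f) = ρ(√f)^* ρ(√f)`. -/
theorem inner_self_of_nonneg (v : H) (f : CompactlySupportedContinuousMap M ℝ) (hf : 0 ≤ f) :
    ⟪v, ρ (ofCcReal f) v⟫_ℂ =
      ((‖ρ (ofCcReal (f.compLeft ⟨Real.sqrt, Real.continuous_sqrt⟩)) v‖ ^ 2 : ℝ) : ℂ) := by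
  set g : CompactlySupportedContinuousMap M ℝ := f.compLeft ⟨Real.sqrt, Real.continuous_sqrt⟩
  have hg : ∀ x, g x = √(f x) := fun x =>
    CompactlySupportedContinuousMap.compLeft_apply (g := ⟨Real.sqrt, Real.continuous_sqrt⟩)
      Real.sqrt_zero f x
  have h1 : ofCcReal f = star (ofCcReal g) * ofCcReal g := by
    ext x
    have := Real.mul_self_sqrt (hf x)
    simp only [ofCcReal, ofCompactSupport, LinearMap.coe_mk, AddHom.coe_mk,
      ZeroAtInftyContinuousMap.coe_mul, Pi.mul_apply, ZeroAtInftyContinuousMap.coe_star,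
      Pi.star_apply]
    change ((f x : ℝ) : ℂ) = star ((g x : ℝ) : ℂ) * ((g x : ℝ) : ℂ)
    rw [hg]
    simp only [Complex.star_def, Complex.conj_ofReal]
    exact_mod_cast this.symm
  rw [h1, map_mul, map_star, mul_apply_eq_comp, ContinuousLinearMap.star_eq_adjoint,
    ContinuousLinearMap.adjoint_inner_right, inner_self_eq_norm_sq_to_K]
  simp

/-- The positive functional `f ↦ ⟪v, ρ(f) v⟫` on the real continuous functions with compact
supports. -/
def spectralFunctional (v : H) : CompactlySupportedContinuousMap M ℝ →ₚ[ℝ] ℝ :=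
  PositiveLinearMap.mk₀
    { toFun := fun f => (⟪v, ρ (ofCcReal f) v⟫_ℂ).re
      map_add' := fun f g => by
        rw [map_add, map_add, add_apply, inner_add_right, Complex.add_re]
      map_smul' := fun c f => by
        have : ρ (ofCcReal (c • f)) = (c : ℂ) • ρ (ofCcReal f) := by
          rw [← map_smul]
          congr 1
          ext x
          simp [ofCcReal, ofCompactSupport]
        rw [this]
        simp }
    (fun f hf => by
      change 0 ≤ (⟪v, ρ (ofCcReal f) v⟫_ℂ).re
      rw [inner_self_of_nonneg ρ v f hf, Complex.ofReal_re]
      positivity)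

theorem spectralFunctional_apply (v : H) (f : CompactlySupportedContinuousMap M ℝ) :
    ((spectralFunctional ρ v f : ℝ) : ℂ) = ⟪v, ρ (ofCcReal f) v⟫_ℂ := by
  change (((⟪v, ρ (ofCcReal f) v⟫_ℂ).re : ℝ) : ℂ) = _
  have h : star (ofCcReal f) = ofCcReal f := by
    ext x
    simp [ofCcReal, ofCompactSupport]
  have h2 : (starRingEnd ℂ) ⟪v, ρ (ofCcReal f) v⟫_ℂ = ⟪v, ρ (ofCcReal f) v⟫_ℂ := by
    rw [inner_conj_symm, ← ContinuousLinearMap.adjoint_inner_right,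
      ← ContinuousLinearMap.star_eq_adjoint, ← map_star, h]
  exact Complex.conj_eq_iff_re.1 h2

/-- A `*`-homomorphism between C*-algebras is contractive. -/
theorem norm_inner_map_le (v : H) (f : C₀(M, ℂ)) : ‖⟪v, ρ f v⟫_ℂ‖ ≤ ‖f‖ * ‖v‖ ^ 2 := by
  calc ‖⟪v, ρ f v⟫_ℂ‖ ≤ ‖v‖ * ‖ρ f v‖ := norm_inner_le_norm _ _
    _ ≤ ‖v‖ * (‖ρ f‖ * ‖v‖) := by gcongr; exact ContinuousLinearMap.le_opNorm _ _
    _ ≤ ‖v‖ * (‖f‖ * ‖v‖) := by gcongr; exact NonUnitalStarAlgHom.norm_apply_le ρ f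
    _ = _ := by ring

theorem norm_le_of_forall {f : C₀(M, ℂ)} {C : ℝ} (hC : 0 ≤ C) (h : ∀ x, ‖f x‖ ≤ C) : ‖f‖ ≤ C := by
  rw [← ZeroAtInftyContinuousMap.norm_toBCF_eq_norm, BoundedContinuousFunction.norm_le hC]
  exact h

/-- The measure of a compact set is at most `⟪v, ρ(f) v⟫` for a cutoff function `f`. -/
theorem isFiniteMeasure_rieszMeasure (v : H) :
    IsFiniteMeasure (RealRMK.rieszMeasure (spectralFunctional ρ v)) := by
  refine ⟨lt_of_le_of_lt ?_ (ENNReal.ofReal_lt_top (r := ‖v‖ ^ 2))⟩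
  have : (RealRMK.rieszMeasure (spectralFunctional ρ v)).Regular :=
    inferInstanceAs (NNRealRMK.rieszMeasure _).Regular
  rw [isOpen_univ.measure_eq_iSup_isCompact]
  refine iSup_le fun K => iSup_le fun _ => iSup_le fun hK => ?_
  obtain ⟨f, h1, -, h3, h4⟩ := exists_continuous_one_zero_of_isCompact hK isClosed_empty
    (Set.disjoint_empty K)
  set F : CompactlySupportedContinuousMap M ℝ := ⟨f, h3⟩
  refine (RealRMK.rieszMeasure_le_of_eq_one (f := F) _ (fun x => (h4 x).1) hK
    fun x hx => h1 hx).trans (ENNReal.ofReal_le_ofReal ?_)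
  have hF : ‖ofCcReal F‖ ≤ 1 := norm_le_of_forall zero_le_one fun x => by
    simpa [ofCcReal, ofCompactSupport, F, abs_of_nonneg (h4 x).1] using (h4 x).2
  calc spectralFunctional ρ v F ≤ ‖((spectralFunctional ρ v F : ℝ) : ℂ)‖ := by
        rw [Complex.norm_real]; exact le_abs_self _
    _ ≤ ‖ofCcReal F‖ * ‖v‖ ^ 2 := by
        rw [spectralFunctional_apply]; exact norm_inner_map_le _ _ _
    _ ≤ 1 * ‖v‖ ^ 2 := by gcongr
    _ = _ := one_mul _

/-- Functions with compact support are dense in `C₀(M)`. -/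
theorem exists_norm_sub_lt (f : C₀(M, ℂ)) {ε : ℝ} (hε : 0 < ε) :
    ∃ (g : C₀(M, ℂ)), HasCompactSupport g ∧ ‖f - g‖ ≤ ε := by
  have hc : IsCompact {x | ε ≤ ‖f x‖} := by
    have h := (tendsto_zero_iff_norm_tendsto_zero.1 (zero_at_infty f)).eventually
      (gt_mem_nhds hε)
    obtain ⟨K, hK, hK2⟩ := mem_cocompact.1 h
    refine hK.of_isClosed_subset (isClosed_le continuous_const (by fun_prop)) fun x hx => ?_
    by_contra hxK
    have : ‖f x‖ < ε := hK2 hxK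
    exact absurd hx (not_le.2 this)
  obtain ⟨c, h1, -, h3, h4⟩ := exists_continuous_one_zero_of_isCompact hc isClosed_empty
    (Set.disjoint_empty _)
  have hs : HasCompactSupport (fun x => f x * (c x : ℂ)) :=
    (h3.comp_left (g := fun r : ℝ => (r : ℂ)) (by simp)).mul_left
  refine ⟨ofCompactSupport (fun x => f x * (c x : ℂ)) (by fun_prop) hs, hs, ?_⟩
  refine norm_le_of_forall hε.le fun x => ?_
  change ‖f x - f x * (c x : ℂ)‖ ≤ ε
  by_cases hx : ε ≤ ‖f x‖
  · have : c x = 1 := h1 hx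
    simp [this, hε.le]
  · have h5 : f x - f x * (c x : ℂ) = f x * ((1 - c x : ℝ) : ℂ) := by push_cast; ring
    rw [h5, norm_mul, Complex.norm_real, Real.norm_eq_abs]
    have h6 : |1 - c x| ≤ 1 := abs_le.2 ⟨by linarith [(h4 x).2], by linarith [(h4 x).1]⟩
    calc ‖f x‖ * |1 - c x| ≤ ε * 1 := by
          apply mul_le_mul (not_le.1 hx).le h6 (abs_nonneg _) hε.le
      _ = ε := mul_one _

/-- The Riesz representation theorem gives the measure for `f ∈ C_c(M)`; both sides are continuous
in `f` for the supremum norm. -/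
theorem exists_isSpectralMeasure (v : H) : ∃ ν : Measure M, IsSpectralMeasure ρ v ν := by
  set ν := RealRMK.rieszMeasure (spectralFunctional ρ v)
  have hfin : IsFiniteMeasure ν := isFiniteMeasure_rieszMeasure ρ v
  have hreal : ∀ f : CompactlySupportedContinuousMap M ℝ,
      ⟪v, ρ (ofCcReal f) v⟫_ℂ = ∫ x, (f x : ℂ) ∂ν := fun f => by
    rw [← spectralFunctional_apply, ← RealRMK.integral_rieszMeasure, integral_complex_ofReal]
  have hcc : ∀ f : C₀(M, ℂ), HasCompactSupport f → ⟪v, ρ f v⟫_ℂ = ∫ x, f x ∂ν := fun f hf => by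
    set a : CompactlySupportedContinuousMap M ℝ := ⟨⟨fun x => (f x).re, by fun_prop⟩,
      hf.comp_left (g := Complex.re) (by simp)⟩
    set b : CompactlySupportedContinuousMap M ℝ := ⟨⟨fun x => (f x).im, by fun_prop⟩,
      hf.comp_left (g := Complex.im) (by simp)⟩
    have h1 : f = ofCcReal a + Complex.I • ofCcReal b := by
      ext x
      change f x = (((f x).re : ℝ) : ℂ) + Complex.I * (((f x).im : ℝ) : ℂ)
      rw [mul_comm, Complex.re_add_im]
    have h2 : ∀ x, f x = (a x : ℂ) + Complex.I * (b x : ℂ) := fun x => by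
      change f x = (((f x).re : ℝ) : ℂ) + Complex.I * (((f x).im : ℝ) : ℂ)
      rw [mul_comm, Complex.re_add_im]
    have hi : ∀ g : CompactlySupportedContinuousMap M ℝ, Integrable (fun x => (g x : ℂ)) ν :=
      fun g => (g.continuous.integrable_of_hasCompactSupport g.hasCompactSupport).ofReal
    simp_rw [h2]
    rw [integral_add (hi a) ((hi b).const_mul _), integral_const_mul, ← hreal, ← hreal]
    conv_lhs => rw [h1]
    rw [map_add, map_smul, add_apply, inner_add_right,
      smul_apply, inner_smul_right]
  refine ⟨ν, hfin, fun f => ?_⟩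
  have hint : ∀ g : C₀(M, ℂ), Integrable g ν := fun g =>
    Integrable.of_bound g.continuous.aestronglyMeasurable ‖g‖ (ae_of_all _ fun x => by
      rw [← ZeroAtInftyContinuousMap.norm_toBCF_eq_norm]
      exact BoundedContinuousFunction.norm_coe_le_norm g.toBCF x)
  refine eq_of_forall_dist_le fun ε hε => ?_
  set K : ℝ := ‖v‖ ^ 2 + ν.real Set.univ + 1
  have hK : 0 < K := by positivity
  obtain ⟨g, hg, hfg⟩ := exists_norm_sub_lt f (div_pos hε hK)
  have e1 : ⟪v, ρ f v⟫_ℂ = ⟪v, ρ (f - g) v⟫_ℂ + ⟪v, ρ g v⟫_ℂ := by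
    rw [← inner_add_right, ← add_apply, ← map_add, sub_add_cancel]
  have e2 : ∫ x, f x ∂ν = ∫ x, (f - g) x ∂ν + ∫ x, g x ∂ν := by
    rw [← integral_add (hint _) (hint _)]
    simp
  rw [e1, e2, hcc g hg, dist_add_right, dist_eq_norm]
  have hb : ‖∫ x, (f - g) x ∂ν‖ ≤ ‖f - g‖ * ν.real Set.univ :=
    norm_integral_le_of_norm_le_const (ae_of_all _ fun x => by
      rw [← ZeroAtInftyContinuousMap.norm_toBCF_eq_norm]
      exact BoundedContinuousFunction.norm_coe_le_norm (f - g).toBCF x)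
  calc _ ≤ ‖⟪v, ρ (f - g) v⟫_ℂ‖ + ‖∫ x, (f - g) x ∂ν‖ := norm_sub_le _ _
    _ ≤ ‖f - g‖ * ‖v‖ ^ 2 + ‖f - g‖ * ν.real Set.univ :=
        add_le_add (norm_inner_map_le _ _ _) hb
    _ = ‖f - g‖ * (K - 1) := by simp only [K]; ring
    _ ≤ (ε / K) * K := mul_le_mul hfg (by linarith) (by
        have : 0 ≤ ‖v‖ ^ 2 + ν.real Set.univ := by positivity
        simp only [K]; linarith) (by positivity)
    _ = ε := div_mul_cancel₀ _ hK.ne'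

theorem IsSpectralMeasure.unique {v : H} {ν ν' : Measure M} (h : IsSpectralMeasure ρ v ν)
    (h' : IsSpectralMeasure ρ v ν') : ν = ν' := by
  have := h.1
  have := h'.1
  refine Measure.ext_of_integral_eq_on_compactlySupported fun f => ?_
  have e := (h.2 (ofCcReal f)).symm.trans (h'.2 (ofCcReal f))
  have e' : ∫ x, ((f x : ℝ) : ℂ) ∂ν = ∫ x, ((f x : ℝ) : ℂ) ∂ν' := e
  rw [integral_complex_ofReal, integral_complex_ofReal] at e'
  exact_mod_cast e'

/-- The spectral measure of the vector `v`. -/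
def spectralMeasure (v : H) : Measure M := (exists_isSpectralMeasure ρ v).choose

theorem isSpectralMeasure_spectralMeasure (v : H) :
    IsSpectralMeasure ρ v (spectralMeasure ρ v) := (exists_isSpectralMeasure ρ v).choose_spec

instance (v : H) : IsFiniteMeasure (spectralMeasure ρ v) :=
  (isSpectralMeasure_spectralMeasure ρ v).1

/-- The sesquilinear form obtained by polarization from the quadratic form `v ↦ ∫ g dν_v`. -/
def spectralForm (g : M → ℂ) (v w : H) : ℂ :=
  4⁻¹ * ((∫ x, g x ∂(spectralMeasure ρ (v + w)) + (-1) * ∫ x, g x ∂(spectralMeasure ρ (v - w))) +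
    ((-Complex.I) * ∫ x, g x ∂(spectralMeasure ρ (v + Complex.I • w)) +
      Complex.I * ∫ x, g x ∂(spectralMeasure ρ (v - Complex.I • w))))

/-- For fixed vectors the form is a combination of four integrals. -/
theorem isSigmaFunctional_spectralForm (v w : H) :
    IsSigmaFunctional fun g : M → ℂ => spectralForm ρ g v w :=
  (((isSigmaFunctional_integral _).add' ((isSigmaFunctional_integral _).const_mul _)).add'
    (((isSigmaFunctional_integral _).const_mul _).add'
      ((isSigmaFunctional_integral _).const_mul _))).const_mul _

theorem inner_polarization (T : H →L[ℂ] H) (v w : H) :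
    ⟪v, T w⟫_ℂ = 4⁻¹ * ((⟪v + w, T (v + w)⟫_ℂ + (-1) * ⟪v - w, T (v - w)⟫_ℂ) +
      ((-Complex.I) * ⟪v + Complex.I • w, T (v + Complex.I • w)⟫_ℂ +
        Complex.I * ⟪v - Complex.I • w, T (v - Complex.I • w)⟫_ℂ)) := by
  have hI : Complex.I * Complex.I = -1 := Complex.I_mul_I
  simp only [map_add, map_sub, map_smul, inner_add_left, inner_add_right, inner_sub_left,
    inner_sub_right, inner_smul_left, inner_smul_right, Complex.conj_I]
  linear_combination ((1 / 2 : ℂ) * ⟪v, T w⟫_ℂ - (1 / 2 : ℂ) * ⟪w, T v⟫_ℂ) * hI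

theorem spectralForm_of_C0 (f : C₀(M, ℂ)) (v w : H) : spectralForm ρ f v w = ⟪v, ρ f w⟫_ℂ := by
  rw [inner_polarization, spectralForm]
  simp only [(isSpectralMeasure_spectralMeasure ρ _).2]

theorem spectralForm_of_cont {f : M → ℂ} (hc : Continuous f) (hs : HasCompactSupport f) (v w : H) :
    spectralForm ρ f v w = ⟪v, ρ (ofCompactSupport f hc hs) w⟫_ℂ :=
  spectralForm_of_C0 ρ (ofCompactSupport f hc hs) v w

variable {g : M → ℂ} (hg : IsBoundedBorel g)
include hg

theorem spectralForm_self (v : H) : spectralForm ρ g v v = ∫ x, g x ∂(spectralMeasure ρ v) := by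
  refine (isSigmaFunctional_spectralForm ρ v v).ext (isSigmaFunctional_integral _)
    (fun f hc hs => ?_) hg
  rw [spectralForm_of_cont ρ hc hs]
  exact (isSpectralMeasure_spectralMeasure ρ v).2 _

/-- Additivity is an identity between functionals of `g` that are continuous for bounded limits, and
it holds for `g ∈ C_c(M)`. -/
theorem spectralForm_add_right (v w w' : H) :
    spectralForm ρ g v (w + w') = spectralForm ρ g v w + spectralForm ρ g v w' := by
  refine (isSigmaFunctional_spectralForm ρ _ _).ext ((isSigmaFunctional_spectralForm ρ _ _).add'
    (isSigmaFunctional_spectralForm ρ _ _)) (fun f hc hs => ?_) hg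
  simp only [spectralForm_of_cont ρ hc hs, map_add, inner_add_right]

theorem spectralForm_add_left (v v' w : H) :
    spectralForm ρ g (v + v') w = spectralForm ρ g v w + spectralForm ρ g v' w := by
  refine (isSigmaFunctional_spectralForm ρ _ _).ext ((isSigmaFunctional_spectralForm ρ _ _).add'
    (isSigmaFunctional_spectralForm ρ _ _)) (fun f hc hs => ?_) hg
  simp only [spectralForm_of_cont ρ hc hs, inner_add_left]

theorem spectralForm_smul_right (c : ℂ) (v w : H) :
    spectralForm ρ g v (c • w) = c * spectralForm ρ g v w := by
  refine (isSigmaFunctional_spectralForm ρ _ _).ext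
    ((isSigmaFunctional_spectralForm ρ _ _).const_mul c) (fun f hc hs => ?_) hg
  simp only [spectralForm_of_cont ρ hc hs, map_smul, inner_smul_right]

theorem spectralForm_smul_left (c : ℂ) (v w : H) :
    spectralForm ρ g (c • v) w = starRingEnd ℂ c * spectralForm ρ g v w := by
  refine (isSigmaFunctional_spectralForm ρ _ _).ext
    ((isSigmaFunctional_spectralForm ρ _ _).const_mul _) (fun f hc hs => ?_) hg
  simp only [spectralForm_of_cont ρ hc hs, inner_smul_left]

omit hg in
theorem norm_integral_spectralMeasure_le {C : ℝ} (hC : ∀ x, ‖g x‖ ≤ C) (v : H) :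
    ‖∫ x, g x ∂(spectralMeasure ρ v)‖ ≤ C * (spectralMeasure ρ v).real Set.univ :=
  norm_integral_le_of_norm_le_const (ae_of_all _ hC)

omit hg in
theorem spectralMeasure_univ_le (v : H) : (spectralMeasure ρ v).real Set.univ ≤ ‖v‖ ^ 2 := by
  have h : ∫ x, (1 : M → ℂ) x ∂(spectralMeasure ρ v) = (spectralMeasure ρ v).real Set.univ := by
    simp
  obtain ⟨f, h1, h2, h3, -, h4⟩ := exists_tendsto_indicator_of_isOpen (M := M) isOpen_univ
  have ht := ((isSigmaFunctional_integral (spectralMeasure ρ v)).lim f 1 1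
    (fun n => (h1 n).measurable) measurable_const h3 (fun x => by simp)
    (fun x => by simpa using h4 x)).norm
  refine (le_of_tendsto ht (Eventually.of_forall fun n => ?_)).trans' ?_
  · have := (isSpectralMeasure_spectralMeasure ρ v).2 (ofCompactSupport (f n) (h1 n) (h2 n))
    change _ = ∫ x, f n x ∂_ at this
    rw [← this]
    refine (norm_inner_map_le ρ v _).trans ?_
    have : ‖ofCompactSupport (f n) (h1 n) (h2 n)‖ ≤ 1 := norm_le_of_forall zero_le_one (h3 n)
    nlinarith [sq_nonneg ‖v‖]
  · rw [h, Complex.norm_real]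
    exact le_abs_self _

/-- The quadratic form is bounded by `sup |g| ‖v‖²`; polarization on unit vectors costs a factor `4`. -/
theorem exists_norm_spectralForm_le :
    ∃ C, ∀ v w : H, ‖spectralForm ρ g v w‖ ≤ C * ‖v‖ * ‖w‖ := by
  obtain ⟨C, hC⟩ := hg.2
  have hC0 : ∀ x, ‖g x‖ ≤ max C 0 := fun x => (hC x).trans (le_max_left _ _)
  set D := max C 0
  have hD : 0 ≤ D := le_max_right _ _
  have hq : ∀ v : H, ‖∫ x, g x ∂(spectralMeasure ρ v)‖ ≤ D * ‖v‖ ^ 2 := fun v =>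
    (norm_integral_spectralMeasure_le ρ hC0 v).trans
      (mul_le_mul_of_nonneg_left (spectralMeasure_univ_le ρ v) hD)
  have h1 : ∀ v w : H, ‖spectralForm ρ g v w‖ ≤ D * (‖v‖ + ‖w‖) ^ 2 := fun v w => by
    have hs : ∀ u : H, ‖u‖ ≤ ‖v‖ + ‖w‖ →
        ‖∫ x, g x ∂(spectralMeasure ρ u)‖ ≤ D * (‖v‖ + ‖w‖) ^ 2 := fun u hu =>
      (hq u).trans (by gcongr)
    have a1 := hs (v + w) (norm_add_le _ _)
    have a2 := hs (v - w) (norm_sub_le _ _)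
    have a3 := hs (v + Complex.I • w) ((norm_add_le _ _).trans (by simp [norm_smul]))
    have a4 := hs (v - Complex.I • w) ((norm_sub_le _ _).trans (by simp [norm_smul]))
    rw [spectralForm, norm_mul]
    have b := (norm_add_le (∫ x, g x ∂(spectralMeasure ρ (v + w)) +
        (-1) * ∫ x, g x ∂(spectralMeasure ρ (v - w)))
      ((-Complex.I) * ∫ x, g x ∂(spectralMeasure ρ (v + Complex.I • w)) +
      Complex.I * ∫ x, g x ∂(spectralMeasure ρ (v - Complex.I • w)))).trans
        (add_le_add (norm_add_le _ _) (norm_add_le _ _))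
    simp only [norm_mul, norm_neg, norm_one, Complex.norm_I, one_mul] at b
    have : ‖(4 : ℂ)⁻¹‖ = 4⁻¹ := by simp
    rw [this]
    linarith
  refine ⟨4 * D, fun v w => ?_⟩
  rcases eq_or_ne v 0 with rfl | hv
  · have := spectralForm_smul_left ρ hg 0 (0 : H) w
    rw [zero_smul, map_zero, zero_mul] at this
    simp [this]
  rcases eq_or_ne w 0 with rfl | hw
  · have := spectralForm_smul_right ρ hg 0 v (0 : H)
    rw [zero_smul, zero_mul] at this
    simp [this]
  have hv' : (‖v‖ : ℂ) ≠ 0 := by simpa using hv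
  have hw' : (‖w‖ : ℂ) ≠ 0 := by simpa using hw
  -- both vectors are rescaled to unit length
  have h2 := h1 ((‖v‖ : ℂ)⁻¹ • v) ((‖w‖ : ℂ)⁻¹ • w)
  have n1 : ‖(‖v‖ : ℂ)⁻¹ • v‖ = 1 := by simp [norm_smul, hv]
  have n2 : ‖(‖w‖ : ℂ)⁻¹ • w‖ = 1 := by simp [norm_smul, hw]
  rw [n1, n2, spectralForm_smul_left ρ hg, spectralForm_smul_right ρ hg] at h2
  simp only [norm_mul, RCLike.norm_conj, norm_inv, Complex.norm_real, norm_norm] at h2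
  have hv0 : 0 < ‖v‖ := norm_pos_iff.2 hv
  have hw0 : 0 < ‖w‖ := norm_pos_iff.2 hw
  calc ‖spectralForm ρ g v w‖ = ‖v‖ * ‖w‖ * (‖v‖⁻¹ * (‖w‖⁻¹ * ‖spectralForm ρ g v w‖)) := by
        field_simp
    _ ≤ ‖v‖ * ‖w‖ * (D * (1 + 1) ^ 2) := by gcongr
    _ = _ := by ring

/-- A bounded sesquilinear form comes from an operator. -/
theorem exists_operator : ∃ T : H →L[ℂ] H, ∀ v w, ⟪v, T w⟫_ℂ = spectralForm ρ g v w := by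
  obtain ⟨C, hC⟩ := exists_norm_spectralForm_le ρ hg
  let B : H →L⋆[ℂ] H →L[ℂ] ℂ := LinearMap.mkContinuous₂
    (LinearMap.mk₂'ₛₗ (starRingEnd ℂ) (RingHom.id ℂ) (spectralForm ρ g)
      (fun v v' w => spectralForm_add_left ρ hg v v' w)
      (fun c v w => spectralForm_smul_left ρ hg c v w)
      (fun v w w' => spectralForm_add_right ρ hg v w w')
      (fun c v w => spectralForm_smul_right ρ hg c v w)) C hC
  refine ⟨ContinuousLinearMap.adjoint (InnerProductSpace.continuousLinearMapOfBilin B),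
    fun v w => ?_⟩
  rw [ContinuousLinearMap.adjoint_inner_right,
    InnerProductSpace.continuousLinearMapOfBilin_apply]
  rfl

theorem inner_borelOp_self (v : H) :
    ⟪v, borelOp ρ g v⟫_ℂ = ∫ x, g x ∂(spectralMeasure ρ v) := by
  obtain ⟨T, hT⟩ := exists_operator ρ hg
  have h : ∃ T : H →L[ℂ] H, ∀ v ν, IsSpectralMeasure ρ v ν → ⟪v, T v⟫_ℂ = ∫ x, g x ∂ν :=
    ⟨T, fun v ν hν => by
      rw [hT, spectralForm_self ρ hg, hν.unique ρ (isSpectralMeasure_spectralMeasure ρ v)]⟩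
  rw [borelOp, dif_pos h]
  exact h.choose_spec v _ (isSpectralMeasure_spectralMeasure ρ v)

theorem inner_borelOp (v w : H) : ⟪v, borelOp ρ g w⟫_ℂ = spectralForm ρ g v w := by
  rw [inner_polarization, spectralForm]
  simp only [inner_borelOp_self ρ hg]

omit hg

theorem borelOp_of_cont {f : M → ℂ} (hc : Continuous f) (hs : HasCompactSupport f) :
    borelOp ρ f = ρ (ofCompactSupport f hc hs) := by
  ext w
  refine ext_inner_left ℂ fun v => ?_
  rw [inner_borelOp ρ (isBoundedBorel_of_hasCompactSupport hc hs), spectralForm_of_cont ρ hc hs]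

theorem borelOp_add {f g : M → ℂ} (hf : IsBoundedBorel f) (hg : IsBoundedBorel g) :
    borelOp ρ (f + g) = borelOp ρ f + borelOp ρ g := by
  ext w
  refine ext_inner_left ℂ fun v => ?_
  rw [add_apply, inner_add_right, inner_borelOp ρ (hf.add hg),
    inner_borelOp ρ hf, inner_borelOp ρ hg, (isSigmaFunctional_spectralForm ρ v w).add _ _ hf hg]

theorem borelOp_smul (c : ℂ) {f : M → ℂ} (hf : IsBoundedBorel f) :
    borelOp ρ (c • f) = c • borelOp ρ f := by
  ext w
  refine ext_inner_left ℂ fun v => ?_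
  rw [smul_apply, inner_smul_right, inner_borelOp ρ (hf.smul c),
    inner_borelOp ρ hf, (isSigmaFunctional_spectralForm ρ v w).smul _ _ hf]

theorem borelOp_zero : borelOp ρ (0 : M → ℂ) = 0 := by
  simpa using borelOp_smul ρ 0 (isBoundedBorel_one (M := M))

/-- Multiplicativity holds for `C_c(M)`, and it extends to bounded Borel functions in one variable
after the other. -/
theorem borelOp_mul {f g : M → ℂ} (hf : IsBoundedBorel f) (hg : IsBoundedBorel g) :
    borelOp ρ (f * g) = borelOp ρ f * borelOp ρ g := by
  have hstar : ∀ {h : M → ℂ} (hc : Continuous h) (hs : HasCompactSupport h) (v w : H),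
      ⟪v, ρ (ofCompactSupport h hc hs) w⟫_ℂ =
        ⟪ContinuousLinearMap.adjoint (ρ (ofCompactSupport h hc hs)) v, w⟫_ℂ := fun hc hs v w => by
    rw [ContinuousLinearMap.adjoint_inner_left]
  have h1 : ∀ (v w : H) {f g : M → ℂ}, Continuous f → HasCompactSupport f → IsBoundedBorel g →
      spectralForm ρ (g * f) v w = ⟪v, borelOp ρ g (borelOp ρ f w)⟫_ℂ := by
    intro v w f g hc hs hg
    rw [inner_borelOp ρ hg]
    refine IsSigmaFunctional.ext (Φ := fun g => spectralForm ρ (g * f) v w)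
      (Ψ := fun g => spectralForm ρ g v (borelOp ρ f w))
      ((isSigmaFunctional_spectralForm ρ v w).comp_mul (isBoundedBorel_of_hasCompactSupport hc hs))
      (isSigmaFunctional_spectralForm ρ _ _) (fun k kc ks => ?_) hg
    rw [borelOp_of_cont ρ hc hs, spectralForm_of_cont ρ kc ks,
      spectralForm_of_cont ρ (kc.mul hc) hs.mul_left, ← mul_apply_eq_comp, ← map_mul]
    rfl
  ext w
  refine ext_inner_left ℂ fun v => ?_
  rw [inner_borelOp ρ (hf.mul hg), mul_apply_eq_comp, mul_comm]
  have hadj : ∀ w', ⟪v, borelOp ρ f w'⟫_ℂ = ⟪ContinuousLinearMap.adjoint (borelOp ρ f) v, w'⟫_ℂ :=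
    fun w' => by rw [ContinuousLinearMap.adjoint_inner_left]
  rw [hadj, inner_borelOp ρ hg]
  refine IsSigmaFunctional.ext (Φ := fun g => spectralForm ρ (g * f) v w)
    (Ψ := fun g => spectralForm ρ g (ContinuousLinearMap.adjoint (borelOp ρ f) v) w)
    ((isSigmaFunctional_spectralForm ρ v w).comp_mul hf)
    (isSigmaFunctional_spectralForm ρ _ _) (fun k kc ks => ?_) hg
  rw [mul_comm, h1 v w kc ks hf, hadj, inner_borelOp ρ (isBoundedBorel_of_hasCompactSupport kc ks)]

end Spectral

/-! ### Multiplication by indicator functions -/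

section SetOp

variable {M : Type*} [MetricSpace M] [ProperSpace M] [MeasurableSpace M] [BorelSpace M]
variable {H : Type*} [NormedAddCommGroup H] [InnerProductSpace ℂ H] [CompleteSpace H]
variable (ρ : C₀(M, ℂ) →⋆ₙₐ[ℂ] (H →L[ℂ] H))

/-- The extension to bounded Borel functions extends `ρ`. -/
theorem borelOp_of_C0 (f : C₀(M, ℂ)) : borelOp ρ f = ρ f := by
  have hf : IsBoundedBorel (f : M → ℂ) := ⟨f.continuous.measurable, ‖f‖, fun x => by
    rw [← ZeroAtInftyContinuousMap.norm_toBCF_eq_norm]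
    exact BoundedContinuousFunction.norm_coe_le_norm f.toBCF x⟩
  ext w
  refine ext_inner_left ℂ fun v => ?_
  rw [inner_borelOp ρ hf, spectralForm_of_C0]

/-- Nondegeneracy: `ρ(f) (1 - E(1)) = 0` for all `f`. -/
theorem borelOp_one (hρ : ∀ v : H, (∀ f : C₀(M, ℂ), ρ f v = 0) → v = 0) :
    borelOp ρ (1 : M → ℂ) = 1 := by
  ext w
  rw [one_apply_eq_self, ← sub_eq_zero]
  refine hρ _ fun f => ?_
  have hf : IsBoundedBorel (f : M → ℂ) := ⟨f.continuous.measurable, ‖f‖, fun x => by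
    rw [← ZeroAtInftyContinuousMap.norm_toBCF_eq_norm]
    exact BoundedContinuousFunction.norm_coe_le_norm f.toBCF x⟩
  have h := borelOp_mul ρ hf isBoundedBorel_one
  rw [mul_one, borelOp_of_C0] at h
  rw [map_sub, ← mul_apply_eq_comp, ← h, sub_self]

theorem setOp_univ (hρ : ∀ v : H, (∀ f : C₀(M, ℂ), ρ f v = 0) → v = 0) :
    setOp ρ (Set.univ : Set M) = 1 := by
  rw [setOp, Set.indicator_univ]
  exact borelOp_one ρ hρ

theorem setOp_empty : setOp ρ (∅ : Set M) = 0 := by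
  rw [setOp, Set.indicator_empty]
  exact borelOp_zero ρ

theorem setOp_mul {A B : Set M} (hA : MeasurableSet A) (hB : MeasurableSet B) :
    setOp ρ A * setOp ρ B = setOp ρ (A ∩ B) := by
  rw [setOp, setOp, setOp, ← borelOp_mul ρ (isBoundedBorel_indicator hA)
    (isBoundedBorel_indicator hB)]
  congr 1
  ext x
  by_cases h : x ∈ A <;> by_cases h' : x ∈ B <;> simp [h, h']

theorem setOp_add_compl (hρ : ∀ v : H, (∀ f : C₀(M, ℂ), ρ f v = 0) → v = 0) {A : Set M}
    (hA : MeasurableSet A) : setOp ρ A + setOp ρ Aᶜ = 1 := by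
  rw [setOp, setOp, ← borelOp_add ρ (isBoundedBorel_indicator hA)
    (isBoundedBorel_indicator hA.compl), Set.indicator_self_add_compl]
  exact borelOp_one ρ hρ

theorem setOp_union {A B : Set M} (hA : MeasurableSet A) (hB : MeasurableSet B)
    (h : Disjoint A B) : setOp ρ (A ∪ B) = setOp ρ A + setOp ρ B := by
  rw [setOp, setOp, setOp, ← borelOp_add ρ (isBoundedBorel_indicator hA)
    (isBoundedBorel_indicator hB), Set.indicator_union_of_disjoint h]
  rfl

theorem tsupport_indicator_subset (A : Set M) :
    tsupport (A.indicator fun _ => (1 : ℂ)) ⊆ closure A :=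
  closure_mono Set.support_indicator_subset

theorem hasCompactSupport_indicator {A : Set M} (hA : Bornology.IsBounded A) :
    HasCompactSupport (A.indicator fun _ => (1 : ℂ)) :=
  hA.isCompact_closure.of_isClosed_subset (isClosed_tsupport _) (tsupport_indicator_subset A)

variable {ρ}

theorem IsLocallyTraceClass.setOp_mul {T : H →L[ℂ] H} (hT : IsLocallyTraceClass ρ T) {A : Set M}
    (hA : MeasurableSet A) (hb : Bornology.IsBounded A) : IsTraceClass (setOp ρ A * T) :=
  (hT _ (isBoundedBorel_indicator hA) (hasCompactSupport_indicator hb)).1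

theorem IsLocallyTraceClass.mul_setOp {T : H →L[ℂ] H} (hT : IsLocallyTraceClass ρ T) {A : Set M}
    (hA : MeasurableSet A) (hb : Bornology.IsBounded A) : IsTraceClass (T * setOp ρ A) :=
  (hT _ (isBoundedBorel_indicator hA) (hasCompactSupport_indicator hb)).2

/-! ### Finite propagation -/

theorem HasPropagationBound.mono {T : H →L[ℂ] H} {R S : ℝ} (h : HasPropagationBound ρ T R)
    (hRS : R ≤ S) : HasPropagationBound ρ T S :=
  fun f g hf hg hfg => h f g hf hg fun x hx y hy => hRS.trans (hfg x hx y hy)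

theorem HasPropagationBound.add {T S : H →L[ℂ] H} {R : ℝ} (hT : HasPropagationBound ρ T R)
    (hS : HasPropagationBound ρ S R) : HasPropagationBound ρ (T + S) R := by
  intro f g hf hg hfg
  rw [mul_add, add_mul, hT f g hf hg hfg, hS f g hf hg hfg, add_zero]

theorem HasPropagationBound.smul {T : H →L[ℂ] H} {R : ℝ} (hT : HasPropagationBound ρ T R) (c : ℂ) :
    HasPropagationBound ρ (c • T) R := by
  intro f g hf hg hfg
  rw [mul_smul_comm, smul_mul_assoc, hT f g hf hg hfg, smul_zero]

theorem le_dist_of_mem_closure {A B : Set M} {R : ℝ} (h : ∀ x ∈ A, ∀ y ∈ B, R ≤ dist x y) :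
    ∀ x ∈ closure A, ∀ y ∈ closure B, R ≤ dist x y := by
  intro x hx y hy
  have h1 : ∀ x ∈ A, R ≤ dist x y := fun x hx =>
    closure_minimal (t := {y | R ≤ dist x y}) (h x hx)
      (isClosed_le continuous_const (by fun_prop)) hy
  exact closure_minimal (t := {x | R ≤ dist x y}) h1
    (isClosed_le continuous_const (by fun_prop)) hx

theorem HasPropagationBound.setOp_mul_mul_setOp {T : H →L[ℂ] H} {R : ℝ}
    (hT : HasPropagationBound ρ T R) {A B : Set M} (hA : MeasurableSet A) (hB : MeasurableSet B)
    (h : ∀ x ∈ A, ∀ y ∈ B, R ≤ dist x y) : setOp ρ A * T * setOp ρ B = 0 :=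
  hT _ _ (isBoundedBorel_indicator hA) (isBoundedBorel_indicator hB) fun x hx y hy =>
    le_dist_of_mem_closure h x (tsupport_indicator_subset A hx) y (tsupport_indicator_subset B hy)

theorem lt_dist_of_notMem_cthickening {A : Set M} {R : ℝ} {x y : M} (hx : x ∈ A)
    (hy : y ∉ Metric.cthickening R A) : R < dist x y := by
  by_contra h
  exact hy (Metric.mem_cthickening_of_dist_le y x R A hx (by rw [dist_comm]; exact not_lt.1 h))

theorem exists_dist_lt_of_mem_cthickening {A : Set M} {R S : ℝ} {x : M} (hR : 0 ≤ R) (hRS : R < S)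
    (hx : x ∈ Metric.cthickening R A) : ∃ a ∈ A, dist x a < S := by
  have := Metric.cthickening_subset_thickening' (hR.trans_lt hRS) hRS A hx
  exact Metric.mem_thickening_iff.1 this

/-- A cutoff to a neighbourhood of `supp f` is inserted between the two operators. The margin `1` is
needed because the propagation condition allows distance exactly `R`. -/
theorem HasPropagationBound.mul (hρ : ∀ v : H, (∀ f : C₀(M, ℂ), ρ f v = 0) → v = 0)
    {T S : H →L[ℂ] H} {R R' : ℝ} (hT : HasPropagationBound ρ T R)
    (hS : HasPropagationBound ρ S R') : HasPropagationBound ρ (T * S) (max R 0 + max R' 0 + 1) := by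
  intro f g hf hg hfg
  set L := Metric.cthickening (max R 0) (tsupport f)
  have hL : IsClosed L := Metric.isClosed_cthickening
  have h1 : borelOp ρ f * T * setOp ρ Lᶜ = 0 := by
    refine hT _ _ hf (isBoundedBorel_indicator hL.measurableSet.compl) fun x hx y hy => ?_
    refine le_dist_of_mem_closure (A := {x}) (B := Lᶜ) (fun z hz y hy => ?_) x
      (subset_closure rfl) y (tsupport_indicator_subset _ hy)
    rw [Set.mem_singleton_iff.1 hz]
    exact (le_max_left R 0).trans (lt_dist_of_notMem_cthickening hx hy).le
  have h2 : setOp ρ L * S * borelOp ρ g = 0 := by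
    refine hS _ _ (isBoundedBorel_indicator hL.measurableSet) hg fun x hx y hy => ?_
    have hx' : x ∈ L := by
      have := tsupport_indicator_subset _ hx
      rwa [hL.closure_eq] at this
    obtain ⟨a, ha, hxa⟩ := exists_dist_lt_of_mem_cthickening (le_max_right _ _)
      (lt_add_one (max R 0)) hx'
    have h3 := hfg a ha y hy
    have h4 := dist_triangle a x y
    rw [dist_comm a x] at h4
    have h5 := le_max_left R' 0
    linarith
  calc borelOp ρ f * (T * S) * borelOp ρ g
      = borelOp ρ f * T * (setOp ρ L + setOp ρ Lᶜ) * S * borelOp ρ g := by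
        rw [setOp_add_compl ρ hρ hL.measurableSet]
        simp only [mul_assoc, one_mul]
    _ = borelOp ρ f * T * (setOp ρ L * S * borelOp ρ g) +
        (borelOp ρ f * T * setOp ρ Lᶜ) * S * borelOp ρ g := by
        simp only [mul_add, add_mul, mul_assoc]
    _ = 0 := by rw [h1, h2]; simp

theorem IsLocallyTraceClass.add {T S : H →L[ℂ] H} (hT : IsLocallyTraceClass ρ T)
    (hS : IsLocallyTraceClass ρ S) : IsLocallyTraceClass ρ (T + S) := fun f hf hc => by
  rw [mul_add, add_mul]
  exact ⟨(hT f hf hc).1.add (hS f hf hc).1, (hT f hf hc).2.add (hS f hf hc).2⟩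

theorem IsLocallyTraceClass.smul {T : H →L[ℂ] H} (hT : IsLocallyTraceClass ρ T) (c : ℂ) :
    IsLocallyTraceClass ρ (c • T) := fun f hf hc => by
  rw [mul_smul_comm, smul_mul_assoc]
  exact ⟨(hT f hf hc).1.smul c, (hT f hf hc).2.smul c⟩

theorem IsLocallyTraceClass.mul {T S : H →L[ℂ] H} (hT : IsLocallyTraceClass ρ T)
    (hS : IsLocallyTraceClass ρ S) : IsLocallyTraceClass ρ (T * S) := fun f hf hc => by
  rw [← mul_assoc, mul_assoc]
  exact ⟨(hT f hf hc).1.mul_right S, (hS f hf hc).2.mul_left T⟩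

/-- The locally trace-class operators of finite propagation are closed under the algebra
operations, so that the elements of the generated algebra have these properties. -/
theorem algB_spec (hρ : ∀ v : H, (∀ f : C₀(M, ℂ), ρ f v = 0) → v = 0) (T : algB ρ) :
    IsLocallyTraceClass ρ (T : H →L[ℂ] H) ∧ ∃ R, HasPropagationBound ρ (T : H →L[ℂ] H) R := by
  obtain ⟨T, hT⟩ := T
  change IsLocallyTraceClass ρ T ∧ ∃ R, HasPropagationBound ρ T R
  rw [algB] at hT
  induction hT using NonUnitalAlgebra.adjoin_induction with
  | mem x hx => exact hx
  | zero =>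
    refine ⟨fun f _ _ => by simpa using isTraceClass_zero, 0, fun f g _ _ _ => by simp⟩
  | add x y hx hy h1 h2 =>
    obtain ⟨h1, R, hR⟩ := h1
    obtain ⟨h2, S, hS⟩ := h2
    exact ⟨h1.add h2, max R S, (hR.mono (le_max_left _ _)).add (hS.mono (le_max_right _ _))⟩
  | mul x y hx hy h1 h2 =>
    obtain ⟨h1, R, hR⟩ := h1
    obtain ⟨h2, S, hS⟩ := h2
    exact ⟨h1.mul h2, _, hR.mul hρ hS⟩
  | smul c x hx h1 =>
    obtain ⟨h1, R, hR⟩ := h1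
    exact ⟨h1.smul c, R, hR.smul c⟩

/-- A finite family in `ℬ(M)` has a common propagation bound. -/
theorem exists_propagationBound (hρ : ∀ v : H, (∀ f : C₀(M, ℂ), ρ f v = 0) → v = 0)
    {ι : Type*} [Finite ι] (T : ι → algB ρ) :
    ∃ R, 0 ≤ R ∧ ∀ i, HasPropagationBound ρ (T i : H →L[ℂ] H) R := by
  cases nonempty_fintype ι
  choose R hR using fun i => (algB_spec hρ (T i)).2
  refine ⟨∑ i, |R i|, Finset.sum_nonneg fun _ _ => abs_nonneg _, fun i => (hR i).mono ?_⟩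
  exact (le_abs_self _).trans
    (Finset.single_le_sum (f := fun i => |R i|) (fun _ _ => abs_nonneg _) (Finset.mem_univ i))

end SetOp

/-! ### Integration against complex measures -/

section ComplexMeasures

variable {X : Type*} [MeasurableSpace X]

/-- The total variation of a complex measure is at most the sum of those of its real and
imaginary parts. -/
theorem isFiniteMeasure_variation (μ : ComplexMeasure X) : IsFiniteMeasure μ.variation := by
  have hr : IsFiniteMeasure (ComplexMeasure.re μ).variation := by
    rw [← SignedMeasure.totalVariation_eq_variation]; infer_instance
  have hi : IsFiniteMeasure (ComplexMeasure.im μ).variation := by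
    rw [← SignedMeasure.totalVariation_eq_variation]; infer_instance
  refine isFiniteMeasure_of_le
    ((ComplexMeasure.re μ).variation + (ComplexMeasure.im μ).variation)
    (VectorMeasure.variation_le_of_forall_enorm_le fun E hE => ?_)
  rw [Measure.add_apply]
  refine le_trans ?_ (add_le_add (VectorMeasure.enorm_measure_le_variation _ E)
    (VectorMeasure.enorm_measure_le_variation _ E))
  have h1 : ComplexMeasure.re μ E = (μ E).re := rfl
  have h2 : ComplexMeasure.im μ E = (μ E).im := rfl
  rw [h1, h2]
  simp only [← ofReal_norm]
  rw [← ENNReal.ofReal_add (norm_nonneg _) (norm_nonneg _)]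
  exact ENNReal.ofReal_le_ofReal (Complex.norm_le_abs_re_add_abs_im _)

attribute [instance] isFiniteMeasure_variation

theorem hasSum_real_iUnion (ν : Measure X) [IsFiniteMeasure ν] {s : ℕ → Set X}
    (hs : ∀ i, MeasurableSet (s i)) (hd : Pairwise (Function.onFun Disjoint s)) :
    HasSum (fun i => ν.real (s i)) (ν.real (⋃ i, s i)) := by
  have h := ν.toSignedMeasure.hasSum_of_disjoint_iUnion hs hd
  simpa only [Measure.toSignedMeasure_apply_measurable, hs, MeasurableSet.iUnion hs] using h

/-- The integral of a complex function with respect to a complex measure. -/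
def cint (μ : ComplexMeasure X) (g : X → ℂ) : ℂ :=
  μ.integral g (ContinuousLinearMap.mul ℝ ℂ)

theorem cint_indicator (μ : ComplexMeasure X) {s : Set X} (hs : MeasurableSet s) :
    cint μ (s.indicator fun _ => 1) = μ s := by
  have := VectorMeasure.integral_indicator_const (μ := μ) (B := ContinuousLinearMap.mul ℝ ℂ) 1 hs
  simpa [cint] using this

theorem cint_smul (μ : ComplexMeasure X) (c : ℂ) (g : X → ℂ) :
    cint μ (c • g) = c * cint μ g := by
  rw [cint, cint, VectorMeasure.integral_eq_setToFun, VectorMeasure.integral_eq_setToFun,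
    setToFun_smul _ (fun c s x => ?_), smul_eq_mul]
  simp only [VectorMeasure.transpose]
  simp [mul_left_comm]

end ComplexMeasures

section Functionals

variable {X : Type*} [MetricSpace X] [MeasurableSpace X] [BorelSpace X]

theorem IsBoundedBorel.cintegrable {g : X → ℂ} (hg : IsBoundedBorel g) (μ : ComplexMeasure X) :
    μ.Integrable g :=
  hg.integrable μ.variation

theorem isSigmaFunctional_cint (μ : ComplexMeasure X) : IsSigmaFunctional fun g => cint μ g where
  add _ _ hf hg := VectorMeasure.integral_add (hf.cintegrable μ) (hg.cintegrable μ)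
  smul c f _ := cint_smul μ c f
  lim _ _ C h1 _ h3 _ h5 :=
    VectorMeasure.tendsto_integral_of_dominated_convergence (fun _ => C)
      (fun n => (h1 n).aestronglyMeasurable) (integrable_const C) (fun n => ae_of_all _ (h3 n))
      (ae_of_all _ h5)

/-- Functionals that agree on indicator functions agree on all bounded Borel functions. -/
theorem IsSigmaFunctional.ext_indicator {Φ Ψ : (X → ℂ) → ℂ} (hΦ : IsSigmaFunctional Φ)
    (hΨ : IsSigmaFunctional Ψ)
    (h : ∀ s, MeasurableSet s → Φ (s.indicator fun _ => 1) = Ψ (s.indicator fun _ => 1))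
    {g : X → ℂ} (hg : IsBoundedBorel g) : Φ g = Ψ g := by
  refine IsBoundedBorel.induction_indicator (P := fun g => Φ g = Ψ g) h (fun f g hf hg h1 h2 => ?_)
    (fun c f hf h1 => ?_) (fun f g C h1 h2 h3 h4 h5 h6 => ?_) hg
  · rw [hΦ.add _ _ hf hg, hΨ.add _ _ hf hg, h1, h2]
  · rw [hΦ.smul _ _ hf, hΨ.smul _ _ hf, h1]
  · have := hΦ.lim f g C h1 h2 h3 h4 h5
    simp_rw [h6] at this
    exact tendsto_nhds_unique this (hΨ.lim f g C h1 h2 h3 h4 h5)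

theorem cint_add_measure (μ ν : ComplexMeasure X) {g : X → ℂ} (hg : IsBoundedBorel g) :
    cint (μ + ν) g = cint μ g + cint ν g :=
  VectorMeasure.integral_add_vectorMeasure (hg.cintegrable μ) (hg.cintegrable ν)

variable {ι : Type*} [Countable ι] {c : ι → ℂ} (hc : Summable fun j => ‖c j‖)
  {m : ι → Measure X} {B : ℝ} (hm : ∀ j, IsFiniteMeasure (m j) ∧ (m j).real Set.univ ≤ B)
include hc hm

theorem norm_mul_integral_le {g : X → ℂ} {C : ℝ} (hC : ∀ x, ‖g x‖ ≤ C) (hC0 : 0 ≤ C) (j : ι) :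
    ‖c j * ∫ x, g x ∂(m j)‖ ≤ ‖c j‖ * (C * B) := by
  have := (hm j).1
  rw [norm_mul]
  refine mul_le_mul_of_nonneg_left ?_ (norm_nonneg _)
  exact (norm_integral_le_of_norm_le_const (ae_of_all _ hC)).trans
    (mul_le_mul_of_nonneg_left (hm j).2 hC0)

theorem summable_mul_integral {g : X → ℂ} (hg : IsBoundedBorel g) :
    Summable fun j => c j * ∫ x, g x ∂(m j) := by
  obtain ⟨C, hC⟩ := hg.2
  exact Summable.of_norm_bounded (hc.mul_right (max C 0 * B)) fun j =>
    norm_mul_integral_le hc hm (fun x => (hC x).trans (le_max_left C 0)) (le_max_right _ _) j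

theorem isSigmaFunctional_tsum : IsSigmaFunctional fun g => ∑' j, c j * ∫ x, g x ∂(m j) where
  add f g hf hg := by
    rw [← (summable_mul_integral hc hm hf).tsum_add (summable_mul_integral hc hm hg)]
    refine tsum_congr fun j => ?_
    have := (hm j).1
    rw [← mul_add, ← integral_add (hf.integrable _) (hg.integrable _)]
    rfl
  smul a f hf := by
    rw [← tsum_mul_left]
    refine tsum_congr fun j => ?_
    simp only [Pi.smul_apply, smul_eq_mul, integral_const_mul]
    ring
  lim f g C h1 h2 h3 h4 h5 := by
    have h3' : ∀ n x, ‖f n x‖ ≤ max C 0 := fun n x => (h3 n x).trans (le_max_left _ _)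
    refine tendsto_tsum_of_dominated_convergence (bound := fun j => ‖c j‖ * (max C 0 * B))
      (hc.mul_right _) (fun j => ?_) (Eventually.of_forall fun n j =>
        norm_mul_integral_le hc hm (h3' n) (le_max_right _ _) j)
    have := (hm j).1
    exact ((isSigmaFunctional_integral (m j)).lim f g C h1 h2 h3 h4 h5).const_mul _

/-- A sum `∑ cⱼ mⱼ` of finite measures of bounded mass with summable coefficients is a complex
measure. -/
theorem exists_complexMeasure_of_sum : ∃ μ : ComplexMeasure X, ∀ g, IsBoundedBorel g →
    cint μ g = ∑' j, c j * ∫ x, g x ∂(m j) := by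
  classical
  let μ : ComplexMeasure X :=
    { measureOf' := fun s => if MeasurableSet s then ∑' j, c j * ((m j).real s : ℂ) else 0
      empty' := by simp
      not_measurable' := fun s hs => by simp [hs]
      m_iUnion' := fun s hs hd => by
        simp only [hs, MeasurableSet.iUnion hs, if_true]
        have hsum : ∀ j, HasSum (fun i => c j * ((m j).real (s i) : ℂ))
            (c j * ((m j).real (⋃ i, s i) : ℂ)) := fun j => by
          have := (hm j).1
          refine HasSum.mul_left _ ?_
          rw [Complex.hasSum_ofReal]
          exact hasSum_real_iUnion (m j) hs hd
        have hfull : Summable (Function.uncurry fun j i => c j * ((m j).real (s i) : ℂ)) := by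
          apply Summable.of_norm
          rw [summable_prod_of_nonneg (fun _ => norm_nonneg _)]
          refine ⟨fun j => ?_, ?_⟩
          · exact (hsum j).summable.norm
          · refine Summable.of_nonneg_of_le (fun j => tsum_nonneg fun _ => norm_nonneg _)
              (fun j => ?_) (hc.mul_right B)
            have := (hm j).1
            have h1 : ∀ i, ‖c j * ((m j).real (s i) : ℂ)‖ = ‖c j‖ * (m j).real (s i) := fun i => by
              rw [norm_mul, Complex.norm_real, Real.norm_of_nonneg measureReal_nonneg]
            simp only [Function.uncurry, h1]
            rw [tsum_mul_left, (hasSum_real_iUnion (m j) hs hd).tsum_eq]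
            exact mul_le_mul_of_nonneg_left
              ((measureReal_mono (Set.subset_univ _)).trans (hm j).2) (norm_nonneg _)
        have e : ∑' j, c j * ((m j).real (⋃ i, s i) : ℂ) =
            ∑' i, ∑' j, c j * ((m j).real (s i) : ℂ) := by
          rw [hfull.tsum_comm]
          exact tsum_congr fun j => (hsum j).tsum_eq.symm
        rw [e]
        exact hfull.prod_symm.prod.hasSum }
  refine ⟨μ, fun g hg => ?_⟩
  refine (isSigmaFunctional_cint μ).ext_indicator (isSigmaFunctional_tsum hc hm)
    (fun s hs => ?_) hg
  rw [cint_indicator μ hs]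
  change (if MeasurableSet s then ∑' j, c j * ((m j).real s : ℂ) else 0) = _
  rw [if_pos hs]
  refine tsum_congr fun j => ?_
  rw [integral_indicator hs, setIntegral_const, Complex.real_smul, mul_one]

end Functionals

section Boxes

variable {M : Type*} [MetricSpace M] [MeasurableSpace M] [BorelSpace M] {n : ℕ}

/-- The Borel boxes form a π-system that generates the Borel sets of a product. -/
theorem complexMeasure_ext_box {μ ν : ComplexMeasure (Fin n → M)}
    (h : ∀ B : Fin n → Set M, (∀ i, MeasurableSet (B i)) →
      μ (Set.univ.pi B) = ν (Set.univ.pi B)) : μ = ν := by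
  refine VectorMeasure.ext_of_generateFrom _ ?_ generateFrom_pi.symm isPiSystem_pi ?_
  · rintro _ ⟨B, hB, rfl⟩
    exact h B fun i => hB i (Set.mem_univ i)
  · have := h (fun _ => Set.univ) fun _ => MeasurableSet.univ
    rwa [Set.pi_univ] at this

theorem complexMeasure_ext_openBox {μ ν : ComplexMeasure (Fin n → M)}
    (h : ∀ B : Fin n → Set M, (∀ i, IsOpen (B i)) →
      μ (Set.univ.pi B) = ν (Set.univ.pi B)) : μ = ν := by
  refine VectorMeasure.ext_of_generateFrom
    (Set.univ.pi '' Set.univ.pi fun _ : Fin n => {s : Set M | IsOpen s}) ?_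
    (generateFrom_eq_pi (fun _ => (BorelSpace.measurable_eq (α := M)).symm)
      (fun _ => ⟨fun _ => Set.univ, fun _ => isOpen_univ, Set.iUnion_const _⟩)).symm
    (IsPiSystem.pi fun _ => isPiSystem_isOpen) ?_
  · rintro _ ⟨B, hB, rfl⟩
    exact h B fun i => hB i (Set.mem_univ i)
  · have := h (fun _ => Set.univ) fun _ => isOpen_univ
    rwa [Set.pi_univ] at this

end Boxes

/-! ### Traces of products as complex measures -/

section ProductFormula

variable {M : Type*} [MetricSpace M] [ProperSpace M] [MeasurableSpace M] [BorelSpace M]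
variable {H : Type*} [NormedAddCommGroup H] [InnerProductSpace ℂ H] [CompleteSpace H]
variable (ρ : C₀(M, ℂ) →⋆ₙₐ[ℂ] (H →L[ℂ] H))

/-- The coefficients of the polarization identity. -/
def polarCoeff : Fin 4 → ℂ := ![4⁻¹, -4⁻¹, -(4⁻¹ * Complex.I), 4⁻¹ * Complex.I]

/-- Polarization: off-diagonal matrix coefficients are combinations of four spectral measures. The mass
is at most `‖y ± i^k x‖² ≤ 4`. -/
theorem exists_measures_inner (y x : H) (hy : ‖y‖ ≤ 1) (hx : ‖x‖ ≤ 1) :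
    ∃ ν : Fin 4 → Measure M, (∀ k, IsFiniteMeasure (ν k) ∧ (ν k).real Set.univ ≤ 4) ∧
      ∀ f, IsBoundedBorel f → ⟪y, borelOp ρ f x⟫_ℂ = ∑ k, polarCoeff k * ∫ z, f z ∂(ν k) := by
  refine ⟨![spectralMeasure ρ (y + x), spectralMeasure ρ (y - x),
    spectralMeasure ρ (y + Complex.I • x), spectralMeasure ρ (y - Complex.I • x)], ?_, ?_⟩
  · have key : ∀ u : H, ‖u‖ ≤ 2 →
        IsFiniteMeasure (spectralMeasure ρ u) ∧ (spectralMeasure ρ u).real Set.univ ≤ 4 :=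
      fun u hu => ⟨inferInstance, (spectralMeasure_univ_le ρ u).trans (by
        nlinarith [norm_nonneg u])⟩
    have hI : ‖Complex.I • x‖ ≤ 1 := by simpa [norm_smul] using hx
    intro k
    fin_cases k
    · exact key _ ((norm_add_le _ _).trans (by linarith))
    · exact key _ ((norm_sub_le _ _).trans (by linarith))
    · exact key _ ((norm_add_le _ _).trans (by linarith))
    · exact key _ ((norm_sub_le _ _).trans (by linarith))
  · intro f hf
    rw [inner_borelOp ρ hf, spectralForm, Fin.sum_univ_four]
    simp only [polarCoeff, Matrix.cons_val_zero, Matrix.cons_val_one, Matrix.cons_val]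
    ring

theorem norm_prod_integral_le {n : ℕ} {ν : Fin n → Measure M}
    (hν : ∀ i, IsFiniteMeasure (ν i) ∧ (ν i).real Set.univ ≤ 4) {f : Fin n → M → ℂ} {C : ℝ}
    (hC : ∀ i x, ‖f i x‖ ≤ C) (hC0 : 0 ≤ C) :
    ‖∏ i, ∫ x, f i x ∂(ν i)‖ ≤ (C * 4) ^ n := by
  rw [norm_prod]
  calc ∏ i, ‖∫ x, f i x ∂(ν i)‖ ≤ ∏ _i : Fin n, C * 4 := by
        refine Finset.prod_le_prod (fun _ _ => norm_nonneg _) fun i _ => ?_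
        have := (hν i).1
        exact (norm_integral_le_of_norm_le_const (ae_of_all _ (hC i))).trans
          (mul_le_mul_of_nonneg_left (hν i).2 hC0)
    _ = _ := by simp

theorem exists_common_bound {n : ℕ} {f : Fin n → M → ℂ} (hf : ∀ i, IsBoundedBorel (f i)) :
    ∃ C, 0 ≤ C ∧ ∀ i x, ‖f i x‖ ≤ C := by
  choose C hC using fun i => (hf i).2
  refine ⟨∑ i, |C i|, Finset.sum_nonneg fun _ _ => abs_nonneg _, fun i x => (hC i x).trans ?_⟩
  exact (le_abs_self _).trans
    (Finset.single_le_sum (f := fun i => |C i|) (fun _ _ => abs_nonneg _) (Finset.mem_univ i))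

/-- The family of measures in an expansion `∑ⱼ cⱼ ∏ᵢ ∫ fᵢ dν_{j,i}` has bounded mass. -/
def BoundedMass {ι : Type*} {n : ℕ} (ν : ι → Fin n → Measure M) : Prop :=
  ∀ j i, IsFiniteMeasure (ν j i) ∧ (ν j i).real Set.univ ≤ 4

theorem hasSum_mul_fintype {ι κ : Type*} [Fintype κ] {u : ι → ℂ} {A : ℂ} (hu : HasSum u A)
    (v : κ → ℂ) : HasSum (fun q : ι × κ => u q.1 * v q.2) (A * ∑ k, v k) :=
  hu.mul (hasSum_fintype v)
    (summable_mul_of_summable_norm hu.summable.norm (hasSum_fintype v).summable.norm)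

/-- With trace-class `Tᵢ`, the form `⟪y, f₀ T₀ f₁ ⋯ Tₙ₋₁ fₙ x⟫` is an absolutely convergent sum of
products of integrals of the `fᵢ`; the coefficients are uniform over the unit ball. -/
theorem exists_product_expansion_inner {n : ℕ} (T : Fin n → H →L[ℂ] H)
    (hT : ∀ i, IsTraceClass (T i)) :
    ∃ (ι : Type) (_ : Countable ι) (c : ι → ℂ), (Summable fun j => ‖c j‖) ∧
      ∀ y x : H, ‖y‖ ≤ 1 → ‖x‖ ≤ 1 → ∃ ν : ι → Fin (n + 1) → Measure M, BoundedMass ν ∧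
        ∀ f : Fin (n + 1) → M → ℂ, (∀ i, IsBoundedBorel (f i)) →
          HasSum (fun j => c j * ∏ i, ∫ z, f i z ∂(ν j i))
            ⟪y, ((List.ofFn fun i : Fin n => borelOp ρ (f i.castSucc) * T i).prod *
              borelOp ρ (f (Fin.last n))) x⟫_ℂ := by
  induction n with
  | zero =>
    refine ⟨Fin 4, inferInstance, polarCoeff, (hasSum_fintype _).summable,
      fun y x hy hx => ?_⟩
    obtain ⟨ν, h1, h2⟩ := exists_measures_inner ρ y x hy hx
    refine ⟨fun k _ => ν k, fun k _ => h1 k, fun f hf => ?_⟩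
    have := h2 (f 0) (hf 0)
    simp only [List.ofFn_zero, List.prod_nil, one_mul, Fin.last_zero]
    rw [this]
    simpa using hasSum_fintype fun k => polarCoeff k * ∏ i, ∫ z, f i z ∂(ν k)
  | succ n ih =>
    obtain ⟨ι, hι, c, hc, H1⟩ := ih (fun i => T i.succ) fun i => hT i.succ
    obtain ⟨a, ξ, η, ha, hξ, hη, hrep⟩ := (hT 0).exists_normalized
    have hsum : Summable fun p : ℕ × (ι × Fin 4) => ‖(a p.1 : ℂ) * (c p.2.1 * polarCoeff p.2.2)‖ := by
      have h4 : Summable fun k => ‖polarCoeff k‖ := (hasSum_fintype _).summable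
      have h5 : Summable fun p : ι × Fin 4 => ‖c p.1‖ * ‖polarCoeff p.2‖ :=
        hc.mul_of_nonneg h4 (fun _ => norm_nonneg _) (fun _ => norm_nonneg _)
      simpa using ha.mul_of_nonneg h5 (fun _ => abs_nonneg _) (fun _ => by positivity)
    refine ⟨ℕ × (ι × Fin 4), inferInstance, fun p => (a p.1 : ℂ) * (c p.2.1 * polarCoeff p.2.2),
      hsum, fun y x hy hx => ?_⟩
    choose ν hν1 hν2 using fun j => H1 (η j) x (hη j) hx
    choose τ hτ1 hτ2 using fun j => exists_measures_inner ρ y (ξ j) hy (hξ j)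
    have hbm : BoundedMass fun (p : ℕ × (ι × Fin 4)) =>
        (Fin.cons (τ p.1 p.2.2) (ν p.1 p.2.1) : Fin (n + 1 + 1) → Measure M) := by
      intro p i
      refine Fin.cases ?_ (fun i => ?_) i
      · exact hτ1 p.1 p.2.2
      · exact hν1 p.1 p.2.1 i
    refine ⟨_, hbm, fun f hf => ?_⟩
    obtain ⟨C, hC0, hC⟩ := exists_common_bound hf
    have hs2 : Summable fun p : ℕ × (ι × Fin 4) => (a p.1 : ℂ) * (c p.2.1 * polarCoeff p.2.2) *
        ∏ i, ∫ z, f i z ∂((Fin.cons (τ p.1 p.2.2) (ν p.1 p.2.1) : Fin (n + 1 + 1) → Measure M) i) :=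
      Summable.of_norm_bounded (hsum.mul_right ((C * 4) ^ (n + 1 + 1))) fun p => by
        rw [norm_mul]
        exact mul_le_mul_of_nonneg_left (norm_prod_integral_le (hbm p) hC hC0) (norm_nonneg _)
    have hfib : ∀ j : ℕ, HasSum (fun q : ι × Fin 4 => (a j : ℂ) * (c q.1 * polarCoeff q.2) *
        ∏ i, ∫ z, f i z ∂((Fin.cons (τ j q.2) (ν j q.1) : Fin (n + 1 + 1) → Measure M) i))
        ((a j : ℂ) * (⟪η j, ((List.ofFn fun i : Fin n =>
          borelOp ρ (f i.castSucc.succ) * T i.succ).prod * borelOp ρ (f (Fin.last n).succ)) x⟫_ℂ *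
          ⟪y, borelOp ρ (f 0) (ξ j)⟫_ℂ)) := by
      intro j
      have e : ∀ q : ι × Fin 4, (a j : ℂ) * (c q.1 * polarCoeff q.2) *
          ∏ i, ∫ z, f i z ∂((Fin.cons (τ j q.2) (ν j q.1) : Fin (n + 1 + 1) → Measure M) i) =
          (a j : ℂ) * ((c q.1 * ∏ i : Fin (n + 1), ∫ z, f i.succ z ∂(ν j q.1 i)) *
            (polarCoeff q.2 * ∫ z, f 0 z ∂(τ j q.2))) := fun q => by
        rw [Fin.prod_univ_succ]
        simp only [Fin.cons_zero, Fin.cons_succ]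
        ring
      simp_rw [e]
      refine HasSum.mul_left _ ?_
      rw [hτ2 j (f 0) (hf 0)]
      exact hasSum_mul_fintype (hν2 j (fun i => f i.succ) fun i => hf i.succ)
        fun k => polarCoeff k * ∫ z, f 0 z ∂(τ j k)
    have htot := hs2.hasSum
    have hval := htot.prod_fiberwise hfib
    suffices h : ⟪y, ((List.ofFn fun i : Fin (n + 1) => borelOp ρ (f i.castSucc) * T i).prod *
        borelOp ρ (f (Fin.last (n + 1)))) x⟫_ℂ = ∑' p : ℕ × (ι × Fin 4),
          (a p.1 : ℂ) * (c p.2.1 * polarCoeff p.2.2) * ∏ i, ∫ z, f i z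
            ∂((Fin.cons (τ p.1 p.2.2) (ν p.1 p.2.1) : Fin (n + 1 + 1) → Measure M) i) by
      rw [h]; exact htot
    refine HasSum.unique ?_ hval
    rw [List.ofFn_succ, List.prod_cons]
    set W := (List.ofFn fun i : Fin n =>
          borelOp ρ (f i.castSucc.succ) * T i.succ).prod * borelOp ρ (f (Fin.last n).succ) with hW
    have e2 : (borelOp ρ (f (Fin.castSucc 0)) * T 0 *
        (List.ofFn fun i : Fin n => borelOp ρ (f i.succ.castSucc) * T i.succ).prod *
          borelOp ρ (f (Fin.last (n + 1)))) x = borelOp ρ (f 0) (T 0 (W x)) := by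
      rw [hW]
      simp only [mul_assoc, mul_apply_eq_comp, Fin.castSucc_zero, Fin.succ_castSucc, Fin.succ_last]
    rw [e2]
    have := ((hrep.hasSum (W x)).mapL (borelOp ρ (f 0))).mapL (innerSL ℂ y)
    have e3 : (fun j => (a j : ℂ) * (⟪η j, W x⟫_ℂ * ⟪y, borelOp ρ (f 0) (ξ j)⟫_ℂ)) =
        fun j => innerSL ℂ y (borelOp ρ (f 0) (⟪η j, W x⟫_ℂ • (a j : ℂ) • ξ j)) := by
      funext j
      simp only [map_smul, innerSL_apply_apply, smul_eq_mul]
      ring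
    rw [e3]
    exact this

/-- The last operator is expanded as `∑ⱼ ⟪ηⱼ, ·⟫ aⱼ ξⱼ`, so that the trace is a sum of matrix
coefficients as in `exists_product_expansion_inner`. -/
theorem exists_product_expansion_trace {n : ℕ} (T : Fin (n + 1) → H →L[ℂ] H)
    (hT : ∀ i, IsTraceClass (T i)) :
    ∃ (ι : Type) (_ : Countable ι) (c : ι → ℂ) (ν : ι → Fin (n + 1) → Measure M),
      (Summable fun j => ‖c j‖) ∧ BoundedMass ν ∧
        ∀ f : Fin (n + 1) → M → ℂ, (∀ i, IsBoundedBorel (f i)) →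
          trace (List.ofFn fun i => borelOp ρ (f i) * T i).prod =
            ∑' j, c j * ∏ i, ∫ z, f i z ∂(ν j i) := by
  obtain ⟨ι, hι, c, hc, H1⟩ := exists_product_expansion_inner ρ (fun i : Fin n => T i.castSucc)
    fun i => hT i.castSucc
  obtain ⟨a, ξ, η, ha, hξ, hη, hrep⟩ := (hT (Fin.last n)).exists_normalized
  choose ν hν1 hν2 using fun j => H1 (η j) (ξ j) (hη j) (hξ j)
  have hsum : Summable fun p : ℕ × ι => ‖(a p.1 : ℂ) * c p.2‖ := by
    simpa using ha.mul_of_nonneg hc (fun _ => abs_nonneg _) (fun _ => norm_nonneg _)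
  refine ⟨ℕ × ι, inferInstance, fun p => (a p.1 : ℂ) * c p.2, fun p => ν p.1 p.2, hsum,
    fun p => hν1 p.1 p.2, fun f hf => ?_⟩
  set W := (List.ofFn fun i : Fin n => borelOp ρ (f i.castSucc) * T i.castSucc).prod *
    borelOp ρ (f (Fin.last n)) with hW
  have e1 : (List.ofFn fun i => borelOp ρ (f i) * T i).prod = W * T (Fin.last n) := by
    rw [List.ofFn_succ_last, List.prod_append, hW]
    simp [mul_assoc]
  rw [e1]
  have h2 := (hrep.comp_left W).trace_eq
  change trace (W * T (Fin.last n)) = _ at h2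
  rw [h2]
  obtain ⟨C, hC0, hC⟩ := exists_common_bound hf
  have hs2 : Summable fun p : ℕ × ι => (a p.1 : ℂ) * c p.2 * ∏ i, ∫ z, f i z ∂(ν p.1 p.2 i) :=
    Summable.of_norm_bounded (hsum.mul_right ((C * 4) ^ (n + 1))) fun p => by
      rw [norm_mul]
      exact mul_le_mul_of_nonneg_left (norm_prod_integral_le (hν1 p.1 p.2) hC hC0) (norm_nonneg _)
  rw [hs2.tsum_prod]
  refine tsum_congr fun j => ?_
  rw [map_smul, inner_smul_right, ← (hν2 j f hf).tsum_eq, ← tsum_mul_left]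
  exact tsum_congr fun k => (mul_assoc _ _ _).symm

theorem IsBoundedBorel.prod {n : ℕ} {f : Fin n → M → ℂ} (hf : ∀ i, IsBoundedBorel (f i)) :
    IsBoundedBorel fun x : Fin n → M => ∏ i, f i (x i) := by
  obtain ⟨C, hC0, hC⟩ := exists_common_bound hf
  refine ⟨Finset.measurable_prod _ fun i _ => (hf i).1.comp (measurable_pi_apply i), C ^ n,
    fun x => ?_⟩
  rw [norm_prod]
  calc ∏ i, ‖f i (x i)‖ ≤ ∏ _i : Fin n, C :=
        Finset.prod_le_prod (fun _ _ => norm_nonneg _) fun i _ => hC i _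
    _ = C ^ n := by simp

/-- For trace-class `Tᵢ` the multilinear functional `Tr(f₀ T₀ ⋯ fₙ Tₙ)` is given by a complex
measure. -/
theorem exists_complexMeasure_trace {n : ℕ} (T : Fin (n + 1) → H →L[ℂ] H)
    (hT : ∀ i, IsTraceClass (T i)) :
    ∃ μ : ComplexMeasure (Fin (n + 1) → M), ∀ f : Fin (n + 1) → M → ℂ,
      (∀ i, IsBoundedBorel (f i)) → cint μ (fun x => ∏ i, f i (x i)) =
        trace (List.ofFn fun i => borelOp ρ (f i) * T i).prod := by
  obtain ⟨ι, hι, c, ν, hc, hν, h⟩ := exists_product_expansion_trace ρ T hT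
  have hfin : ∀ j i, IsFiniteMeasure (ν j i) := fun j i => (hν j i).1
  obtain ⟨μ, hμ⟩ := exists_complexMeasure_of_sum (X := Fin (n + 1) → M) hc
    (m := fun j => Measure.pi (ν j)) (B := 4 ^ (n + 1)) fun j => ⟨inferInstance, by
      rw [Measure.real, Measure.pi_univ, ENNReal.toReal_prod]
      calc ∏ i, (ν j i Set.univ).toReal ≤ ∏ _i : Fin (n + 1), (4 : ℝ) :=
            Finset.prod_le_prod (fun _ _ => ENNReal.toReal_nonneg) fun i _ => (hν j i).2
        _ = _ := by simp⟩
  refine ⟨μ, fun f hf => ?_⟩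
  rw [hμ _ (IsBoundedBorel.prod hf), h f hf]
  refine tsum_congr fun j => ?_
  rw [integral_fintype_prod_eq_prod]

end ProductFormula

/-! ### Locally finite complex measures -/

section LocFin

variable {X : Type*} [MetricSpace X] [MeasurableSpace X]

theorem restrictTo_apply (μ : locFinMeasure X) {B : Set X} (hB : MeasurableSet B)
    (hb : Bornology.IsBounded B) {s : Set X} (hs : MeasurableSet s) :
    restrictTo μ B s = (μ : Set X → ℂ) (s ∩ B) := by
  exact if_pos ⟨hs, hB, hb⟩

theorem locFinMeasure_union {μ : Set X → ℂ} (hμ : μ ∈ locFinMeasure X) {s t : Set X}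
    (hs : MeasurableSet s) (ht : MeasurableSet t) (hbs : Bornology.IsBounded s)
    (hbt : Bornology.IsBounded t) (hd : Disjoint s t) : μ (s ∪ t) = μ s + μ t := by
  have h := VectorMeasure.of_union (v := restrictTo ⟨μ, hμ⟩ (s ∪ t)) hd hs ht
  have hu := hs.union ht
  have hb := hbs.union hbt
  rw [restrictTo_apply _ hu hb hu, restrictTo_apply _ hu hb hs, restrictTo_apply _ hu hb ht] at h
  simpa [Set.inter_eq_left.2 Set.subset_union_left, Set.inter_eq_left.2 Set.subset_union_right]
    using h

variable [BorelSpace X]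

/-- A finite measure that vanishes on a set `B` does not see the values on `B` of an integrand. -/
theorem cint_congr_of_null (μ : ComplexMeasure X) {B : Set X} (hB : MeasurableSet B)
    (h : ∀ s ⊆ B, MeasurableSet s → μ s = 0) {f g : X → ℂ} (hfg : ∀ x ∉ B, f x = g x) :
    cint μ f = cint μ g := by
  refine VectorMeasure.integral_congr_ae ?_
  rw [Filter.EventuallyEq, ae_iff]
  refine measure_mono_null (t := B) (fun x hx => ?_) ?_
  · by_contra hxB
    exact hx (hfg x hxB)
  · exact VectorMeasure.variation_apply_eq_zero hB |>.2 h

/-- The integral over `B` may be computed over any larger bounded set. -/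
theorem integralOn_eq_cint (μ : locFinMeasure X) {B B' : Set X} (hB : MeasurableSet B)
    (hB' : MeasurableSet B') (hb' : Bornology.IsBounded B') (hBB' : B ⊆ B') {g : X → ℂ}
    (hg : IsBoundedBorel (B.indicator g)) :
    integralOn μ B g = cint (restrictTo μ B') (B.indicator g) := by
  have hb := hb'.subset hBB'
  have h1 : integralOn μ B g = cint (restrictTo μ B) (B.indicator g) := by
    refine cint_congr_of_null (restrictTo μ B) hB.compl (fun s hs hms => ?_) fun x hx => ?_
    · rw [restrictTo_apply μ hB hb hms, Set.disjoint_iff_inter_eq_empty.1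
        (Set.disjoint_left.2 fun x hx => hs hx), locFinMeasure_empty μ.2]
    · rw [Set.indicator_of_mem (Set.notMem_compl_iff.1 hx)]
  have h2 := (isSigmaFunctional_cint (restrictTo μ B)).ext_indicator
    ((isSigmaFunctional_cint (restrictTo μ B')).comp_mul (isBoundedBorel_indicator hB))
    (fun s hs => by
      have e : (s.indicator fun _ => (1 : ℂ)) * (B.indicator fun _ => 1) =
          (s ∩ B).indicator fun _ => 1 := by
        ext x
        by_cases h1 : x ∈ s <;> by_cases h2 : x ∈ B <;> simp [h1, h2]
      rw [e, cint_indicator _ hs, cint_indicator _ (hs.inter hB), restrictTo_apply μ hB hb hs,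
        restrictTo_apply μ hB' hb' (hs.inter hB),
        Set.inter_eq_left.2 (Set.inter_subset_right.trans hBB')]) hg
  rw [h1, h2]
  congr 1
  ext x
  by_cases hx : x ∈ B <;> simp [hx]

theorem exists_isOpen_pi_superset {M : Type*} [MetricSpace M] {n : ℕ} {s : Set (Fin n → M)}
    (hs : Bornology.IsBounded s) :
    ∃ K : Set M, IsOpen K ∧ Bornology.IsBounded K ∧ s ⊆ Set.univ.pi fun _ => K := by
  rcases s.eq_empty_or_nonempty with rfl | ⟨p, hp⟩
  · exact ⟨∅, isOpen_empty, Bornology.isBounded_empty, Set.empty_subset _⟩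
  · obtain ⟨r, hr⟩ := hs.subset_closedBall p
    refine ⟨⋃ i, Metric.ball (p i) (r + 1), isOpen_iUnion fun _ => Metric.isOpen_ball,
      (Bornology.isBounded_iUnion).2 fun _ => Metric.isBounded_ball, fun x hx i _ => ?_⟩
    have h1 : dist x p ≤ r := hr hx
    exact Set.mem_iUnion.2 ⟨i, ((dist_le_pi_dist x p i).trans h1).trans_lt (lt_add_one r)⟩

theorem isBounded_univ_pi {M : Type*} [MetricSpace M] {n : ℕ} {B : Fin n → Set M}
    (h : ∀ i, Bornology.IsBounded (B i)) : Bornology.IsBounded (Set.univ.pi B) :=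
  Bornology.IsBounded.pi h

end LocFin

section LocFinPi

variable {M : Type*} [MetricSpace M] [ProperSpace M] [MeasurableSpace M] [BorelSpace M] {n : ℕ}

/-- Locally finite measures are determined by their values on bounded open boxes. -/
theorem locFinMeasure_ext_openBox {μ ν : Set (Fin n → M) → ℂ}
    (hμ : μ ∈ locFinMeasure (Fin n → M)) (hν : ν ∈ locFinMeasure (Fin n → M))
    (h : ∀ B : Fin n → Set M, (∀ i, IsOpen (B i)) → (∀ i, Bornology.IsBounded (B i)) →
      μ (Set.univ.pi B) = ν (Set.univ.pi B)) : μ = ν := by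
  ext s
  by_cases hs : MeasurableSet s ∧ Bornology.IsBounded s
  · obtain ⟨K, hK, hb, hsK⟩ := exists_isOpen_pi_superset hs.2
    have hQ : MeasurableSet (Set.univ.pi fun _ : Fin n => K) :=
      MeasurableSet.univ_pi fun _ => hK.measurableSet
    have hQb : Bornology.IsBounded (Set.univ.pi fun _ : Fin n => K) :=
      isBounded_univ_pi fun _ => hb
    have e : restrictTo ⟨μ, hμ⟩ (Set.univ.pi fun _ : Fin n => K) =
        restrictTo ⟨ν, hν⟩ (Set.univ.pi fun _ : Fin n => K) := by
      refine complexMeasure_ext_openBox fun B hB => ?_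
      have hBm := MeasurableSet.univ_pi fun i => (hB i).measurableSet
      rw [restrictTo_apply _ hQ hQb hBm, restrictTo_apply _ hQ hQb hBm, ← Set.pi_inter_distrib]
      exact h _ (fun i => (hB i).inter hK) fun i => hb.subset Set.inter_subset_right
    have := congrArg (fun m : ComplexMeasure (Fin n → M) => m s) e
    simpa only [restrictTo_apply _ hQ hQb hs.1, Set.inter_eq_left.2 hsK] using this
  · rw [hμ.1 s hs, hν.1 s hs]

open Classical in
/-- Complex measures with prescribed values on boxes inside the bounded cubes `K × ⋯ × K` glue to a
locally finite complex measure. -/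
theorem exists_locFinMeasure_of_box (t : (Fin n → Set M) → ℂ)
    (h : ∀ K : Set M, MeasurableSet K → Bornology.IsBounded K →
      ∃ μ : ComplexMeasure (Fin n → M), ∀ B : Fin n → Set M, (∀ i, MeasurableSet (B i)) →
        μ (Set.univ.pi B) = t fun i => B i ∩ K) :
    ∃ μ ∈ locFinMeasure (Fin n → M), ∀ B : Fin n → Set M, (∀ i, MeasurableSet (B i)) →
      (∀ i, Bornology.IsBounded (B i)) → μ (Set.univ.pi B) = t B := by
  choose! m hm using h
  -- a bounded set `s` is measured with the measure of a cube that contains it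
  let hull : Set (Fin n → M) → Set M := fun s => if hs : Bornology.IsBounded s then
    (exists_isOpen_pi_superset hs).choose else ∅
  have hull_spec : ∀ s, Bornology.IsBounded s → MeasurableSet (hull s) ∧
      Bornology.IsBounded (hull s) ∧ s ⊆ Set.univ.pi fun _ => hull s := fun s hs => by
    simp only [hull, hs, dif_pos]
    exact ⟨(exists_isOpen_pi_superset hs).choose_spec.1.measurableSet,
      (exists_isOpen_pi_superset hs).choose_spec.2⟩
  -- the measures of two cubes agree on the subsets of both
  have cons : ∀ K L : Set M, MeasurableSet K → Bornology.IsBounded K → MeasurableSet L →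
      Bornology.IsBounded L → ∀ s : Set (Fin n → M), MeasurableSet s →
      (s ⊆ Set.univ.pi fun _ => K) → (s ⊆ Set.univ.pi fun _ => L) → m K s = m L s := by
    intro K L hK hKb hL hLb s hs hsK hsL
    have hQ : MeasurableSet (Set.univ.pi fun _ : Fin n => K ∩ L) :=
      MeasurableSet.univ_pi fun _ => hK.inter hL
    have e : (m K).restrict (Set.univ.pi fun _ : Fin n => K ∩ L) =
        (m L).restrict (Set.univ.pi fun _ : Fin n => K ∩ L) := by
      refine complexMeasure_ext_box fun B hB => ?_
      have hBm := MeasurableSet.univ_pi hB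
      rw [VectorMeasure.restrict_apply _ hQ hBm, VectorMeasure.restrict_apply _ hQ hBm,
        ← Set.pi_inter_distrib, hm K hK hKb _ fun i => (hB i).inter (hK.inter hL),
        hm L hL hLb _ fun i => (hB i).inter (hK.inter hL)]
      congr 1
      ext i x
      simp only [Set.mem_inter_iff]
      tauto
    have hsub : s ⊆ Set.univ.pi fun _ : Fin n => K ∩ L := fun x hx i hi =>
      ⟨hsK hx i hi, hsL hx i hi⟩
    have := congrArg (fun m : ComplexMeasure (Fin n → M) => m s) e
    simpa only [VectorMeasure.restrict_apply _ hQ hs, Set.inter_eq_left.2 hsub] using this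
  let μ : Set (Fin n → M) → ℂ := fun s =>
    if MeasurableSet s ∧ Bornology.IsBounded s then m (hull s) s else 0
  have hμ : ∀ K, MeasurableSet K → Bornology.IsBounded K → ∀ s, MeasurableSet s →
      (s ⊆ Set.univ.pi fun _ => K) → μ s = m K s := by
    intro K hK hKb s hs hsK
    have hb : Bornology.IsBounded s := (isBounded_univ_pi fun _ => hKb).subset hsK
    have := hull_spec s hb
    simp only [μ, hs, hb, and_self, if_true]
    exact cons _ _ this.1 this.2.1 hK hKb s hs this.2.2 hsK
  refine ⟨μ, ⟨fun s hs => if_neg hs, fun s h1 h2 h3 => ?_⟩, fun B hB hb => ?_⟩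
  · obtain ⟨hK, hKb, hsK⟩ := hull_spec _ h3
    rw [hμ _ hK hKb _ (MeasurableSet.iUnion h1) hsK]
    simp_rw [fun i => hμ _ hK hKb _ (h1 i) ((Set.subset_iUnion s i).trans hsK)]
    exact (m (hull (⋃ i, s i))).m_iUnion h1 h2
  · have hK : MeasurableSet (⋃ i, B i) := MeasurableSet.iUnion hB
    have hKb : Bornology.IsBounded (⋃ i, B i) := (Bornology.isBounded_iUnion).2 hb
    rw [hμ _ hK hKb _ (MeasurableSet.univ_pi hB) (Set.pi_mono fun i _ => Set.subset_iUnion B i),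
      hm _ hK hKb _ hB]
    congr 1
    ext1 i
    exact Set.inter_eq_left.2 (Set.subset_iUnion B i)

/-- Vanishing on small boxes around each point of a set implies vanishing on the set. -/
theorem locFinMeasure_eq_zero_of_locally {μ : Set (Fin n → M) → ℂ}
    (hμ : μ ∈ locFinMeasure (Fin n → M)) {s : Set (Fin n → M)}
    (h : ∀ x ∈ s, ∃ V : Fin n → Set M, (∀ i, V i ∈ 𝓝 (x i) ∧ MeasurableSet (V i)) ∧
      ∀ B : Fin n → Set M, (∀ i, MeasurableSet (B i)) → (∀ i, Bornology.IsBounded (B i)) →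
        (∀ i, B i ⊆ V i) → μ (Set.univ.pi B) = 0) : μ s = 0 := by
  by_cases hs : MeasurableSet s ∧ Bornology.IsBounded s
  · obtain ⟨K, hK, hb, hsK⟩ := exists_isOpen_pi_superset hs.2
    have hQ : MeasurableSet (Set.univ.pi fun _ : Fin n => K) :=
      MeasurableSet.univ_pi fun _ => hK.measurableSet
    have hQb : Bornology.IsBounded (Set.univ.pi fun _ : Fin n => K) :=
      isBounded_univ_pi fun _ => hb
    set m := restrictTo ⟨μ, hμ⟩ (Set.univ.pi fun _ : Fin n => K) with hm
    have hnull : m.variation s = 0 := by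
      refine measure_null_of_locally_null s fun x hx => ?_
      obtain ⟨V, hV, hB⟩ := h x hx
      have hVm : MeasurableSet (Set.univ.pi V) := MeasurableSet.univ_pi fun i => (hV i).2
      refine ⟨Set.univ.pi V, mem_nhdsWithin_of_mem_nhds
        (set_pi_mem_nhds Set.finite_univ fun i _ => (hV i).1), ?_⟩
      rw [VectorMeasure.variation_apply_eq_zero hVm]
      have e : m.restrict (Set.univ.pi V) = 0 := by
        refine complexMeasure_ext_box fun B hBm => ?_
        have hBm' := MeasurableSet.univ_pi hBm
        rw [VectorMeasure.restrict_apply _ hVm hBm', hm, restrictTo_apply _ hQ hQb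
          (hBm'.inter hVm), ← Set.pi_inter_distrib, ← Set.pi_inter_distrib]
        exact hB _ (fun i => ((hBm i).inter (hV i).2).inter hK.measurableSet)
          (fun i => hb.subset Set.inter_subset_right)
          fun i => Set.inter_subset_left.trans Set.inter_subset_right
      intro t ht htm
      have := congrArg (fun m : ComplexMeasure (Fin n → M) => m t) e
      rw [VectorMeasure.restrict_apply _ hVm htm, Set.inter_eq_left.2 ht] at this
      exact this
    have := (VectorMeasure.variation_apply_eq_zero hs.1).1 hnull s le_rfl hs.1
    rwa [hm, restrictTo_apply _ hQ hQb hs.1, Set.inter_eq_left.2 hsK] at this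
  · exact hμ.1 s hs

end LocFinPi

/-! ### The character measure -/

section ListProducts

variable {R : Type*}

/-- The projection `e` moves through the product `a₀ e a₁ e ⋯`. -/
theorem prod_ofFn_mul_right_comm [Monoid R] (e : R) {n : ℕ} (a : Fin n → R) :
    e * (List.ofFn fun i => a i * e).prod = (List.ofFn fun i => e * a i).prod * e := by
  induction n with
  | zero => simp
  | succ n ih =>
    rw [List.ofFn_succ, List.ofFn_succ, List.prod_cons, List.prod_cons, mul_assoc, mul_assoc,
      mul_assoc, ih fun i => a i.succ]

theorem prod_ofFn_eq_zero [MonoidWithZero R] {n : ℕ} (g : Fin (n + 1) → R) (i : Fin n)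
    (h : g i.castSucc * g i.succ = 0) : (List.ofFn g).prod = 0 := by
  induction n with
  | zero => exact i.elim0
  | succ n ih =>
    rw [List.ofFn_succ, List.prod_cons]
    rcases Fin.eq_zero_or_eq_succ i with rfl | ⟨j, rfl⟩
    · rw [List.ofFn_succ, List.prod_cons, ← mul_assoc]
      have h' : g 0 * g (Fin.succ 0) = 0 := h
      rw [h', zero_mul]
    · rw [ih (fun i => g i.succ) j h, mul_zero]

/-- Contraction of adjacent factors does not change a product. -/
theorem prod_ofFn_contractNth [Monoid R] {n : ℕ} (g : Fin (n + 2) → R) (i : Fin (n + 1)) :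
    (List.ofFn (Fin.contractNth i.castSucc (· * ·) g)).prod = (List.ofFn g).prod := by
  induction n with
  | zero =>
    obtain rfl : i = 0 := Fin.ext (by omega)
    simp [List.ofFn_succ, Fin.contractNth]
  | succ n ih =>
    rcases Fin.eq_zero_or_eq_succ i with rfl | ⟨j, rfl⟩
    · rw [List.ofFn_succ, List.ofFn_succ (f := g), List.ofFn_succ (f := fun i => g i.succ)]
      simp [Fin.contractNth, mul_assoc]
    · rw [List.ofFn_succ, List.ofFn_succ (f := g), List.prod_cons, List.prod_cons,
        ← ih (fun i => g i.succ) j]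
      have e : (fun k : Fin (n + 1) => Fin.contractNth j.succ.castSucc (· * ·) g k.succ) =
          Fin.contractNth j.castSucc (· * ·) fun i => g i.succ := by
        ext1 k
        simp [Fin.contractNth]
      rw [e]
      simp [Fin.contractNth]

end ListProducts

section LocalMeasures

variable {M : Type*} [MetricSpace M] [ProperSpace M] [MeasurableSpace M] [BorelSpace M]
variable {H : Type*} [NormedAddCommGroup H] [InnerProductSpace ℂ H] [CompleteSpace H]
variable (ρ : C₀(M, ℂ) →⋆ₙₐ[ℂ] (H →L[ℂ] H)) {n : ℕ}

theorem sandwich_tprod (f : Fin (n + 1) → M → ℂ) (T : Fin (n + 1) → algB ρ) :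
    sandwich ρ f (PiTensorProduct.tprod ℂ T) =
      (List.ofFn fun i => borelOp ρ (f i) * (T i : H →L[ℂ] H)).prod := by
  rw [sandwich, PiTensorProduct.lift.tprod, MultilinearMap.compLinearMap_apply,
    MultilinearMap.mkPiAlgebraFin_apply]
  rfl

variable (hρ : ∀ v : H, (∀ f : C₀(M, ℂ), ρ f v = 0) → v = 0)
include hρ

omit hρ in
theorem indicator_eq_mul (K : Set M) (f : M → ℂ) :
    K.indicator f = (K.indicator fun _ => 1) * f := by
  ext x
  by_cases h : x ∈ K <;> simp [h]

theorem isTraceClass_sandwich {f : Fin (n + 1) → M → ℂ} (hf : IsBoundedBorel (f 0))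
    (hc : HasCompactSupport (f 0)) (z : Chains (algB ρ) n) : IsTraceClass (sandwich ρ f z) := by
  induction z using PiTensorProduct.induction_on with
  | smul_tprod r T =>
    rw [map_smul, sandwich_tprod, List.ofFn_succ, List.prod_cons]
    exact (((algB_spec hρ (T 0)).1 _ hf hc).1.mul_right _).smul r
  | add x y hx hy =>
    rw [map_add]
    exact hx.add hy

/-- The functional `Tr(f₀ T₀ ⋯ fₙ Tₙ)` is given by a complex measure as long as all `fᵢ` live on a
fixed bounded set. -/
theorem exists_complexMeasure_sandwich {K : Set M} (hK : MeasurableSet K)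
    (hb : Bornology.IsBounded K) (z : Chains (algB ρ) n) :
    ∃ μ : ComplexMeasure (Fin (n + 1) → M), ∀ f : Fin (n + 1) → M → ℂ,
      (∀ i, IsBoundedBorel (f i)) → cint μ (fun x => ∏ i, f i (x i)) =
        trace (sandwich ρ (fun i => K.indicator (f i)) z) := by
  have hKb := isBoundedBorel_indicator hK
  have hind : ∀ {f : M → ℂ}, IsBoundedBorel f → IsBoundedBorel (K.indicator f) := fun hf => by
    rw [indicator_eq_mul]; exact hKb.mul hf
  have hcs : ∀ f : M → ℂ, HasCompactSupport (K.indicator f) := fun f =>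
    hb.isCompact_closure.of_isClosed_subset (isClosed_tsupport _)
      (closure_mono Set.support_indicator_subset)
  induction z using PiTensorProduct.induction_on with
  | smul_tprod r T =>
    have htc : ∀ i, IsTraceClass ((T i : H →L[ℂ] H) * setOp ρ K) := fun i =>
      (algB_spec hρ (T i)).1.mul_setOp hK hb
    obtain ⟨μ, hμ⟩ := exists_complexMeasure_trace ρ _ htc
    refine ⟨r • μ, fun f hf => ?_⟩
    have hsm : ∀ g, IsBoundedBorel g → cint (r • μ) g = r * cint μ g := fun g hg =>
      (isSigmaFunctional_cint (r • μ)).ext_indicator ((isSigmaFunctional_cint μ).const_mul r)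
        (fun s hs => by rw [cint_indicator _ hs, cint_indicator _ hs]; rfl) hg
    rw [hsm _ (IsBoundedBorel.prod hf), hμ f hf, map_smul, trace_smul, sandwich_tprod]
    congr 1
    -- with `e` the indicator function of `K`, `Tr(e a₀ e a₁ ⋯ e aₙ) = Tr(a₀ e a₁ e ⋯ aₙ e)`, and the
    -- operators `Tᵢ e` are trace-class
    set e := setOp ρ K with he
    set a : Fin (n + 1) → H →L[ℂ] H := fun i => borelOp ρ (f i) * (T i : H →L[ℂ] H)
    have hee : e * e = e := by rw [he, setOp_mul ρ hK hK, Set.inter_self]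
    have h1 : (List.ofFn fun i => borelOp ρ (K.indicator (f i)) * (T i : H →L[ℂ] H)) =
        List.ofFn fun i => e * a i := by
      congr 1
      ext1 i
      rw [indicator_eq_mul, borelOp_mul ρ hKb (hf i), mul_assoc]
      rfl
    have h2 : (List.ofFn fun i => borelOp ρ (f i) * ((T i : H →L[ℂ] H) * e)) =
        List.ofFn fun i => a i * e := by
      simp only [a, mul_assoc]
    rw [h1, h2]
    have h3 : (List.ofFn fun i => a i * e).prod * e = (List.ofFn fun i => a i * e).prod := by
      rw [List.ofFn_succ_last, List.prod_append, List.prod_singleton, mul_assoc, mul_assoc, hee]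
    have h4 : e * (List.ofFn fun i => e * a i).prod = (List.ofFn fun i => e * a i).prod := by
      rw [List.ofFn_succ, List.prod_cons, ← mul_assoc, ← mul_assoc, hee]
    have h5 : IsTraceClass (List.ofFn fun i => e * a i).prod := by
      rw [← h1, ← sandwich_tprod ρ (fun i => K.indicator (f i))]
      exact isTraceClass_sandwich ρ hρ (hind (hf 0)) (hcs _) _
    have h6 : IsTraceClass (List.ofFn fun i => a i * e).prod := by
      rw [List.ofFn_succ_last, List.prod_append, List.prod_singleton]
      refine IsTraceClass.mul_left ?_ _
      rw [mul_assoc]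
      exact (htc _).mul_left _
    calc trace (List.ofFn fun i => a i * e).prod
        = trace (e * (List.ofFn fun i => a i * e).prod) := by
          rw [h6.trace_mul_comm, h3]
      _ = trace (e * (List.ofFn fun i => e * a i).prod) := by
          rw [prod_ofFn_mul_right_comm, h5.trace_mul_comm]
      _ = _ := by rw [h4]
  | add x y hx hy =>
    obtain ⟨μ, hμ⟩ := hx
    obtain ⟨ν, hν⟩ := hy
    refine ⟨μ + ν, fun f hf => ?_⟩
    have htc : ∀ z, IsTraceClass (sandwich ρ (fun i => K.indicator (f i)) z) := fun z =>
      isTraceClass_sandwich ρ hρ (f := fun i => K.indicator (f i)) (hind (hf 0)) (hcs _) z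
    rw [cint_add_measure _ _ (IsBoundedBorel.prod hf), hμ f hf, hν f hf, map_add,
      (htc x).trace_add (htc y)]

end LocalMeasures

section CharacterMeasure

variable {M : Type*} [MetricSpace M] [ProperSpace M] [MeasurableSpace M] [BorelSpace M]
variable {H : Type*} [NormedAddCommGroup H] [InnerProductSpace ℂ H] [CompleteSpace H]
variable (ρ : C₀(M, ℂ) →⋆ₙₐ[ℂ] (H →L[ℂ] H)) {n : ℕ}

/-- `Tr(B₀ T₀ ⋯ Bₙ Tₙ)` for `z = T₀ ⊗ ⋯ ⊗ Tₙ`, the value of `χ(z)` on the box `B₀ × ⋯ × Bₙ`. -/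
def boxTrace (z : Chains (algB ρ) n) (B : Fin (n + 1) → Set M) : ℂ :=
  trace (sandwich ρ (fun i => (B i).indicator fun _ => 1) z)

theorem boxTrace_tprod (T : Fin (n + 1) → algB ρ) (B : Fin (n + 1) → Set M) :
    boxTrace ρ (PiTensorProduct.tprod ℂ T) B =
      trace (List.ofFn fun i => setOp ρ (B i) * (T i : H →L[ℂ] H)).prod := by
  rw [boxTrace, sandwich_tprod]
  rfl

theorem prod_indicator {B : Fin n → Set M} :
    (fun x : Fin n → M => ∏ i, (B i).indicator (fun _ => (1 : ℂ)) (x i)) =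
      (Set.univ.pi B).indicator fun _ => 1 := by
  ext x
  by_cases h : x ∈ Set.univ.pi B
  · rw [Set.indicator_of_mem h]
    exact Finset.prod_eq_one fun i _ => Set.indicator_of_mem (h i (Set.mem_univ i)) _
  · rw [Set.indicator_of_notMem h]
    simp only [Set.mem_pi, Set.mem_univ, true_implies, not_forall] at h
    obtain ⟨i, hi⟩ := h
    exact Finset.prod_eq_zero (Finset.mem_univ i) (Set.indicator_of_notMem hi _)

variable (hρ : ∀ v : H, (∀ f : C₀(M, ℂ), ρ f v = 0) → v = 0)
include hρ

theorem boxTrace_add (z w : Chains (algB ρ) n) {B : Fin (n + 1) → Set M}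
    (hB : ∀ i, MeasurableSet (B i)) (hb : ∀ i, Bornology.IsBounded (B i)) :
    boxTrace ρ (z + w) B = boxTrace ρ z B + boxTrace ρ w B := by
  have htc : ∀ z, IsTraceClass (sandwich ρ (fun i => (B i).indicator fun _ => 1) z) := fun z =>
    isTraceClass_sandwich ρ hρ (f := fun i => (B i).indicator fun _ => 1)
      (isBoundedBorel_indicator (hB 0)) (hasCompactSupport_indicator (hb 0)) z
  rw [boxTrace, map_add, (htc z).trace_add (htc w)]
  rfl

/-- The measures on bounded cubes glue. -/
theorem exists_boxTrace_measure (z : Chains (algB ρ) n) :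
    ∃ μ ∈ locFinMeasure (Fin (n + 1) → M), ∀ B : Fin (n + 1) → Set M, (∀ i, MeasurableSet (B i)) →
      (∀ i, Bornology.IsBounded (B i)) → μ (Set.univ.pi B) = boxTrace ρ z B := by
  refine exists_locFinMeasure_of_box _ fun K hK hb => ?_
  obtain ⟨μ, hμ⟩ := exists_complexMeasure_sandwich ρ hρ hK hb z
  refine ⟨μ, fun B hB => ?_⟩
  have := hμ _ fun i => isBoundedBorel_indicator (hB i)
  rw [prod_indicator, cint_indicator _ (MeasurableSet.univ_pi hB)] at this
  rw [this, boxTrace]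
  simp only [Set.indicator_indicator, Set.inter_comm]

/-- The coarse character measure `χ(z)`, with `χ(z)(B₀ × ⋯ × Bₙ) = Tr(B₀ T₀ ⋯ Bₙ Tₙ)` for
`z = T₀ ⊗ ⋯ ⊗ Tₙ`. -/
def chi : Chains (algB ρ) n →ₗ[ℂ] (Set (Fin (n + 1) → M) → ℂ) where
  toFun z := (exists_boxTrace_measure ρ hρ z).choose
  map_add' z w := by
    have h := fun z => (exists_boxTrace_measure (n := n) ρ hρ z).choose_spec
    refine locFinMeasure_ext_openBox (h _).1 (add_mem (h _).1 (h _).1) fun B hB hb => ?_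
    have hBm := fun i => (hB i).measurableSet
    rw [(h _).2 B hBm hb, Pi.add_apply, (h _).2 B hBm hb, (h _).2 B hBm hb,
      boxTrace_add ρ hρ _ _ hBm hb]
  map_smul' c z := by
    have h := fun z => (exists_boxTrace_measure (n := n) ρ hρ z).choose_spec
    refine locFinMeasure_ext_openBox (h _).1 (Submodule.smul_mem _ _ (h _).1) fun B hB hb => ?_
    have hBm := fun i => (hB i).measurableSet
    rw [(h _).2 B hBm hb, RingHom.id_apply, Pi.smul_apply, (h _).2 B hBm hb, boxTrace, map_smul,
      trace_smul]
    rfl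

theorem chi_mem_locFin (z : Chains (algB ρ) n) : chi ρ hρ z ∈ locFinMeasure (Fin (n + 1) → M) :=
  (exists_boxTrace_measure ρ hρ z).choose_spec.1

theorem chi_box (z : Chains (algB ρ) n) {B : Fin (n + 1) → Set M} (hB : ∀ i, MeasurableSet (B i))
    (hb : ∀ i, Bornology.IsBounded (B i)) : chi ρ hρ z (Set.univ.pi B) = boxTrace ρ z B :=
  (exists_boxTrace_measure ρ hρ z).choose_spec.2 B hB hb

theorem isCharacterMeasure_chi (z : Chains (algB ρ) n) :
    IsCharacterMeasure ρ z ⟨chi ρ hρ z, chi_mem_locFin ρ hρ z⟩ := by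
  intro f hf
  have hbb := fun i => isBoundedBorel_of_hasCompactSupport (hf i).1 (hf i).2
  set K := ⋃ i, tsupport (f i) with hKdef
  have hK : MeasurableSet K := MeasurableSet.iUnion fun i => (isClosed_tsupport _).measurableSet
  have hb : Bornology.IsBounded K := (Bornology.isBounded_iUnion).2 fun i => (hf i).2.isBounded
  have hKc : IsClosed K := isClosed_iUnion_of_finite fun i => isClosed_tsupport _
  have hfK : ∀ i, K.indicator (f i) = f i := fun i => by
    refine Set.indicator_eq_self.2 fun x hx => ?_
    exact Set.mem_iUnion.2 ⟨i, subset_tsupport _ hx⟩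
  have hQc : IsClosed (Set.univ.pi fun _ : Fin (n + 1) => K) :=
    isClosed_set_pi fun _ _ => hKc
  have hQ := hQc.measurableSet
  have hQb : Bornology.IsBounded (Set.univ.pi fun _ : Fin (n + 1) => K) :=
    isBounded_univ_pi fun _ => hb
  set F : (Fin (n + 1) → M) → ℂ := fun x => ∏ i, f i (x i) with hF
  have hsub : tsupport F ⊆ Set.univ.pi fun _ : Fin (n + 1) => K := by
    refine closure_minimal (fun x hx i _ => ?_) hQc
    have := Finset.prod_ne_zero_iff.1 hx i (Finset.mem_univ i)
    exact Set.mem_iUnion.2 ⟨i, subset_tsupport _ this⟩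
  have hFi : (tsupport F).indicator F = F := Set.indicator_eq_self.2 (subset_tsupport F)
  have hFb : IsBoundedBorel F := IsBoundedBorel.prod hbb
  rw [integralOn_eq_cint _ (isClosed_tsupport F).measurableSet hQ hQb hsub (by rwa [hFi]), hFi]
  obtain ⟨μ, hμ⟩ := exists_complexMeasure_sandwich ρ hρ hK hb z
  have e : restrictTo ⟨chi ρ hρ z, chi_mem_locFin ρ hρ z⟩
      (Set.univ.pi fun _ : Fin (n + 1) => K) = μ := by
    refine complexMeasure_ext_box fun B hB => ?_
    have := hμ _ fun i => isBoundedBorel_indicator (hB i)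
    rw [prod_indicator, cint_indicator _ (MeasurableSet.univ_pi hB)] at this
    rw [this, restrictTo_apply _ hQ hQb (MeasurableSet.univ_pi hB), ← Set.pi_inter_distrib]
    change chi ρ hρ z _ = _
    rw [chi_box ρ hρ z (fun i => (hB i).inter hK) fun i => hb.subset Set.inter_subset_right,
      boxTrace]
    simp only [Set.indicator_indicator, Set.inter_comm]
  rw [e, hF, hμ f hbb]
  simp only [hfK]

omit hρ in
/-- A locally finite measure on `M^{n+1}` is determined by the integrals of products of compactly
supported continuous functions. -/
theorem IsCharacterMeasure.unique {z : Chains (algB ρ) n}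
    {μ ν : locFinMeasure (Fin (n + 1) → M)} (hμ : IsCharacterMeasure ρ z μ)
    (hν : IsCharacterMeasure ρ z ν) : μ = ν := by
  refine Subtype.ext (locFinMeasure_ext_openBox μ.2 ν.2 fun B hB hb => ?_)
  choose f h1 h2 h3 h4 h5 using fun i => exists_tendsto_indicator_of_isOpen (hB i)
  set Q : Set (Fin (n + 1) → M) := closure (Set.univ.pi B) with hQd
  have hQ : MeasurableSet Q := isClosed_closure.measurableSet
  have hQb : Bornology.IsBounded Q := (isBounded_univ_pi hb).closure
  have hBm : MeasurableSet (Set.univ.pi B) := MeasurableSet.univ_pi fun i => (hB i).measurableSet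
  let F : ℕ → (Fin (n + 1) → M) → ℂ := fun k x => ∏ i, f i k (x i)
  have hFc : ∀ k, Continuous (F k) := fun k => by
    refine continuous_finsetProd _ fun i _ => (h1 i k).comp (continuous_apply i)
  have hsub : ∀ k, tsupport (F k) ⊆ Q := fun k => by
    refine closure_mono fun x hx i _ => ?_
    by_contra hxi
    exact Finset.prod_ne_zero_iff.1 hx i (Finset.mem_univ i) (h4 i k _ hxi)
  have hnorm : ∀ k x, ‖F k x‖ ≤ 1 := fun k x => by
    simp only [F, norm_prod]
    exact Finset.prod_le_one (fun _ _ => norm_nonneg _) fun i _ => h3 i k _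
  have hlim : ∀ x, Tendsto (fun k => F k x) atTop
      (𝓝 ((Set.univ.pi B).indicator (fun _ => 1) x)) := fun x => by
    rw [← prod_indicator]
    exact tendsto_finsetProd _ fun i _ => h5 i _
  have key : ∀ μ : locFinMeasure (Fin (n + 1) → M), IsCharacterMeasure ρ z μ →
      Tendsto (fun k => trace (sandwich ρ (fun i => f i k) z)) atTop
        (𝓝 ((μ : Set (Fin (n + 1) → M) → ℂ) (Set.univ.pi B))) := fun μ hμ => by
    have hl := (isSigmaFunctional_cint (restrictTo μ Q)).lim F _ 1 (fun k => (hFc k).measurable)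
      (measurable_const.indicator hBm) hnorm (fun x => by
        by_cases hx : x ∈ Set.univ.pi B
        · rw [Set.indicator_of_mem hx]; simp
        · rw [Set.indicator_of_notMem hx]; simp) hlim
    rw [cint_indicator _ hBm, restrictTo_apply μ hQ hQb hBm,
      Set.inter_eq_left.2 subset_closure] at hl
    refine hl.congr fun k => ?_
    rw [← hμ (fun i => f i k) fun i => ⟨h1 i k, h2 i k⟩]
    have hFi : (tsupport (F k)).indicator (F k) = F k :=
      Set.indicator_eq_self.2 (subset_tsupport _)
    change _ = integralOn μ (tsupport (F k)) (F k)
    rw [integralOn_eq_cint μ (isClosed_tsupport _).measurableSet hQ hQb (hsub k)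
      (by rw [hFi]; exact ⟨(hFc k).measurable, 1, hnorm k⟩), hFi]
  exact tendsto_nhds_unique (key μ hμ) (key ν hν)

end CharacterMeasure

/-! ### Support and symmetry of the character measure -/

section CoarseGeometry

variable {M : Type*} [MetricSpace M] {n : ℕ}

/-- A tuple with all coordinates near one point is near the diagonal. -/
theorem mem_diagThickening {x : Fin (n + 1) → M} {R : ℝ} {c : M}
    (h : ∀ i, dist (x i) c ≤ R) : x ∈ diagThickening M n R :=
  Metric.mem_cthickening_of_dist_le x (fun _ => c) R _ ⟨c, rfl⟩
    ((dist_pi_le_iff (dist_nonneg.trans (h 0))).2 h)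

/-- The slack of `2` avoids choosing a nearest point on the diagonal. -/
theorem dist_le_of_mem_diagThickening {x : Fin (n + 1) → M} {R : ℝ} (hR : 0 ≤ R)
    (hx : x ∈ diagThickening M n R) (i j : Fin (n + 1)) : dist (x i) (x j) ≤ 2 * R + 2 := by
  obtain ⟨_, ⟨c, rfl⟩, h⟩ := Metric.mem_thickening_iff.1
    (Metric.cthickening_subset_thickening' (hR.trans_lt (lt_add_one R)) (lt_add_one R) _ hx)
  have h1 := (dist_le_pi_dist x (fun _ => c) i).trans h.le
  have h2 := (dist_le_pi_dist x (fun _ => c) j).trans h.le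
  have h3 := dist_triangle_right (x i) (x j) c
  linarith

theorem eventually_subset_diagThickening {s : Set (Fin (n + 1) → M)}
    (hs : Bornology.IsBounded s) : ∀ᶠ R in atTop, s ⊆ diagThickening M n R := by
  obtain ⟨K, -, hK, hsK⟩ := exists_isOpen_pi_superset hs
  obtain ⟨D, hD⟩ := Metric.isBounded_iff.1 hK
  filter_upwards [eventually_ge_atTop D] with R hR x hx
  exact mem_diagThickening (c := x 0) fun i =>
    (hD (hsK hx i (Set.mem_univ i)) (hsK hx 0 (Set.mem_univ 0))).trans hR

theorem diagThickening_perm (σ : Equiv.Perm (Fin (n + 1))) {R : ℝ} {x : Fin (n + 1) → M} :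
    (fun i => x (σ i)) ∈ diagThickening M n R ↔ x ∈ diagThickening M n R := by
  have key : ∀ (σ : Equiv.Perm (Fin (n + 1))) (x : Fin (n + 1) → M),
      x ∈ diagThickening M n R → (fun i => x (σ i)) ∈ diagThickening M n R := by
    intro σ x hx
    rw [diagThickening, Metric.mem_cthickening_iff] at hx ⊢
    refine le_trans ?_ hx
    refine le_iInf₂ fun y hy => ?_
    obtain ⟨c, rfl⟩ := hy
    refine (Metric.infEDist_le_edist_of_mem (Set.mem_range_self c)).trans ?_
    exact edist_pi_le_iff.2 fun i => edist_le_pi_edist x (fun _ => c) (σ i)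
  refine ⟨fun h => ?_, key σ x⟩
  simpa using key σ.symm _ h

theorem isBounded_preimage_face_inter {s : Set (Fin (n + 1) → M)} (hs : Bornology.IsBounded s)
    (i : Fin (n + 2)) (R : ℝ) :
    Bornology.IsBounded ((fun (x : Fin (n + 2) → M) j => x (i.succAbove j)) ⁻¹' s ∩
      diagThickening M (n + 1) R) := by
  obtain ⟨K, -, hK, hsK⟩ := exists_isOpen_pi_superset hs
  have hb : Bornology.IsBounded (Set.univ.pi fun _ : Fin (n + 2) =>
      Metric.cthickening (2 * max R 0 + 2) K) := isBounded_univ_pi fun _ => hK.cthickening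
  refine hb.subset fun x ⟨hx, hxR⟩ j _ => ?_
  have h0 : x (i.succAbove 0) ∈ K := hsK hx 0 (Set.mem_univ 0)
  exact Metric.mem_cthickening_of_dist_le _ _ _ _ h0 (dist_le_of_mem_diagThickening
    (le_max_right _ _) (Metric.cthickening_mono (le_max_left R 0) _ hxR) _ _)

theorem measurableSet_diagThickening [ProperSpace M] [MeasurableSpace M] [BorelSpace M] (R : ℝ) :
    MeasurableSet (diagThickening M n R) :=
  Metric.isClosed_cthickening.measurableSet

theorem isBounded_preimage_perm {s : Set (Fin n → M)} (hs : Bornology.IsBounded s)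
    (σ : Equiv.Perm (Fin n)) : Bornology.IsBounded ((fun (x : Fin n → M) i => x (σ i)) ⁻¹' s) := by
  obtain ⟨K, -, hK, hsK⟩ := exists_isOpen_pi_superset hs
  refine (isBounded_univ_pi fun _ => hK).subset fun x hx i _ => ?_
  simpa using hsK hx (σ.symm i) (Set.mem_univ _)

variable [MeasurableSpace M]

theorem measurable_coord {m : ℕ} (σ : Fin n → Fin m) :
    Measurable fun (x : Fin m → M) i => x (σ i) :=
  measurable_pi_lambda _ fun i => measurable_pi_apply (σ i)

theorem preimage_perm_symm (σ : Equiv.Perm (Fin n)) (s : Set (Fin n → M)) :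
    (fun (x : Fin n → M) i => x (σ.symm i)) ⁻¹' ((fun (x : Fin n → M) i => x (σ i)) ⁻¹' s) = s := by
  ext x
  simp

theorem locFinMeasure_perm {μ : Set (Fin n → M) → ℂ} (hμ : μ ∈ locFinMeasure (Fin n → M))
    (σ : Equiv.Perm (Fin n)) :
    (fun s => μ ((fun x i => x (σ i)) ⁻¹' s)) ∈ locFinMeasure (Fin n → M) := by
  refine ⟨fun s hs => hμ.1 _ fun h => hs ?_, fun s h1 h2 h3 => ?_⟩
  · have := h.1.preimage (measurable_coord σ.symm)
    rw [preimage_perm_symm] at this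
    have h4 := isBounded_preimage_perm h.2 σ.symm
    rw [preimage_perm_symm] at h4
    exact ⟨this, h4⟩
  · have := hμ.2 (fun i => (fun (x : Fin n → M) i => x (σ i)) ⁻¹' s i)
      (fun i => (h1 i).preimage (measurable_coord σ))
      (fun i j hij => (h2 hij).preimage _)
      (by rw [← Set.preimage_iUnion]; exact isBounded_preimage_perm h3 σ)
    rwa [← Set.preimage_iUnion] at this

theorem coarseChains_perm {μ : Set (Fin (n + 1) → M) → ℂ} (hμ : μ ∈ coarseChains M n)
    (σ : Equiv.Perm (Fin (n + 1))) :
    (fun s => μ ((fun x i => x (σ i)) ⁻¹' s)) ∈ coarseChains M n := by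
  obtain ⟨h1, R, hR⟩ := hμ
  refine ⟨locFinMeasure_perm h1 σ, R, fun s hs => hR _ ?_⟩
  refine Set.disjoint_left.2 fun x hx hxR => Set.disjoint_left.1 hs hx ?_
  exact (diagThickening_perm σ).2 hxR

theorem antisymNull_le : antisymNull M n ≤ coarseChains M n := by
  refine Submodule.span_le.2 ?_
  rintro _ ⟨μ, hμ, σ, rfl⟩
  exact sub_mem hμ (Submodule.smul_mem _ ((Equiv.Perm.sign σ : ℤ) : ℂ) (coarseChains_perm hμ σ))

end CoarseGeometry

section Support

variable {M : Type*} [MetricSpace M] [ProperSpace M] [MeasurableSpace M] [BorelSpace M]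
variable {H : Type*} [NormedAddCommGroup H] [InnerProductSpace ℂ H] [CompleteSpace H]
variable (ρ : C₀(M, ℂ) →⋆ₙₐ[ℂ] (H →L[ℂ] H)) {n : ℕ}
variable (hρ : ∀ v : H, (∀ f : C₀(M, ℂ), ρ f v = 0) → v = 0)
include hρ

/-- Neighbouring coordinates in the support of `χ(T₀ ⊗ ⋯ ⊗ Tₙ)` are at most a propagation bound
apart. -/
theorem chi_tprod_eq_zero {T : Fin (n + 1) → algB ρ} {R : ℝ}
    (hR : ∀ i, HasPropagationBound ρ (T i : H →L[ℂ] H) R) {s : Set (Fin (n + 1) → M)}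
    (hs : ∀ x ∈ s, ∃ i : Fin n, R < dist (x i.castSucc) (x i.succ)) :
    chi ρ hρ (PiTensorProduct.tprod ℂ T) s = 0 := by
  refine locFinMeasure_eq_zero_of_locally (chi_mem_locFin ρ hρ _) fun x hx => ?_
  obtain ⟨i, hi⟩ := hs x hx
  -- points in the `ε`-balls around the two coordinates are still at distance at least `R`
  set ε := (dist (x i.castSucc) (x i.succ) - R) / 2 with hε
  have hε0 : 0 < ε := by rw [hε]; linarith
  refine ⟨fun j => Metric.ball (x j) ε, fun j => ⟨Metric.ball_mem_nhds _ hε0,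
    measurableSet_ball⟩, fun B hB hb hBV => ?_⟩
  rw [chi_box ρ hρ _ hB hb, boxTrace_tprod, prod_ofFn_eq_zero _ i, trace_zero]
  rw [← mul_assoc, (hR i.castSucc).setOp_mul_mul_setOp (hB _) (hB _) fun y hy y' hy' => ?_,
    zero_mul]
  have h1 : dist y (x i.castSucc) < ε := hBV _ hy
  have h2 : dist y' (x i.succ) < ε := hBV _ hy'
  have h3 := dist_triangle4 (x i.castSucc) y y' (x i.succ)
  rw [dist_comm] at h1
  rw [hε] at h1 h2
  linarith

/-- Each step between neighbouring coordinates is at most the propagation, so that all coordinates are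
close to the first one. -/
theorem chi_mem_coarseChains (z : Chains (algB ρ) n) : chi ρ hρ z ∈ coarseChains M n := by
  induction z using PiTensorProduct.induction_on with
  | smul_tprod r T =>
    rw [map_smul]
    refine Submodule.smul_mem _ _ ⟨chi_mem_locFin ρ hρ _, ?_⟩
    obtain ⟨R, hR0, hR⟩ := exists_propagationBound hρ T
    refine ⟨n * R, fun s hs => chi_tprod_eq_zero ρ hρ hR fun x hx => ?_⟩
    by_contra! hcon
    refine Set.disjoint_left.1 hs hx (mem_diagThickening (c := x 0) fun i => ?_)
    have key : ∀ i : Fin (n + 1), dist (x i) (x 0) ≤ (i : ℕ) * R := by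
      intro i
      induction i using Fin.induction with
      | zero => simp
      | succ i ih =>
        have h1 := dist_triangle_left (x i.succ) (x 0) (x i.castSucc)
        have h2 := hcon i
        simp only [Fin.val_castSucc, Fin.val_succ] at ih ⊢
        push_cast
        linarith
    refine (key i).trans (mul_le_mul_of_nonneg_right ?_ hR0)
    exact_mod_cast Nat.lt_succ_iff.1 i.2
  | add x y hx hy =>
    rw [map_add]
    exact add_mem hx hy

/-! ### Behaviour under rotation -/

omit hρ in
theorem rotateMap_tprod {A : Type*} [NonUnitalRing A] [Module ℂ A] [IsScalarTower ℂ A A]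
    [SMulCommClass ℂ A A] (a : Fin (n + 1) → A) :
    rotateMap A n (PiTensorProduct.tprod ℂ a) =
      PiTensorProduct.tprod ℂ fun i => a ((finRotate (n + 1)).symm i) :=
  PiTensorProduct.reindex_tprod _ _

theorem boxTrace_rotate_tprod (T : Fin (n + 1) → algB ρ) {B : Fin (n + 1) → Set M}
    (hB : ∀ i, MeasurableSet (B i)) (hb : ∀ i, Bornology.IsBounded (B i)) :
    boxTrace ρ (rotateMap _ n (PiTensorProduct.tprod ℂ T)) B =
      boxTrace ρ (PiTensorProduct.tprod ℂ T) fun i => B (finRotate (n + 1) i) := by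
  rw [rotateMap_tprod, boxTrace_tprod, boxTrace_tprod, List.ofFn_succ, List.prod_cons,
    List.ofFn_succ_last, List.prod_append, List.prod_singleton]
  have h0 : (finRotate (n + 1)).symm 0 = Fin.last n := by
    rw [Equiv.symm_apply_eq, finRotate_last]
  have h1 : ∀ i : Fin n, (finRotate (n + 1)).symm i.succ = i.castSucc := fun i => by
    rw [Equiv.symm_apply_eq, finRotate_apply, Fin.coeSucc_eq_succ]
  have h2 : ∀ i : Fin n, finRotate (n + 1) i.castSucc = i.succ := fun i => by
    rw [← h1, Equiv.apply_symm_apply]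
  simp only [h0, h1, h2, finRotate_last]
  rw [← IsTraceClass.trace_mul_comm]
  exact (algB_spec hρ _).1.setOp_mul (hB 0) (hb 0)

/-- Cyclicity of the trace. -/
theorem chi_rotate (z : Chains (algB ρ) n) (s : Set (Fin (n + 1) → M)) :
    chi ρ hρ (rotateMap _ n z) s =
      chi ρ hρ z ((fun x i => x ((finRotate (n + 1)).symm i)) ⁻¹' s) := by
  induction z using PiTensorProduct.induction_on with
  | smul_tprod r T =>
    rw [map_smul, map_smul, map_smul, Pi.smul_apply, Pi.smul_apply]
    congr 1
    refine congrFun (locFinMeasure_ext_openBox (chi_mem_locFin ρ hρ _)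
      (locFinMeasure_perm (chi_mem_locFin ρ hρ _) (finRotate (n + 1)).symm)
      fun B hB hb => ?_) s
    have hBm := fun i => (hB i).measurableSet
    have e : (fun (x : Fin (n + 1) → M) i => x ((finRotate (n + 1)).symm i)) ⁻¹' (Set.univ.pi B) =
        Set.univ.pi fun i => B (finRotate (n + 1) i) := by
      ext x
      simp only [Set.mem_preimage, Set.mem_pi, Set.mem_univ, true_implies]
      rw [← (finRotate (n + 1)).forall_congr_right]
      simp
    rw [e, chi_box ρ hρ _ hBm hb, chi_box ρ hρ _ (fun i => hBm _) (fun i => hb _),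
      boxTrace_rotate_tprod ρ hρ T hBm hb]
  | add x y hx hy =>
    rw [map_add, map_add, map_add, Pi.add_apply, Pi.add_apply, hx, hy]

/-- `χ` maps `w - λ w` to a chain minus its signed rotation. -/
theorem chi_mem_antisymNull {z : Chains (algB ρ) n} (hz : z ∈ cyclicNull (algB ρ) n) :
    chi ρ hρ z ∈ antisymNull M n := by
  obtain ⟨w, rfl⟩ := hz
  refine Submodule.subset_span ⟨chi ρ hρ w, chi_mem_coarseChains ρ hρ w,
    (finRotate (n + 1)).symm, ?_⟩
  ext s
  change chi ρ hρ (w - (-1 : ℂ) ^ n • rotateMap _ n w) s = _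
  rw [map_sub, map_smul, Pi.sub_apply, Pi.smul_apply, chi_rotate, Equiv.Perm.sign_symm, sign_finRotate]
  simp

end Support

/-! ### The character map and the differentials -/

theorem faceMap_tprod {A : Type*} [NonUnitalRing A] [Module ℂ A] [IsScalarTower ℂ A A]
    [SMulCommClass ℂ A A] {n : ℕ} (i : Fin (n + 1)) (a : Fin (n + 2) → A) :
    faceMap A n i (PiTensorProduct.tprod ℂ a) =
      PiTensorProduct.tprod ℂ (Fin.contractNth i.castSucc (· * ·) a) :=
  PiTensorProduct.lift.tprod _

theorem hochschild_apply {A : Type*} [NonUnitalRing A] [Module ℂ A] [IsScalarTower ℂ A A]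
    [SMulCommClass ℂ A A] {n : ℕ} (z : Chains A (n + 1)) : hochschild A n z =
      (∑ i : Fin (n + 1), (-1 : ℂ) ^ (i : ℕ) • faceMap A n i z) +
        (-1 : ℂ) ^ (n + 1) • faceMap A n 0 (rotateMap A (n + 1) z) := by
  simp only [hochschild, LinearMap.add_apply, LinearMap.sum_apply, LinearMap.smul_apply,
    LinearMap.comp_apply]

section Faces

variable {M : Type*} [MetricSpace M] [ProperSpace M] [MeasurableSpace M] [BorelSpace M]
variable {H : Type*} [NormedAddCommGroup H] [InnerProductSpace ℂ H] [CompleteSpace H]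
variable (ρ : C₀(M, ℂ) →⋆ₙₐ[ℂ] (H →L[ℂ] H)) {n : ℕ}
variable (hρ : ∀ v : H, (∀ f : C₀(M, ℂ), ρ f v = 0) → v = 0)
include hρ

/-- An indicator function between `Tᵢ` and `Tᵢ₊₁` has no effect when its set is large compared to
the other boxes and to the propagation of `Tᵢ`. -/
theorem boxTrace_face_tprod {T : Fin (n + 2) → algB ρ} {R : ℝ}
    (hR : ∀ i, HasPropagationBound ρ (T i : H →L[ℂ] H) R) (i : Fin (n + 1))
    {B : Fin (n + 1) → Set M} (hB : ∀ j, MeasurableSet (B j)) {L : Set M} (hL : MeasurableSet L)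
    (hBL : ∀ x ∈ B i, ∀ y ∉ L, R ≤ dist x y) :
    boxTrace ρ (PiTensorProduct.tprod ℂ T) (Fin.insertNth (α := fun _ => Set M) i.succ L B) =
      boxTrace ρ (faceMap _ n i (PiTensorProduct.tprod ℂ T)) B := by
  rw [faceMap_tprod, boxTrace_tprod, boxTrace_tprod, ← prod_ofFn_contractNth _ i]
  congr 3
  ext1 j
  have hins : ∀ k : Fin (n + 1), Fin.insertNth (α := fun _ => Set M) i.succ L B
      (i.succ.succAbove k) = B k := fun k => Fin.insertNth_apply_succAbove _ _ _ _
  rcases lt_trichotomy (j : ℕ) i with h | h | h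
  · have h1 : i.succ.succAbove j = j.castSucc :=
      Fin.succAbove_of_castSucc_lt _ _ (by rw [Fin.lt_def]; simp; omega)
    rw [Fin.contractNth_apply_of_lt _ _ _ _ h, Fin.contractNth_apply_of_lt _ _ _ _ h, ← h1, hins]
  · obtain rfl : j = i := Fin.ext h
    have h1 : j.succ.succAbove j = j.castSucc :=
      Fin.succAbove_of_castSucc_lt _ _ (by rw [Fin.lt_def]; simp)
    rw [Fin.contractNth_apply_of_eq _ _ _ _ rfl, Fin.contractNth_apply_of_eq _ _ _ _ rfl]
    have h2 : Fin.insertNth (α := fun _ => Set M) j.succ L B j.castSucc = B j := by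
      rw [← hins j, h1]
    have h3 : Fin.insertNth (α := fun _ => Set M) j.succ L B j.succ = L :=
      Fin.insertNth_apply_same _ _ _
    rw [h2, h3]
    have h4 : setOp ρ (B j) * (T j.castSucc : H →L[ℂ] H) * setOp ρ L =
        setOp ρ (B j) * (T j.castSucc : H →L[ℂ] H) := by
      have h5 := (hR j.castSucc).setOp_mul_mul_setOp (hB j) hL.compl fun x hx y hy => hBL x hx y hy
      have h6 := congrArg (fun S => setOp ρ (B j) * (T j.castSucc : H →L[ℂ] H) * S)
        (setOp_add_compl ρ hρ hL)
      simpa only [mul_add, h5, add_zero, mul_one] using h6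
    rw [← mul_assoc, h4, mul_assoc]
    rfl
  · have h1 : i.succ.succAbove j = j.succ :=
      Fin.succAbove_of_le_castSucc _ _ (by rw [Fin.le_def]; simp; omega)
    rw [Fin.contractNth_apply_of_gt _ _ _ _ h, Fin.contractNth_apply_of_gt _ _ _ _ h, ← h1, hins]

/-- For large `R` the set `πᵢ⁻¹(s) ∩ Δ_R` contains the part of the support of `χ` over `s`, and on this
part the `i`-th coordinate is unconstrained, so that its indicator function drops out. -/
theorem eventually_chi_face_tprod (T : Fin (n + 2) → algB ρ) (i : Fin (n + 1))
    {s : Set (Fin (n + 1) → M)} (hs : MeasurableSet s) (hb : Bornology.IsBounded s) :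
    ∀ᶠ R in atTop, chi ρ hρ (PiTensorProduct.tprod ℂ T)
        ((fun x j => x (i.succ.succAbove j)) ⁻¹' s ∩ diagThickening M (n + 1) R) =
      chi ρ hρ (faceMap _ n i (PiTensorProduct.tprod ℂ T)) s := by
  obtain ⟨R₀, hR₀, hR⟩ := exists_propagationBound hρ T
  obtain ⟨K, hK, hKb, hsK⟩ := exists_isOpen_pi_superset hb
  have hKm := hK.measurableSet
  set L := Metric.cthickening (R₀ + 1) K
  have hL : MeasurableSet L := Metric.isClosed_cthickening.measurableSet
  have hLb : Bornology.IsBounded L := hKb.cthickening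
  have hKL : ∀ x ∈ K, ∀ y ∉ L, R₀ < dist x y := fun x hx y hy =>
    (lt_add_one R₀).trans (lt_dist_of_notMem_cthickening hx hy)
  have hpre : ∀ (B : Fin (n + 1) → Set M) (L : Set M),
      Set.univ.pi (Fin.insertNth (α := fun _ => Set M) i.succ L B) =
        (fun (x : Fin (n + 2) → M) j => x (i.succ.succAbove j)) ⁻¹' (Set.univ.pi B) ∩
          {x | x i.succ ∈ L} := fun B L => by
    ext x
    simp only [Set.mem_pi, Set.mem_univ, true_implies, Set.mem_inter_iff, Set.mem_preimage,
      Set.mem_ofPred_eq, Fin.forall_iff_succAbove i.succ, Fin.insertNth_apply_same,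
      Fin.insertNth_apply_succAbove]
    tauto
  have hins : ∀ (P : Set M → Prop) (B : Fin (n + 1) → Set M) (L : Set M), (∀ i, P (B i)) → P L →
      ∀ j, P (Fin.insertNth (α := fun _ => Set M) i.succ L B j) := fun P B L h1 h2 => by
    rw [Fin.forall_iff_succAbove i.succ]
    simp only [Fin.insertNth_apply_same, Fin.insertNth_apply_succAbove]
    exact ⟨h2, h1⟩
  set δ : (Fin (n + 2) → M) → Fin (n + 1) → M := fun x j => x (i.succ.succAbove j) with hδ
  have hδm : Measurable δ := measurable_coord _
  set Q := Set.univ.pi (Fin.insertNth (α := fun _ => Set M) i.succ L fun _ => K) with hQd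
  have hQ : MeasurableSet Q := MeasurableSet.univ_pi (hins MeasurableSet _ _ (fun _ => hKm) hL)
  have hQb : Bornology.IsBounded Q :=
    isBounded_univ_pi (hins Bornology.IsBounded _ _ (fun _ => hKb) hLb)
  have hP : MeasurableSet (Set.univ.pi fun _ : Fin (n + 1) => K) :=
    MeasurableSet.univ_pi fun _ => hKm
  have hPb : Bornology.IsBounded (Set.univ.pi fun _ : Fin (n + 1) => K) :=
    isBounded_univ_pi fun _ => hKb
  have e : (restrictTo ⟨_, chi_mem_locFin ρ hρ (PiTensorProduct.tprod ℂ T)⟩ Q).map δ =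
      restrictTo ⟨_, chi_mem_locFin ρ hρ (faceMap _ n i (PiTensorProduct.tprod ℂ T))⟩
        (Set.univ.pi fun _ : Fin (n + 1) => K) := by
    refine complexMeasure_ext_box fun B hB => ?_
    have hBm := MeasurableSet.univ_pi hB
    have hBK := fun j => (hB j).inter hKm
    rw [VectorMeasure.map_apply _ hδm hBm, restrictTo_apply _ hQ hQb (hBm.preimage hδm),
      restrictTo_apply _ hP hPb hBm, ← Set.pi_inter_distrib]
    have h1 : δ ⁻¹' (Set.univ.pi B) ∩ Q =
        Set.univ.pi (Fin.insertNth (α := fun _ => Set M) i.succ L fun j => B j ∩ K) := by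
      rw [hQd, hpre, hpre, ← Set.inter_assoc, ← Set.preimage_inter, ← Set.pi_inter_distrib]
    rw [h1]
    change chi ρ hρ _ _ = chi ρ hρ _ _
    rw [chi_box ρ hρ _ (hins MeasurableSet _ _ hBK hL)
      (hins Bornology.IsBounded _ _ (fun j => hKb.subset Set.inter_subset_right) hLb),
      chi_box ρ hρ _ hBK fun j => hKb.subset Set.inter_subset_right]
    exact boxTrace_face_tprod ρ hρ hR i hBK hL fun x hx y hy => (hKL x hx.2 y hy).le
  have h2 := congrArg (fun m : ComplexMeasure (Fin (n + 1) → M) => m s) e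
  simp only [VectorMeasure.map_apply _ hδm hs, restrictTo_apply _ hQ hQb (hs.preimage hδm),
    restrictTo_apply _ hP hPb hs, Set.inter_eq_left.2 hsK] at h2
  filter_upwards [eventually_subset_diagThickening hQb] with R hQR
  rw [← h2]
  have hD : MeasurableSet (δ ⁻¹' s ∩ diagThickening M (n + 1) R) :=
    (hs.preimage hδm).inter (measurableSet_diagThickening R)
  have hDb : Bornology.IsBounded (δ ⁻¹' s ∩ diagThickening M (n + 1) R) :=
    isBounded_preimage_face_inter hb _ _
  have h3 : δ ⁻¹' s ∩ diagThickening M (n + 1) R =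
      (δ ⁻¹' s ∩ Q) ∪ ((δ ⁻¹' s ∩ diagThickening M (n + 1) R) \ Q) := by
    ext x
    have := @hQR x
    simp only [Set.mem_inter_iff, Set.mem_union, Set.mem_sdiff]
    tauto
  rw [h3, locFinMeasure_union (chi_mem_locFin ρ hρ _) ((hs.preimage hδm).inter hQ) (hD.diff hQ)
    (hQb.subset Set.inter_subset_right) (hDb.subset Set.sdiff_subset)
    (Set.disjoint_sdiff_right.mono_left Set.inter_subset_right),
    chi_tprod_eq_zero ρ hρ hR (s := (δ ⁻¹' s ∩ diagThickening M (n + 1) R) \ Q), add_zero]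
  rintro x ⟨⟨hx, -⟩, hxQ⟩
  have hxK := hsK hx
  rw [hQd, hpre] at hxQ
  refine ⟨i, hKL _ ?_ _ fun h => hxQ ⟨hxK, h⟩⟩
  have h4 := hxK i (Set.mem_univ i)
  have h5 : i.succ.succAbove i = i.castSucc :=
    Fin.succAbove_of_castSucc_lt _ _ (by rw [Fin.lt_def]; simp)
  simpa only [hδ, h5] using h4

theorem eventually_chi_face (z : Chains (algB ρ) (n + 1)) (i : Fin (n + 1))
    {s : Set (Fin (n + 1) → M)} (hs : MeasurableSet s) (hb : Bornology.IsBounded s) :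
    ∀ᶠ R in atTop, chi ρ hρ z
        ((fun x j => x (i.succ.succAbove j)) ⁻¹' s ∩ diagThickening M (n + 1) R) =
      chi ρ hρ (faceMap _ n i z) s := by
  induction z using PiTensorProduct.induction_on with
  | smul_tprod r T =>
    filter_upwards [eventually_chi_face_tprod ρ hρ T i hs hb] with R h
    rw [map_smul, map_smul, map_smul, Pi.smul_apply, Pi.smul_apply, h]
  | add x y hx hy =>
    filter_upwards [hx, hy] with R h1 h2
    rw [map_add, map_add, map_add, Pi.add_apply, Pi.add_apply, h1, h2]

/-- Omitting the `0`-th coordinate is the rotation of omitting the `1`-st. -/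
theorem eventually_chi_face_zero (z : Chains (algB ρ) (n + 1))
    {s : Set (Fin (n + 1) → M)} (hs : MeasurableSet s) (hb : Bornology.IsBounded s) :
    ∀ᶠ R in atTop, chi ρ hρ z
        ((fun x j => x ((0 : Fin (n + 2)).succAbove j)) ⁻¹' s ∩ diagThickening M (n + 1) R) =
      chi ρ hρ (faceMap _ n 0 (rotateMap _ (n + 1) z))
        ((fun x j => x (finRotate (n + 1) j)) ⁻¹' s) := by
  filter_upwards [eventually_chi_face ρ hρ (rotateMap _ (n + 1) z) 0
    (hs.preimage (measurable_coord (finRotate (n + 1))))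
    (isBounded_preimage_perm hb (finRotate (n + 1)))] with R hR
  rw [← hR, chi_rotate]
  refine congrArg (chi ρ hρ z) (Set.ext fun x => ?_)
  simp only [Set.mem_inter_iff, Set.mem_preimage, diagThickening_perm]
  have e : ∀ j : Fin (n + 1), (finRotate (n + 1 + 1)).symm
      ((Fin.succ 0 : Fin (n + 2)).succAbove (finRotate (n + 1) j)) =
        (0 : Fin (n + 2)).succAbove j := fun j => by
    rw [Equiv.symm_apply_eq, Fin.succAbove_zero, finRotate_apply, finRotate_apply]
    refine Fin.lastCases ?_ (fun j => ?_) j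
    · rw [Fin.succ_last, Fin.last_add_one, Fin.last_add_one]
      rfl
    · rw [Fin.coeSucc_eq_succ, Fin.succ_castSucc, Fin.coeSucc_eq_succ]
      rfl
  simp only [e]

/-- `χ` is a chain map up to sign, modulo the relations of the antisymmetric complex. -/
theorem exists_isBoundaryOf_chi (z : Chains (algB ρ) (n + 1)) :
    ∃ ν ∈ antisymNull M n, IsBoundaryOf (chi ρ hρ z) (ν - chi ρ hρ (hochschild _ n z)) := by
  set w := faceMap (algB ρ) n 0 (rotateMap (algB ρ) (n + 1) z) with hw
  refine ⟨-(-1 : ℂ) ^ n • fun s => chi ρ hρ w s -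
    ((Equiv.Perm.sign (finRotate (n + 1)) : ℤ) : ℂ) *
      chi ρ hρ w ((fun x i => x (finRotate (n + 1) i)) ⁻¹' s), Submodule.smul_mem _ _
        (Submodule.subset_span ⟨_, chi_mem_coarseChains ρ hρ w, _, rfl⟩), fun s hs hb => ?_⟩
  have h1 : ∀ᶠ R in atTop, ∀ i : Fin (n + 1), chi ρ hρ z
        ((fun x j => x (i.succ.succAbove j)) ⁻¹' s ∩ diagThickening M (n + 1) R) =
      chi ρ hρ (faceMap _ n i z) s :=
    eventually_all.2 fun i => eventually_chi_face ρ hρ z i hs hb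
  filter_upwards [h1, eventually_chi_face_zero ρ hρ z hs hb] with R h2 h3
  rw [Fin.sum_univ_succ, h3, ← hw]
  simp_rw [h2]
  have h4 : chi ρ hρ (hochschild _ n z) s =
      (∑ i : Fin (n + 1), (-1 : ℂ) ^ (i : ℕ) * chi ρ hρ (faceMap _ n i z) s) +
        (-1 : ℂ) ^ (n + 1) * chi ρ hρ w s := by
    have : hochschild _ n z = (∑ i : Fin (n + 1), (-1 : ℂ) ^ (i : ℕ) • faceMap (algB ρ) n i z) +
        (-1 : ℂ) ^ (n + 1) • w := hochschild_apply z
    rw [this]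
    simp
  rw [Pi.sub_apply, h4, sign_finRotate]
  have h5 : ((-1 : ℂ) ^ n) * (-1) ^ n = 1 := by rw [← mul_pow]; simp
  simp only [Pi.smul_apply, smul_eq_mul, Fin.val_succ, Fin.val_zero, pow_succ, pow_zero]
  push_cast
  simp only [mul_neg, neg_mul, mul_one, Finset.sum_neg_distrib]
  linear_combination (chi ρ hρ w ((fun x i => x (finRotate (n + 1) i)) ⁻¹' s)) * h5

end Faces

/-! ### Dropping scalar parts, and the character maps on homology -/

section Unitization

variable {A : Type*} [NonUnitalRing A] [Module ℂ A] [IsScalarTower ℂ A A] [SMulCommClass ℂ A A]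
variable {n : ℕ}

variable (A n) in
/-- The linear map `(λ₀ + T₀) ⊗ ⋯ ⊗ (λₙ + Tₙ) ↦ T₀ ⊗ ⋯ ⊗ Tₙ`, for any algebra. -/
def dropUnit : Chains (Unitization ℂ A) n →ₗ[ℂ] Chains A n :=
  PiTensorProduct.map fun _ => Unitization.sndHom ℂ ℂ A

theorem dropUnit_tprod (a : Fin (n + 1) → Unitization ℂ A) :
    dropUnit A n (PiTensorProduct.tprod ℂ a) = PiTensorProduct.tprod ℂ fun i => (a i).snd :=
  PiTensorProduct.map_tprod _ _

theorem dropUnit_rotate (z : Chains (Unitization ℂ A) n) :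
    dropUnit A n (rotateMap _ n z) = rotateMap _ n (dropUnit A n z) := by
  induction z using PiTensorProduct.induction_on with
  | smul_tprod r a =>
    rw [map_smul, map_smul, map_smul, map_smul, rotateMap_tprod, dropUnit_tprod,
      dropUnit_tprod, rotateMap_tprod]
  | add x y hx hy => rw [map_add, map_add, map_add, map_add, hx, hy]

theorem dropUnit_mem_cyclicNull {z : Chains (Unitization ℂ A) n}
    (hz : z ∈ cyclicNull (Unitization ℂ A) n) : dropUnit A n z ∈ cyclicNull A n := by
  obtain ⟨w, rfl⟩ := hz
  refine ⟨dropUnit A n w, ?_⟩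
  change dropUnit A n w - (-1 : ℂ) ^ n • rotateMap _ n (dropUnit A n w) =
    dropUnit A n (w - (-1 : ℂ) ^ n • rotateMap _ n w)
  rw [map_sub, map_smul, dropUnit_rotate]

/-- In `(λᵢ + Tᵢ)(λᵢ₊₁ + Tᵢ₊₁)` the terms with one scalar factor omit one of the two operators. -/
theorem dropUnit_face_tprod (i : Fin (n + 1)) (a : Fin (n + 2) → Unitization ℂ A) :
    dropUnit A n (faceMap _ n i (PiTensorProduct.tprod ℂ a)) =
      faceMap _ n i (PiTensorProduct.tprod ℂ fun j => (a j).snd) +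
        ((a i.castSucc).fst • PiTensorProduct.tprod ℂ (fun j => (a (i.castSucc.succAbove j)).snd) +
          (a i.succ).fst • PiTensorProduct.tprod ℂ (fun j => (a (i.succ.succAbove j)).snd)) := by
  rw [faceMap_tprod, faceMap_tprod, dropUnit_tprod]
  set c : Fin (n + 1) → A := Fin.contractNth i.castSucc (· * ·) fun j => (a j).snd with hc
  have hval : ∀ j, j ≠ i → (Fin.contractNth i.castSucc (· * ·) a j).snd = c j ∧
      (a (i.castSucc.succAbove j)).snd = c j ∧ (a (i.succ.succAbove j)).snd = c j := by
    intro j hj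
    rcases lt_or_gt_of_ne (Fin.val_ne_of_ne hj) with h | h
    · rw [hc, Fin.contractNth_apply_of_lt _ _ _ _ h, Fin.contractNth_apply_of_lt _ _ _ _ h,
        Fin.succAbove_of_castSucc_lt i.castSucc j (by rw [Fin.lt_def]; simpa using h),
        Fin.succAbove_of_castSucc_lt i.succ j (by rw [Fin.lt_def]; simp; omega)]
      exact ⟨rfl, rfl, rfl⟩
    · rw [hc, Fin.contractNth_apply_of_gt _ _ _ _ h, Fin.contractNth_apply_of_gt _ _ _ _ h,
        Fin.succAbove_of_le_castSucc i.castSucc j (by rw [Fin.le_def]; simp; omega),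
        Fin.succAbove_of_le_castSucc i.succ j (by rw [Fin.le_def]; simp; omega)]
      exact ⟨rfl, rfl, rfl⟩
  have h1 : (fun j => (Fin.contractNth i.castSucc (· * ·) a j).snd) = Function.update c i
      ((a i.castSucc).snd * (a i.succ).snd +
        ((a i.castSucc).fst • (a i.succ).snd + (a i.succ).fst • (a i.castSucc).snd)) := by
    ext1 j
    by_cases hj : j = i
    · subst hj
      rw [Function.update_self, Fin.contractNth_apply_of_eq _ _ _ _ rfl, Unitization.snd_mul]
      abel
    · rw [Function.update_of_ne hj, (hval j hj).1]
  have h2 : (fun j => (a (i.castSucc.succAbove j)).snd) = Function.update c i (a i.succ).snd := by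
    ext1 j
    by_cases hj : j = i
    · subst hj
      rw [Function.update_self, Fin.succAbove_castSucc_self]
    · rw [Function.update_of_ne hj, (hval j hj).2.1]
  have h3 : (fun j => (a (i.succ.succAbove j)).snd) = Function.update c i (a i.castSucc).snd := by
    ext1 j
    by_cases hj : j = i
    · subst hj
      rw [Function.update_self, Fin.succAbove_succ_self]
    · rw [Function.update_of_ne hj, (hval j hj).2.2]
  have h4 : c = Function.update c i ((a i.castSucc).snd * (a i.succ).snd) := by
    rw [eq_comm, Function.update_eq_self_iff, hc, Fin.contractNth_apply_of_eq _ _ _ _ rfl]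
  rw [h1, h2, h3, MultilinearMap.map_update_add, MultilinearMap.map_update_add,
    MultilinearMap.map_update_smul, MultilinearMap.map_update_smul, ← h4]

/-- A telescoping sum. -/
theorem alternating_sum_add_succ {V : Type*} [AddCommGroup V] [Module ℂ V] (e : Fin (n + 2) → V) :
    ∑ i : Fin (n + 1), (-1 : ℂ) ^ (i : ℕ) • (e i.castSucc + e i.succ) =
      e 0 + (-1 : ℂ) ^ n • e (Fin.last (n + 1)) := by
  induction n with
  | zero => simp
  | succ n ih =>
    rw [Fin.sum_univ_castSucc]
    have := ih fun i => e i.castSucc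
    simp only [Fin.val_castSucc, Fin.succ_castSucc] at this ⊢
    rw [this]
    simp only [Fin.val_last, pow_succ, Fin.succ_last, Fin.castSucc_zero, mul_neg, mul_one, neg_smul,
      smul_add]
    abel

/-- The terms with one scalar factor cancel in pairs, up to one rotation. -/
theorem dropUnit_hochschild_sub_mem (z : Chains (Unitization ℂ A) (n + 1)) :
    dropUnit A n (hochschild _ n z) - hochschild _ n (dropUnit A (n + 1) z) ∈
      cyclicNull A n := by
  induction z using PiTensorProduct.induction_on with
  | smul_tprod r a =>
    rw [map_smul, map_smul, map_smul, map_smul, ← smul_sub]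
    refine Submodule.smul_mem _ r ?_
    rw [dropUnit_tprod]
    set d : Fin (n + 2) → Chains A n := fun j =>
      PiTensorProduct.tprod ℂ fun i => (a (j.succAbove i)).snd with hd
    set e : Fin (n + 2) → Chains A n := fun j => (a j).fst • d j with he
    have hface : ∀ i : Fin (n + 1), dropUnit A n (faceMap _ n i (PiTensorProduct.tprod ℂ a)) =
        faceMap _ n i (PiTensorProduct.tprod ℂ fun j => (a j).snd) +
          (e i.castSucc + e i.succ) := fun i => dropUnit_face_tprod i a
    have hlast : dropUnit A n (faceMap _ n 0 (rotateMap _ (n + 1) (PiTensorProduct.tprod ℂ a))) =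
        faceMap _ n 0 (rotateMap _ (n + 1) (PiTensorProduct.tprod ℂ fun j => (a j).snd)) +
          (e (Fin.last (n + 1)) + rotateMap _ n (e 0)) := by
      have h0 : (finRotate (n + 1 + 1)).symm 0 = Fin.last (n + 1) := by
        rw [Equiv.symm_apply_eq, finRotate_last]
      have h1 : ∀ {m : ℕ} (i : Fin (m + 1)), (finRotate (m + 1 + 1)).symm i.succ = i.castSucc :=
        fun i => by rw [Equiv.symm_apply_eq, finRotate_apply, Fin.coeSucc_eq_succ]
      rw [rotateMap_tprod, dropUnit_face_tprod, rotateMap_tprod]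
      congr 2
      · have h2 : (Fin.castSucc 0 : Fin (n + 1 + 1)) = 0 := rfl
        rw [he, hd, h2, h0]
        congr 2
        ext1 j
        rw [Fin.succAbove_zero, h1, Fin.succAbove_last]
      · rw [he, map_smul, hd, rotateMap_tprod, h1, Fin.castSucc_zero]
        congr 2
        ext1 j
        congr 1
        refine congrArg (fun i => (a i).toProd) ?_
        rw [Equiv.symm_apply_eq, finRotate_apply, Fin.succAbove_zero]
        obtain ⟨i, rfl⟩ := (finRotate (n + 1)).surjective j
        rw [Equiv.symm_apply_apply, finRotate_apply]
        refine Fin.lastCases ?_ (fun i => ?_) i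
        · rw [Fin.last_add_one, Fin.succ_last, Fin.last_add_one]
          rfl
        · rw [Fin.coeSucc_eq_succ, Fin.succ_castSucc, Fin.coeSucc_eq_succ]
          rfl
    rw [hochschild_apply, hochschild_apply, map_add, map_sum, map_smul, hlast]
    simp_rw [map_smul, hface, smul_add (_ : ℂ) (faceMap A n _ _)]
    rw [Finset.sum_add_distrib, alternating_sum_add_succ]
    refine ⟨e 0, ?_⟩
    change e 0 - (-1 : ℂ) ^ n • rotateMap _ n (e 0) = _
    simp only [pow_succ, mul_neg, mul_one, neg_smul, smul_add]
    abel
  | add x y hx hy =>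
    have := add_mem hx hy
    simp only [map_add]
    convert this using 1
    abel

theorem dropUnit_mem_cyclicCycles : ∀ {n : ℕ} {z : Chains (Unitization ℂ A) n},
    z ∈ cyclicCycles (Unitization ℂ A) n → dropUnit A n z ∈ cyclicCycles A n
  | 0, _, _ => Submodule.mem_top
  | n + 1, z, hz => by
    have h1 := dropUnit_mem_cyclicNull (z := hochschild _ n z) hz
    have h2 := sub_mem h1 (dropUnit_hochschild_sub_mem z)
    rw [sub_sub_cancel] at h2
    exact h2

theorem dropUnit_mem_cyclicBoundaries {z : Chains (Unitization ℂ A) n}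
    (hz : z ∈ cyclicBoundaries (Unitization ℂ A) n) :
    dropUnit A n z ∈ cyclicBoundaries A n := by
  obtain ⟨_, ⟨w, rfl⟩, y, hy, rfl⟩ := Submodule.mem_sup.1 hz
  rw [map_add]
  refine add_mem ?_ (Submodule.mem_sup_right (dropUnit_mem_cyclicNull hy))
  rw [← sub_add_cancel (dropUnit A n (hochschild (Unitization ℂ A) n w))
    (hochschild _ n (dropUnit A (n + 1) w))]
  exact add_mem (Submodule.mem_sup_right (dropUnit_hochschild_sub_mem w))
    (Submodule.mem_sup_left ⟨_, rfl⟩)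

end Unitization

section InducedMaps

variable {A : Type*} [NonUnitalRing A] [Module ℂ A] [IsScalarTower ℂ A A] [SMulCommClass ℂ A A]
variable {M : Type*} [MetricSpace M] [MeasurableSpace M] {n : ℕ}

/-- The map on homology that is induced by a linear map of chains. -/
def inducedHC (F : Chains A n →ₗ[ℂ] (Set (Fin (n + 1) → M) → ℂ))
    (h1 : ∀ z ∈ cyclicCycles A n, F z ∈ coarseCycles M n)
    (h2 : ∀ z ∈ cyclicBoundaries A n, F z ∈ coarseBoundaries M n) : HC A n →ₗ[ℂ] HXHom M n :=
  Submodule.mapQ ((cyclicBoundaries A n).submoduleOf (cyclicCycles A n))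
    ((coarseBoundaries M n).submoduleOf (coarseCycles M n)) (F.restrict h1) fun _ hz => h2 _ hz

theorem inducedHC_mk (F : Chains A n →ₗ[ℂ] (Set (Fin (n + 1) → M) → ℂ))
    (h1 : ∀ z ∈ cyclicCycles A n, F z ∈ coarseCycles M n)
    (h2 : ∀ z ∈ cyclicBoundaries A n, F z ∈ coarseBoundaries M n) {z : Chains A n}
    (hz : z ∈ cyclicCycles A n) :
    inducedHC F h1 h2 (HC.mk z hz) = HXHom.mk ⟨F z, h1 z hz⟩ := rfl

end InducedMaps

section HomologyMap

variable {M : Type*} [MetricSpace M] [ProperSpace M] [MeasurableSpace M] [BorelSpace M]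
variable {H : Type*} [NormedAddCommGroup H] [InnerProductSpace ℂ H] [CompleteSpace H]
variable (ρ : C₀(M, ℂ) →⋆ₙₐ[ℂ] (H →L[ℂ] H)) {n : ℕ}
variable (hρ : ∀ v : H, (∀ f : C₀(M, ℂ), ρ f v = 0) → v = 0)

theorem chi_mem_coarseCycles : ∀ {n : ℕ} {z : Chains (algB ρ) n},
    z ∈ cyclicCycles (algB ρ) n → chi ρ hρ z ∈ coarseCycles M n
  | 0, z, _ => chi_mem_coarseChains ρ hρ z
  | n + 1, z, hz => by
    obtain ⟨ν, hν, h⟩ := exists_isBoundaryOf_chi ρ hρ z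
    exact ⟨chi_mem_coarseChains ρ hρ z, _, sub_mem hν (chi_mem_antisymNull ρ hρ hz), h⟩

theorem chi_mem_coarseBoundaries {z : Chains (algB ρ) n}
    (hz : z ∈ cyclicBoundaries (algB ρ) n) : chi ρ hρ z ∈ coarseBoundaries M n := by
  obtain ⟨_, ⟨w, rfl⟩, y, hy, rfl⟩ := Submodule.mem_sup.1 hz
  rw [map_add]
  refine add_mem ?_ (Submodule.mem_sup_right (chi_mem_antisymNull ρ hρ hy))
  obtain ⟨ν, hν, h⟩ := exists_isBoundaryOf_chi ρ hρ w
  have h1 : ν - chi ρ hρ (hochschild _ n w) ∈ coarseBoundaries M n :=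
    Submodule.mem_sup_left ⟨sub_mem (antisymNull_le hν) (chi_mem_coarseChains ρ hρ _), _,
      chi_mem_coarseChains ρ hρ w, h⟩
  have h2 : ν ∈ coarseBoundaries M n := Submodule.mem_sup_right hν
  simpa using sub_mem h2 h1

include hρ in
theorem exists_isInducedCharacter : ∃ F : HC (algB ρ) n →ₗ[ℂ] HXHom M n, IsInducedCharacter ρ F :=
  ⟨inducedHC (chi ρ hρ) (fun _ hz => chi_mem_coarseCycles ρ hρ hz)
    fun _ hz => chi_mem_coarseBoundaries ρ hρ hz, fun z hz =>
      ⟨⟨chi ρ hρ z, chi_mem_coarseCycles ρ hρ hz⟩, isCharacterMeasure_chi ρ hρ z,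
        inducedHC_mk _ _ _ hz⟩⟩

include hρ in
theorem isInducedCharacter_coarseCharacter : IsInducedCharacter ρ (coarseCharacter ρ n) := by
  have h := exists_isInducedCharacter (n := n) ρ hρ
  rw [coarseCharacter, dif_pos h]
  exact h.choose_spec

theorem eq_chi_of_isCharacterMeasure {z : Chains (algB ρ) n} {μ : coarseCycles M n}
    (hμ : IsCharacterMeasure ρ z (toLocFin μ)) : (μ : Set (Fin (n + 1) → M) → ℂ) = chi ρ hρ z :=
  congrArg Subtype.val (IsCharacterMeasure.unique ρ hμ (isCharacterMeasure_chi ρ hρ z))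

theorem coarseCharacter_mk {z : Chains (algB ρ) n} (hz : z ∈ cyclicCycles (algB ρ) n) :
    coarseCharacter ρ n (HC.mk z hz) = HXHom.mk ⟨chi ρ hρ z, chi_mem_coarseCycles ρ hρ hz⟩ := by
  obtain ⟨μ, h1, h2⟩ := isInducedCharacter_coarseCharacter ρ hρ z hz
  rw [h2]
  congr 1
  exact Subtype.ext (eq_chi_of_isCharacterMeasure ρ hρ h1)

theorem chi_dropScalars_mem_coarseCycles {z : Chains (algBPlus ρ) n}
    (hz : z ∈ cyclicCycles (algBPlus ρ) n) : chi ρ hρ (dropScalars ρ n z) ∈ coarseCycles M n :=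
  chi_mem_coarseCycles ρ hρ (dropUnit_mem_cyclicCycles (A := algB ρ) hz)

include hρ in
theorem exists_isInducedCharacterPlus :
    ∃ F : HC (algBPlus ρ) n →ₗ[ℂ] HXHom M n, IsInducedCharacterPlus ρ F :=
  ⟨inducedHC (chi ρ hρ ∘ₗ dropScalars ρ n)
    (fun _ hz => chi_dropScalars_mem_coarseCycles ρ hρ hz)
    fun _ hz => chi_mem_coarseBoundaries ρ hρ (dropUnit_mem_cyclicBoundaries (A := algB ρ) hz),
    fun z hz => ⟨⟨chi ρ hρ (dropScalars ρ n z), chi_dropScalars_mem_coarseCycles ρ hρ hz⟩,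
      isCharacterMeasure_chi ρ hρ _, inducedHC_mk _ _ _ hz⟩⟩

include hρ in
theorem isInducedCharacterPlus_coarseCharacterPlus :
    IsInducedCharacterPlus ρ (coarseCharacterPlus ρ n) := by
  have h := exists_isInducedCharacterPlus (n := n) ρ hρ
  rw [coarseCharacterPlus, dif_pos h]
  exact h.choose_spec

theorem coarseCharacterPlus_mk {z : Chains (algBPlus ρ) n} (hz : z ∈ cyclicCycles (algBPlus ρ) n) :
    coarseCharacterPlus ρ n (HC.mk z hz) = HXHom.mk ⟨chi ρ hρ (dropScalars ρ n z),
      chi_dropScalars_mem_coarseCycles ρ hρ hz⟩ := by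
  obtain ⟨μ, h1, h2⟩ := isInducedCharacterPlus_coarseCharacterPlus ρ hρ z hz
  rw [h2]
  congr 1
  exact Subtype.ext (eq_chi_of_isCharacterMeasure ρ hρ h1)

end HomologyMap

/-! ### The pairing of coarse cohomology and homology -/

section Pairing

variable {X Y : Type*} [MetricSpace X] [MeasurableSpace X] [BorelSpace X]
  [MetricSpace Y] [MeasurableSpace Y] [BorelSpace Y]

/-- Change of variables. -/
theorem cint_map (μ : ComplexMeasure X) {δ : X → Y} (hδ : Measurable δ) {g : Y → ℂ}
    (hg : IsBoundedBorel g) : cint (μ.map δ) g = cint μ fun x => g (δ x) := by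
  have hΨ : IsSigmaFunctional fun g : Y → ℂ => cint μ fun x => g (δ x) :=
    have hc : ∀ {f : Y → ℂ}, IsBoundedBorel f → IsBoundedBorel fun x => f (δ x) := fun hf =>
      ⟨hf.1.comp hδ, hf.2.imp fun C hC x => hC _⟩
    { add := fun f g hf hg => (isSigmaFunctional_cint μ).add _ _ (hc hf) (hc hg)
      smul := fun c f hf => (isSigmaFunctional_cint μ).smul c _ (hc hf)
      lim := fun f g C h1 h2 h3 h4 h5 => (isSigmaFunctional_cint μ).lim _ _ C
        (fun n => (h1 n).comp hδ) (h2.comp hδ) (fun n x => h3 n _) (fun x => h4 _)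
        fun x => h5 _ }
  refine (isSigmaFunctional_cint _).ext_indicator hΨ (fun s hs => ?_) hg
  rw [cint_indicator _ hs, VectorMeasure.map_apply _ hδ hs, ← cint_indicator _ (hs.preimage hδ)]
  rfl

theorem cint_smul_measure (μ : ComplexMeasure X) (r : ℂ) {g : X → ℂ} (hg : IsBoundedBorel g) :
    cint (r • μ) g = r * cint μ g :=
  (isSigmaFunctional_cint (r • μ)).ext_indicator ((isSigmaFunctional_cint μ).const_mul r)
    (fun s hs => by rw [cint_indicator _ hs, cint_indicator _ hs]; rfl) hg

omit [MetricSpace X] [BorelSpace X] in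
theorem vectorMeasure_sum_apply {ι : Type*} (t : Finset ι) (μ : ι → ComplexMeasure X) (s : Set X) :
    (∑ i ∈ t, μ i) s = ∑ i ∈ t, μ i s := by
  classical
  induction t using Finset.induction_on with
  | empty => rfl
  | insert i t hi ih => rw [Finset.sum_insert hi, Finset.sum_insert hi, add_apply, ih]

theorem cint_sum_measure {ι : Type*} (t : Finset ι) (μ : ι → ComplexMeasure X) {g : X → ℂ}
    (hg : IsBoundedBorel g) : cint (∑ i ∈ t, μ i) g = ∑ i ∈ t, cint (μ i) g := by
  classical
  induction t using Finset.induction_on with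
  | empty =>
    have := cint_add_measure (0 : ComplexMeasure X) 0 hg
    rw [add_zero] at this
    simpa using this
  | insert i t hi ih => rw [Finset.sum_insert hi, Finset.sum_insert hi, cint_add_measure _ _ hg, ih]

theorem cint_sum {ι : Type*} (t : Finset ι) (μ : ComplexMeasure X) {g : ι → X → ℂ}
    (hg : ∀ i, IsBoundedBorel (g i)) : cint μ (∑ i ∈ t, g i) = ∑ i ∈ t, cint μ (g i) := by
  classical
  have h0 : IsBoundedBorel (0 : X → ℂ) := by simpa using (isBoundedBorel_one (M := X)).smul 0
  have key : IsBoundedBorel (∑ i ∈ t, g i) ∧ cint μ (∑ i ∈ t, g i) = ∑ i ∈ t, cint μ (g i) := by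
    induction t using Finset.induction_on with
    | empty =>
      have := cint_smul μ 0 (0 : X → ℂ)
      simpa [h0] using this
    | insert i t hi ih =>
      rw [Finset.sum_insert hi, Finset.sum_insert hi, ← ih.2]
      exact ⟨(hg i).add ih.1, (isSigmaFunctional_cint μ).add _ _ (hg i) ih.1⟩
  exact key.2

end Pairing

/-- A bilinear map that vanishes on submodules descends to the quotients. -/
theorem exists_bilin_quotient {V W : Type*} [AddCommGroup V] [Module ℂ V] [AddCommGroup W]
    [Module ℂ W] (B : V →ₗ[ℂ] W →ₗ[ℂ] ℂ) (p : Submodule ℂ V) (q : Submodule ℂ W)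
    (hp : ∀ v ∈ p, ∀ w, B v w = 0) (hq : ∀ v, ∀ w ∈ q, B v w = 0) :
    ∃ F : V ⧸ p →ₗ[ℂ] W ⧸ q →ₗ[ℂ] ℂ, ∀ v w,
      F (Submodule.Quotient.mk v) (Submodule.Quotient.mk w) = B v w := by
  let B₁ : V →ₗ[ℂ] W ⧸ q →ₗ[ℂ] ℂ :=
    { toFun := fun v => q.liftQ (B v) (hq v)
      map_add' := fun v v' => by
        ext w
        change B (v + v') w = B v w + B v' w
        simp
      map_smul' := fun c v => by
        ext w
        change B (c • v) w = c • B v w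
        simp }
  refine ⟨p.liftQ B₁ fun v hv => ?_, fun v w => rfl⟩
  rw [LinearMap.mem_ker]
  ext w
  exact hp v hv w

section CochainPairing

variable {M : Type*} [MetricSpace M] [ProperSpace M] [MeasurableSpace M] [BorelSpace M] {n : ℕ}

/-- A locally bounded function is bounded on bounded sets, whose closures are compact. -/
theorem isBoundedBorel_indicator_of_mem_coarseCochains {θ : (Fin (n + 1) → M) → ℂ}
    (hθ : θ ∈ coarseCochains M n) {Q : Set (Fin (n + 1) → M)} (hQ : MeasurableSet Q)
    (hb : Bornology.IsBounded Q) : IsBoundedBorel (Q.indicator θ) := by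
  refine ⟨hθ.1.indicator hQ, ?_⟩
  have key : ∃ C : ℝ, ∀ y ∈ closure Q, ‖θ y‖ ≤ C := by
    refine hb.isCompact_closure.induction_on (p := fun s => ∃ C : ℝ, ∀ y ∈ s, ‖θ y‖ ≤ C)
      ⟨0, by simp⟩ (fun s t hst ⟨C, hC⟩ => ⟨C, fun y hy => hC y (hst hy)⟩)
      (fun s t ⟨C, hC⟩ ⟨D, hD⟩ => ⟨max C D, fun y hy => hy.elim
        (fun h => (hC y h).trans (le_max_left _ _)) fun h => (hD y h).trans (le_max_right _ _)⟩)
      fun x _ => ?_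
    obtain ⟨U, hU, C, hC⟩ := hθ.2.1 x
    exact ⟨U, mem_nhdsWithin_of_mem_nhds hU, C, hC⟩
  obtain ⟨C, hC⟩ := key
  refine ⟨max C 0, fun x => ?_⟩
  by_cases hx : x ∈ Q
  · rw [Set.indicator_of_mem hx]
    exact (hC x (subset_closure hx)).trans (le_max_left _ _)
  · rw [Set.indicator_of_notMem hx, norm_zero]
    exact le_max_right _ _

theorem tsupport_inter_measurable (θ : (Fin (n + 1) → M) → ℂ) (R : ℝ) :
    MeasurableSet (tsupport θ ∩ diagThickening M n R) :=
  (isClosed_tsupport θ).measurableSet.inter (measurableSet_diagThickening R)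

/-- The pairing may be computed over any sufficiently large bounded set. -/
theorem integralOn_eq_cint_of_support {θ : (Fin (n + 1) → M) → ℂ} (hθ : θ ∈ coarseCochains M n)
    (μ : locFinMeasure (Fin (n + 1) → M)) {R : ℝ}
    (hR : ∀ s, Disjoint s (diagThickening M n R) → (μ : Set (Fin (n + 1) → M) → ℂ) s = 0)
    {Q : Set (Fin (n + 1) → M)} (hQ : MeasurableSet Q) (hb : Bornology.IsBounded Q)
    (hsub : tsupport θ ∩ diagThickening M n R ⊆ Q) :
    integralOn μ (tsupport θ ∩ diagThickening M n R) θ =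
      cint (restrictTo μ Q) (Q.indicator θ) := by
  rw [integralOn_eq_cint μ (tsupport_inter_measurable θ R) hQ hb hsub
    (isBoundedBorel_indicator_of_mem_coarseCochains hθ (tsupport_inter_measurable θ R)
      (hb.subset hsub))]
  refine cint_congr_of_null _ (measurableSet_diagThickening R).compl (fun s hs hms => ?_)
    fun x hx => ?_
  · rw [restrictTo_apply μ hQ hb hms]
    exact hR _ (Set.disjoint_left.2 fun x hx hxR => hs hx.1 hxR)
  · rw [Set.notMem_compl_iff] at hx
    by_cases hxt : x ∈ tsupport θ
    · rw [Set.indicator_of_mem (show x ∈ _ ∩ _ from ⟨hxt, hx⟩),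
        Set.indicator_of_mem (hsub ⟨hxt, hx⟩)]
    · rw [Set.indicator_of_notMem fun h => hxt h.1]
      by_cases hxQ : x ∈ Q
      · rw [Set.indicator_of_mem hxQ, image_eq_zero_of_notMem_tsupport hxt]
      · rw [Set.indicator_of_notMem hxQ]

theorem disjoint_diagThickening_mono {R R' : ℝ} (h : R ≤ R') {s : Set (Fin (n + 1) → M)}
    (hs : Disjoint s (diagThickening M n R')) : Disjoint s (diagThickening M n R) :=
  hs.mono_right (Metric.cthickening_mono h _)

/-- `⟨θ, μ⟩ = ∫ θ dμ` for all coarse chains and cochains. -/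
def chainPairing (θ : coarseCochains M n) (μ : coarseChains M n) : ℂ :=
  integralOn ⟨μ, μ.2.1⟩ (tsupport (θ : (Fin (n + 1) → M) → ℂ) ∩
    diagThickening M n μ.2.2.choose) θ

theorem chainPairing_eq_cint (θ : coarseCochains M n) (μ : coarseChains M n) {R : ℝ}
    (hR : ∀ s, Disjoint s (diagThickening M n R) → (μ : Set (Fin (n + 1) → M) → ℂ) s = 0)
    {Q : Set (Fin (n + 1) → M)} (hQ : MeasurableSet Q) (hb : Bornology.IsBounded Q)
    (hsub : tsupport (θ : (Fin (n + 1) → M) → ℂ) ∩ diagThickening M n R ⊆ Q) :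
    chainPairing θ μ = cint (restrictTo (⟨μ, μ.2.1⟩) Q)
      (Q.indicator (θ : (Fin (n + 1) → M) → ℂ)) := by
  set R₁ := μ.2.2.choose with hR₁
  have hspec := μ.2.2.choose_spec
  rw [← hR₁] at hspec
  set Q' := tsupport (θ : (Fin (n + 1) → M) → ℂ) ∩ diagThickening M n (max R R₁) with hQ'd
  have hQ' : MeasurableSet Q' := tsupport_inter_measurable _ _
  have hb' : Bornology.IsBounded Q' := θ.2.2.2.1 _
  have hmono : ∀ {S : ℝ}, S ≤ max R R₁ →
      tsupport (θ : (Fin (n + 1) → M) → ℂ) ∩ diagThickening M n S ⊆ Q' := fun h =>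
    Set.inter_subset_inter_right _ (Metric.cthickening_mono h _)
  rw [← integralOn_eq_cint_of_support θ.2 (⟨μ, μ.2.1⟩) hR hQ hb hsub,
    integralOn_eq_cint_of_support θ.2 (⟨μ, μ.2.1⟩) hR hQ' hb' (hmono (le_max_left _ _)),
    ← integralOn_eq_cint_of_support θ.2 (⟨μ, μ.2.1⟩) hspec hQ' hb' (hmono (le_max_right _ _))]
  rfl

theorem restrictTo_add (μ ν : locFinMeasure (Fin (n + 1) → M)) {Q : Set (Fin (n + 1) → M)}
    (hQ : MeasurableSet Q) (hb : Bornology.IsBounded Q) :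
    restrictTo (μ + ν) Q = restrictTo μ Q + restrictTo ν Q := by
  ext s hs
  rw [add_apply, restrictTo_apply _ hQ hb hs, restrictTo_apply _ hQ hb hs,
    restrictTo_apply _ hQ hb hs]
  rfl

theorem restrictTo_smul (c : ℂ) (μ : locFinMeasure (Fin (n + 1) → M)) {Q : Set (Fin (n + 1) → M)}
    (hQ : MeasurableSet Q) (hb : Bornology.IsBounded Q) :
    restrictTo (c • μ) Q = c • restrictTo μ Q := by
  ext s hs
  rw [smul_apply, restrictTo_apply _ hQ hb hs, restrictTo_apply _ hQ hb hs]
  rfl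

theorem exists_common_support (μ ν : coarseChains M n) : ∃ R : ℝ,
    ∀ s, Disjoint s (diagThickening M n R) → (μ : Set (Fin (n + 1) → M) → ℂ) s = 0 ∧
      (ν : Set (Fin (n + 1) → M) → ℂ) s = 0 := by
  obtain ⟨R, hR⟩ := μ.2.2
  obtain ⟨S, hS⟩ := ν.2.2
  exact ⟨max R S, fun s hs => ⟨hR s (disjoint_diagThickening_mono (le_max_left _ _) hs),
    hS s (disjoint_diagThickening_mono (le_max_right _ _) hs)⟩⟩

theorem chainPairing_add_left (θ η : coarseCochains M n) (μ : coarseChains M n) :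
    chainPairing (θ + η) μ = chainPairing θ μ + chainPairing η μ := by
  obtain ⟨R, hR⟩ := μ.2.2
  set Q := (tsupport (θ : (Fin (n + 1) → M) → ℂ) ∪ tsupport (η : (Fin (n + 1) → M) → ℂ)) ∩
    diagThickening M n R with hQd
  have hQ : MeasurableSet Q := ((isClosed_tsupport _).union (isClosed_tsupport _)).measurableSet.inter
    (measurableSet_diagThickening R)
  have hb : Bornology.IsBounded Q := by
    rw [hQd, Set.union_inter_distrib_right]
    exact (θ.2.2.2.1 R).union (η.2.2.2.1 R)
  have hbb := fun θ : coarseCochains M n =>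
    isBoundedBorel_indicator_of_mem_coarseCochains θ.2 hQ hb
  rw [chainPairing_eq_cint (θ + η) μ hR hQ hb (Set.inter_subset_inter_left _
      (tsupport_add _ _)),
    chainPairing_eq_cint θ μ hR hQ hb (Set.inter_subset_inter_left _ Set.subset_union_left),
    chainPairing_eq_cint η μ hR hQ hb (Set.inter_subset_inter_left _ Set.subset_union_right),
    ← (isSigmaFunctional_cint _).add _ _ (hbb θ) (hbb η), ← Set.indicator_add']
  rfl

theorem chainPairing_smul_left (c : ℂ) (θ : coarseCochains M n) (μ : coarseChains M n) :
    chainPairing (c • θ) μ = c * chainPairing θ μ := by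
  obtain ⟨R, hR⟩ := μ.2.2
  have hQ := tsupport_inter_measurable (θ : (Fin (n + 1) → M) → ℂ) R
  have hb := θ.2.2.2.1 R
  rw [chainPairing_eq_cint (c • θ) μ hR hQ hb (Set.inter_subset_inter_left _
      (closure_mono (Function.support_const_smul_subset c _))),
    chainPairing_eq_cint θ μ hR hQ hb le_rfl, ← cint_smul]
  congr 1
  exact Set.indicator_const_smul _ c _

theorem chainPairing_add_right (θ : coarseCochains M n) (μ ν : coarseChains M n) :
    chainPairing θ (μ + ν) = chainPairing θ μ + chainPairing θ ν := by
  obtain ⟨R, hR⟩ := exists_common_support μ ν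
  have hQ := tsupport_inter_measurable (θ : (Fin (n + 1) → M) → ℂ) R
  have hb := θ.2.2.2.1 R
  rw [chainPairing_eq_cint θ (μ + ν) (fun s hs => by
      change (μ : Set (Fin (n + 1) → M) → ℂ) s + (ν : Set (Fin (n + 1) → M) → ℂ) s = 0
      rw [(hR s hs).1, (hR s hs).2, add_zero]) hQ hb le_rfl,
    chainPairing_eq_cint θ μ (fun s hs => (hR s hs).1) hQ hb le_rfl,
    chainPairing_eq_cint θ ν (fun s hs => (hR s hs).2) hQ hb le_rfl,
    ← cint_add_measure _ _ (isBoundedBorel_indicator_of_mem_coarseCochains θ.2 hQ hb),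
    ← restrictTo_add _ _ hQ hb]
  rfl

theorem chainPairing_smul_right (c : ℂ) (θ : coarseCochains M n) (μ : coarseChains M n) :
    chainPairing θ (c • μ) = c * chainPairing θ μ := by
  obtain ⟨R, hR⟩ := μ.2.2
  have hQ := tsupport_inter_measurable (θ : (Fin (n + 1) → M) → ℂ) R
  have hb := θ.2.2.2.1 R
  rw [chainPairing_eq_cint θ (c • μ) (fun s hs => by
      change c * (μ : Set (Fin (n + 1) → M) → ℂ) s = 0
      rw [hR s hs, mul_zero]) hQ hb le_rfl,
    chainPairing_eq_cint θ μ hR hQ hb le_rfl,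
    ← cint_smul_measure _ _ (isBoundedBorel_indicator_of_mem_coarseCochains θ.2 hQ hb),
    ← restrictTo_smul _ _ hQ hb]
  rfl

/-- The pairing of cochains and chains as a bilinear map. -/
def pairingBilin : coarseCochains M n →ₗ[ℂ] coarseChains M n →ₗ[ℂ] ℂ :=
  LinearMap.mk₂ ℂ chainPairing chainPairing_add_left chainPairing_smul_left
    chainPairing_add_right chainPairing_smul_right

theorem pairingBilin_apply (θ : coarseCochains M n) (μ : coarseChains M n) :
    pairingBilin θ μ = chainPairing θ μ := rfl

/-- Coarse cochains are antisymmetric, so that the pairing with a permuted chain changes by a sign. -/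
theorem pairingBilin_perm (θ : coarseCochains M n) (μ : coarseChains M n)
    (σ : Equiv.Perm (Fin (n + 1))) :
    pairingBilin θ ⟨_, coarseChains_perm μ.2 σ⟩ =
      ((Equiv.Perm.sign σ : ℤ) : ℂ) * pairingBilin θ μ := by
  obtain ⟨R, hR⟩ := exists_common_support μ ⟨_, coarseChains_perm μ.2 σ⟩
  set S : (Fin (n + 1) → M) → Fin (n + 1) → M := fun x i => x (σ i) with hS
  have hSm : Measurable S := measurable_coord σ
  set Q := tsupport (θ : (Fin (n + 1) → M) → ℂ) ∩ diagThickening M n R with hQd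
  have hQ : MeasurableSet Q := tsupport_inter_measurable _ _
  have hb : Bornology.IsBounded Q := θ.2.2.2.1 R
  have hSQ : MeasurableSet (S ⁻¹' Q) := hQ.preimage hSm
  have hSb : Bornology.IsBounded (S ⁻¹' Q) := isBounded_preimage_perm hb σ
  have hθσ : ∀ x, (θ : (Fin (n + 1) → M) → ℂ) (S x) =
      ((Equiv.Perm.sign σ : ℤ) : ℂ) * (θ : (Fin (n + 1) → M) → ℂ) x := θ.2.2.2.2 σ
  have hsub : Q ⊆ S ⁻¹' Q := by
    rintro x ⟨hx, hxR⟩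
    refine ⟨?_, (diagThickening_perm σ).2 hxR⟩
    have hSc : Continuous S := continuous_pi fun i => continuous_apply (σ i)
    refine closure_mono ?_ (image_closure_subset_closure_image hSc ⟨x, hx, rfl⟩)
    rintro _ ⟨y, hy, rfl⟩
    rw [Function.mem_support, hθσ]
    exact mul_ne_zero (by simp) hy
  rw [pairingBilin_apply, pairingBilin_apply,
    chainPairing_eq_cint θ _ (fun s hs => (hR s hs).2) hQ hb le_rfl,
    chainPairing_eq_cint θ μ (fun s hs => (hR s hs).1) hSQ hSb hsub, ← cint_smul]
  have e : restrictTo ⟨_, locFinMeasure_perm μ.2.1 σ⟩ Q =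
      (restrictTo ⟨_, μ.2.1⟩ (S ⁻¹' Q)).map S := by
    ext s hs
    rw [VectorMeasure.map_apply _ hSm hs, restrictTo_apply _ hQ hb hs,
      restrictTo_apply _ hSQ hSb (hs.preimage hSm)]
    rfl
  change cint (restrictTo ⟨_, locFinMeasure_perm μ.2.1 σ⟩ Q) _ = _
  rw [e, cint_map _ hSm (isBoundedBorel_indicator_of_mem_coarseCochains θ.2 hQ hb)]
  congr 1
  ext x
  by_cases hx : S x ∈ Q
  · have hx' : x ∈ S ⁻¹' Q := hx
    simp [hx, hx', hθσ]
  · have hx' : x ∉ S ⁻¹' Q := hx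
    simp [hx, hx']

/-- The pairing is insensitive to the antisymmetry relations. -/
theorem pairingBilin_eq_zero_of_mem_antisymNull (θ : coarseCochains M n)
    {ν : Set (Fin (n + 1) → M) → ℂ} (hν : ν ∈ antisymNull M n) :
    pairingBilin θ ⟨ν, antisymNull_le hν⟩ = 0 := by
  have key : antisymNull M n ≤
      (LinearMap.ker (pairingBilin θ)).map (coarseChains M n).subtype := by
    refine Submodule.span_le.2 ?_
    rintro _ ⟨μ, hμ, σ, rfl⟩
    refine ⟨⟨μ, hμ⟩ - ((Equiv.Perm.sign σ : ℤ) : ℂ) • ⟨_, coarseChains_perm hμ σ⟩, ?_, rfl⟩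
    have := pairingBilin_perm θ ⟨μ, hμ⟩ σ
    rw [SetLike.mem_coe, LinearMap.mem_ker, map_sub, map_smul, this, smul_eq_mul, ← mul_assoc]
    rcases Int.units_eq_one_or (Equiv.Perm.sign σ) with h | h <;> simp [h]
  obtain ⟨μ, h1, rfl⟩ := key hν
  exact h1

omit [ProperSpace M] [BorelSpace M] in
theorem coboundary_apply (θ : (Fin (n + 1) → M) → ℂ) (x : Fin (n + 2) → M) :
    coboundary M n θ x =
      ∑ i : Fin (n + 2), (-1 : ℂ) ^ (i : ℕ) * θ fun j => x (i.succAbove j) := rfl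

theorem diagThickening_face {x : Fin (n + 2) → M} {R : ℝ} (i : Fin (n + 2))
    (hx : x ∈ diagThickening M (n + 1) R) : (fun j => x (i.succAbove j)) ∈ diagThickening M n R := by
  rw [diagThickening, Metric.mem_cthickening_iff] at hx ⊢
  refine le_trans ?_ hx
  refine le_iInf₂ fun y hy => ?_
  obtain ⟨c, rfl⟩ := hy
  refine (Metric.infEDist_le_edist_of_mem (Set.mem_range_self c)).trans ?_
  exact edist_pi_le_iff.2 fun j => edist_le_pi_edist x (fun _ => c) (i.succAbove j)

/-- Stokes' theorem for coarse chains and cochains. -/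
theorem pairingBilin_coboundary {θ : coarseCochains M n} {η : coarseCochains M (n + 1)}
    (hη : (η : (Fin (n + 2) → M) → ℂ) = coboundary M n θ) {μ : coarseChains M (n + 1)}
    {ν : coarseChains M n} (h : IsBoundaryOf (μ : Set (Fin (n + 2) → M) → ℂ) ν) :
    pairingBilin η μ = pairingBilin θ ν := by
  obtain ⟨R, hμR, hνR⟩ : ∃ R : ℝ,
      (∀ s, Disjoint s (diagThickening M (n + 1) R) → (μ : Set (Fin (n + 2) → M) → ℂ) s = 0) ∧
      ∀ s, Disjoint s (diagThickening M n R) → (ν : Set (Fin (n + 1) → M) → ℂ) s = 0 := by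
    obtain ⟨R, hR⟩ := μ.2.2
    obtain ⟨S, hS⟩ := ν.2.2
    exact ⟨max R S, fun s hs => hR s (disjoint_diagThickening_mono (le_max_left _ _) hs),
      fun s hs => hS s (disjoint_diagThickening_mono (le_max_right _ _) hs)⟩
  set D := diagThickening M (n + 1) R with hDd
  have hD : MeasurableSet D := measurableSet_diagThickening R
  set δ : Fin (n + 2) → (Fin (n + 2) → M) → Fin (n + 1) → M :=
    fun i x j => x (i.succAbove j) with hδ
  have hδm : ∀ i, Measurable (δ i) := fun i => measurable_coord _
  set Q := tsupport (θ : (Fin (n + 1) → M) → ℂ) ∩ diagThickening M n R with hQd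
  have hQ : MeasurableSet Q := tsupport_inter_measurable _ _
  have hb : Bornology.IsBounded Q := θ.2.2.2.1 R
  set Q₁ : Fin (n + 2) → Set (Fin (n + 2) → M) := fun i => δ i ⁻¹' Q ∩ D with hQ₁d
  have hQ₁ : ∀ i, MeasurableSet (Q₁ i) := fun i => (hQ.preimage (hδm i)).inter hD
  have hb₁ : ∀ i, Bornology.IsBounded (Q₁ i) := fun i => isBounded_preimage_face_inter hb i R
  have hb₂ : Bornology.IsBounded (⋃ i, Q₁ i) := (Bornology.isBounded_iUnion).2 hb₁
  have hQ₂ : MeasurableSet (⋃ i, Q₁ i) := MeasurableSet.iUnion hQ₁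
  -- The value of `μ` on `πᵢ⁻¹(s) ∩ Δ_S` does not depend on `S ≥ R`.
  have hν : ∀ s, MeasurableSet s → Bornology.IsBounded s → (ν : Set (Fin (n + 1) → M) → ℂ) s =
      ∑ i : Fin (n + 2), (-1 : ℂ) ^ (i : ℕ) * (μ : Set (Fin (n + 2) → M) → ℂ) (δ i ⁻¹' s ∩ D) := by
    intro s hs hsb
    obtain ⟨S, hS, hRS⟩ := ((h s hs hsb).and (eventually_ge_atTop R)).exists
    rw [hS]
    refine Finset.sum_congr rfl fun i _ => ?_
    congr 1
    have hDS : D ⊆ diagThickening M (n + 1) S := Metric.cthickening_mono hRS _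
    have e : δ i ⁻¹' s ∩ diagThickening M (n + 1) S = (δ i ⁻¹' s ∩ D) ∪
        ((δ i ⁻¹' s ∩ diagThickening M (n + 1) S) \ D) := by
      ext x
      have := @hDS x
      simp only [Set.mem_inter_iff, Set.mem_union, Set.mem_sdiff]
      tauto
    have hm := (hs.preimage (hδm i)).inter (measurableSet_diagThickening (n := n + 1) S)
    have hmb := isBounded_preimage_face_inter hsb i S
    change (μ : Set (Fin (n + 2) → M) → ℂ) (δ i ⁻¹' s ∩ diagThickening M (n + 1) S) = _
    rw [e, locFinMeasure_union μ.2.1 ((hs.preimage (hδm i)).inter hD) (hm.diff hD)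
      (isBounded_preimage_face_inter hsb i R) (hmb.subset Set.sdiff_subset)
      (Set.disjoint_sdiff_right.mono_left Set.inter_subset_right),
      hμR _ Set.disjoint_sdiff_left, add_zero]
  have hθb : IsBoundedBorel (Q.indicator (θ : (Fin (n + 1) → M) → ℂ)) :=
    isBoundedBorel_indicator_of_mem_coarseCochains θ.2 hQ hb
  have e : restrictTo ⟨_, ν.2.1⟩ Q = ∑ i : Fin (n + 2),
      (-1 : ℂ) ^ (i : ℕ) • (restrictTo ⟨_, μ.2.1⟩ (Q₁ i)).map (δ i) := by
    ext s hs
    rw [restrictTo_apply _ hQ hb hs]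
    change (ν : Set (Fin (n + 1) → M) → ℂ) (s ∩ Q) = _
    rw [hν _ (hs.inter hQ) (hb.subset Set.inter_subset_right), vectorMeasure_sum_apply]
    refine Finset.sum_congr rfl fun i _ => ?_
    rw [smul_apply, VectorMeasure.map_apply _ (hδm i) hs,
      restrictTo_apply _ (hQ₁ i) (hb₁ i) (hs.preimage (hδm i)), Set.preimage_inter,
      Set.inter_assoc]
    rfl
  set g : Fin (n + 2) → (Fin (n + 2) → M) → ℂ := fun i =>
    (Q₁ i).indicator fun x => Q.indicator (θ : (Fin (n + 1) → M) → ℂ) (δ i x) with hg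
  have hcomp : ∀ i, IsBoundedBorel fun x => Q.indicator (θ : (Fin (n + 1) → M) → ℂ) (δ i x) :=
    fun i => ⟨hθb.1.comp (hδm i), hθb.2.imp fun C hC x => hC _⟩
  have hgb : ∀ i, IsBoundedBorel (g i) := fun i => by
    rw [show g i = _ from indicator_eq_mul (Q₁ i) _]
    exact (isBoundedBorel_indicator (hQ₁ i)).mul (hcomp i)
  have hθν : pairingBilin θ ν = ∑ i : Fin (n + 2),
      (-1 : ℂ) ^ (i : ℕ) * cint (restrictTo ⟨_, μ.2.1⟩ (⋃ i, Q₁ i)) (g i) := by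
    rw [pairingBilin_apply, chainPairing_eq_cint θ ν hνR hQ hb le_rfl, e,
      cint_sum_measure _ _ hθb]
    refine Finset.sum_congr rfl fun i _ => ?_
    rw [cint_smul_measure _ _ hθb, cint_map _ (hδm i) hθb]
    congr 1
    exact integralOn_eq_cint ⟨_, μ.2.1⟩ (hQ₁ i) hQ₂ hb₂ (Set.subset_iUnion _ i) (hgb i)
  have hηsum : (⋃ i, Q₁ i).indicator (η : (Fin (n + 2) → M) → ℂ) =
      ∑ i : Fin (n + 2), (-1 : ℂ) ^ (i : ℕ) • g i := by
    ext x
    rw [Finset.sum_apply]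
    by_cases hx : x ∈ ⋃ i, Q₁ i
    · rw [Set.indicator_of_mem hx, hη, coboundary_apply]
      refine Finset.sum_congr rfl fun i _ => ?_
      obtain ⟨k, hk⟩ := Set.mem_iUnion.1 hx
      have hxD : x ∈ D := hk.2
      rw [Pi.smul_apply, smul_eq_mul]
      congr 1
      change (θ : (Fin (n + 1) → M) → ℂ) (δ i x) = _
      by_cases hxi : δ i x ∈ Q
      · have : x ∈ Q₁ i := ⟨hxi, hxD⟩
        simp only [hg, Set.indicator_of_mem this, Set.indicator_of_mem hxi]
      · have h1 : x ∉ Q₁ i := fun h => hxi h.1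
        simp only [hg, Set.indicator_of_notMem h1]
        exact image_eq_zero_of_notMem_tsupport fun h => hxi ⟨h, diagThickening_face i hxD⟩
    · rw [Set.indicator_of_notMem hx]
      refine (Finset.sum_eq_zero fun i _ => ?_).symm
      have h1 : x ∉ Q₁ i := fun h => hx (Set.mem_iUnion.2 ⟨i, h⟩)
      simp [hg, h1]
  have hsub : tsupport (η : (Fin (n + 2) → M) → ℂ) ∩ diagThickening M (n + 1) R ⊆ ⋃ i, Q₁ i := by
    rintro x ⟨hx, hxR⟩
    have hcl : IsClosed (⋃ i, δ i ⁻¹' tsupport (θ : (Fin (n + 1) → M) → ℂ)) :=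
      isClosed_iUnion_of_finite fun i => (isClosed_tsupport _).preimage
        (continuous_pi fun j => continuous_apply (i.succAbove j))
    have h1 : tsupport (η : (Fin (n + 2) → M) → ℂ) ⊆
        ⋃ i, δ i ⁻¹' tsupport (θ : (Fin (n + 1) → M) → ℂ) := by
      refine closure_minimal (fun y hy => ?_) hcl
      by_contra hcon
      refine hy ?_
      rw [hη, coboundary_apply]
      refine Finset.sum_eq_zero fun i _ => ?_
      have h2 : δ i y ∉ tsupport (θ : (Fin (n + 1) → M) → ℂ) := fun h =>
        hcon (Set.mem_iUnion.2 ⟨i, h⟩)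
      have h3 := image_eq_zero_of_notMem_tsupport h2
      change _ * (θ : (Fin (n + 1) → M) → ℂ) (δ i y) = 0
      rw [h3, mul_zero]
    obtain ⟨i, hi⟩ := Set.mem_iUnion.1 (h1 hx)
    exact Set.mem_iUnion.2 ⟨i, ⟨hi, diagThickening_face i hxR⟩, hxR⟩
  rw [hθν, pairingBilin_apply, chainPairing_eq_cint η μ hμR hQ₂ hb₂ hsub, hηsum,
    cint_sum _ _ fun i => (hgb i).smul _]
  exact Finset.sum_congr rfl fun i _ => cint_smul _ _ _

theorem pairingBilin_eq_zero_of_mem_coarseBoundaries {θ : (Fin (n + 1) → M) → ℂ}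
    (hθ : θ ∈ coarseCocycles M n) {ν : coarseChains M n}
    (hν : (ν : Set (Fin (n + 1) → M) → ℂ) ∈ coarseBoundaries M n) :
    pairingBilin ⟨θ, hθ.1⟩ ν = 0 := by
  obtain ⟨ν₁, ⟨h1, μ, hμ, hb⟩, ν₂, h2, h3⟩ := Submodule.mem_sup.1 hν
  have e : ν = ⟨ν₁, h1⟩ + ⟨ν₂, antisymNull_le h2⟩ := Subtype.ext h3.symm
  have h4 := pairingBilin_coboundary (θ := ⟨θ, hθ.1⟩) (η := 0) (μ := ⟨μ, hμ⟩) (ν := ⟨ν₁, h1⟩)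
    (LinearMap.mem_ker.1 hθ.2).symm hb
  rw [e, map_add, pairingBilin_eq_zero_of_mem_antisymNull _ h2, ← h4]
  simp

theorem pairingBilin_eq_zero_of_mem_coarseCoboundaries :
    ∀ {n : ℕ} {θ : coarseCochains M n} {μ : coarseChains M n},
    (θ : (Fin (n + 1) → M) → ℂ) ∈ coarseCoboundaries M n →
    (μ : Set (Fin (n + 1) → M) → ℂ) ∈ coarseCycles M n → pairingBilin θ μ = 0
  | 0, θ, μ, hθ, _ => by
    have : θ = 0 := Subtype.ext hθ
    rw [this, map_zero, LinearMap.zero_apply]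
  | n + 1, θ, μ, hθ, hμ => by
    obtain ⟨η, hη, e⟩ := hθ
    obtain ⟨h1, ν, hν, hb⟩ := hμ
    rw [pairingBilin_coboundary (θ := ⟨η, hη⟩) (ν := ⟨ν, antisymNull_le hν⟩) e.symm hb]
    exact pairingBilin_eq_zero_of_mem_antisymNull _ hν

theorem exists_isInducedPairing :
    ∃ F : HXCoh M n →ₗ[ℂ] HXHom M n →ₗ[ℂ] ℂ, IsInducedPairing F := by
  obtain ⟨B, hB⟩ : ∃ B : coarseCocycles M n →ₗ[ℂ] coarseCycles M n →ₗ[ℂ] ℂ,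
      ∀ (θ : coarseCocycles M n) (μ : coarseCycles M n),
        B θ μ = pairingBilin (n := n) ⟨θ.1, θ.2.1⟩ ⟨μ.1, coarseCycles_le n μ.2⟩ := by
    refine ⟨pairingBilin.compl₁₂
      (Submodule.inclusion (inf_le_left : coarseCocycles M n ≤ coarseCochains M n))
      (Submodule.inclusion (coarseCycles_le n)), fun θ μ => ?_⟩
    rw [LinearMap.compl₁₂_apply]
    exact congrArg₂ (fun a b => pairingBilin a b) rfl rfl
  have h1 : ∀ θ ∈ (coarseCoboundaries M n).submoduleOf (coarseCocycles M n), ∀ μ, B θ μ = 0 := by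
    intro θ hθ μ
    have hθ : (θ : (Fin (n + 1) → M) → ℂ) ∈ coarseCoboundaries M n := hθ
    rw [hB]
    exact pairingBilin_eq_zero_of_mem_coarseCoboundaries hθ μ.2
  have h2 : ∀ θ, ∀ μ ∈ (coarseBoundaries M n).submoduleOf (coarseCycles M n), B θ μ = 0 := by
    intro θ μ hμ
    have hμ : (μ : Set (Fin (n + 1) → M) → ℂ) ∈ coarseBoundaries M n := hμ
    rw [hB]
    exact pairingBilin_eq_zero_of_mem_coarseBoundaries θ.2 hμ
  obtain ⟨F, hF⟩ := exists_bilin_quotient B _ _ h1 h2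
  refine ⟨F, fun θ μ => ?_⟩
  have h3 := hF θ μ
  rw [hB, pairingBilin_apply] at h3
  exact h3

theorem isInducedPairing_classPairing : IsInducedPairing (classPairing M n) := by
  have h := exists_isInducedPairing (M := M) (n := n)
  rw [classPairing, dif_pos h]
  exact h.choose_spec

theorem classPairing_mk {θ : (Fin (n + 1) → M) → ℂ} (hθ : θ ∈ coarseCocycles M n)
    (μ : coarseCycles M n) : classPairing M n (HXCoh.mk θ hθ) (HXHom.mk μ) =
      pairingBilin ⟨θ, hθ.1⟩ ⟨μ, coarseCycles_le n μ.2⟩ :=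
  isInducedPairing_classPairing ⟨θ, hθ⟩ μ

end CochainPairing

/-! ### The coarse cocycle of a transverse family of sets -/

section Atoms

variable {M : Type*} {n : ℕ}

/-- The set of points that lie in exactly those sets `Yⱼ` with `q j = true`. -/
def atom (Y : Fin n → Set M) (q : Fin n → Bool) : Set M := {y | ∀ j, y ∈ Y j ↔ q j = true}

open Classical in
/-- The membership pattern of a point. -/
def pattern (Y : Fin n → Set M) (y : M) : Fin n → Bool := fun j => decide (y ∈ Y j)

theorem mem_atom_iff {Y : Fin n → Set M} {q : Fin n → Bool} {y : M} :
    y ∈ atom Y q ↔ pattern Y y = q := by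
  refine ⟨fun h => ?_, fun h j => ?_⟩
  · ext1 j
    rw [Bool.eq_iff_iff, ← h j]
    simp [pattern]
  · rw [← h]
    simp [pattern]

theorem disjoint_atom {Y : Fin n → Set M} {q q' : Fin n → Bool} (h : q ≠ q') :
    Disjoint (atom Y q) (atom Y q') :=
  Set.disjoint_left.2 fun _ hy hy' => h ((mem_atom_iff.1 hy).symm.trans (mem_atom_iff.1 hy'))

theorem measurableSet_atom [MeasurableSpace M] {Y : Fin n → Set M} (hY : ∀ j, MeasurableSet (Y j))
    (q : Fin n → Bool) : MeasurableSet (atom Y q) := by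
  have : atom Y q = ⋂ j, if q j then Y j else (Y j)ᶜ := by
    ext y
    rw [Set.mem_iInter]
    refine forall_congr' fun j => ?_
    cases h : q j <;> simp
  rw [this]
  refine MeasurableSet.iInter fun j => ?_
  cases q j
  · simpa using (hY j).compl
  · simpa using hY j

/-- The determinant of the incidence matrix of a family of membership patterns. -/
def patternDet (e : Fin n → Fin n → Bool) : ℂ :=
  Matrix.det (Matrix.of fun j i => if e i j then (1 : ℂ) else 0)

theorem patternDet_eq_sum (e : Fin n → Fin n → Bool) : patternDet e =
    ∑ σ : Equiv.Perm (Fin n), ((Equiv.Perm.sign σ : ℤ) : ℂ) *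
      ∏ i, if e i (σ i) then (1 : ℂ) else 0 := by
  rw [patternDet, Matrix.det_apply']
  rfl

theorem patternDet_eq_zero_of_eq {e : Fin n → Fin n → Bool} {i j : Fin n} (hij : i ≠ j)
    (h : e i = e j) : patternDet e = 0 :=
  Matrix.det_zero_of_column_eq hij fun k => by simp [h]

/-- The wedge depends only on the membership patterns of the coordinates. -/
theorem wedge_eq_patternDet {Y : Fin (n + 1) → Set M} (x : Fin (n + 1) → M) :
    wedge Y x = patternDet fun i => pattern Y (x i) := by
  rw [patternDet_eq_sum, wedge]
  refine Finset.sum_congr rfl fun σ _ => ?_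
  congr 1
  refine Finset.prod_congr rfl fun i _ => ?_
  by_cases h : x i ∈ Y (σ i) <;> simp [pattern, h]

end Atoms

section Transverse

variable {M : Type*} [MetricSpace M] [MeasurableSpace M] {n : ℕ}

/-- The properties of a list of sets `Y₀, …, Yₙ` that make `Y₀ ∧ ⋯ ∧ Yₙ` a coarse cocycle. They are
shared by coarsely transverse partitions and by the lists `M, X₁, …, Xₙ` that come from half
spaces. -/
structure IsTransverse (Y : Fin (n + 1) → Set M) : Prop where
  measurableSet : ∀ i, MeasurableSet (Y i)
  bounded : ∀ e : Fin (n + 1) → Fin (n + 1) → Bool, patternDet e ≠ 0 → ∀ R : ℝ,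
    Bornology.IsBounded (⋂ i, Metric.cthickening R (atom Y (e i)))
  one_mem_span : ∃ c : Fin (n + 1) → ℂ, ∀ y, ∑ j, c j * (Y j).indicator (fun _ => (1 : ℂ)) y = 1

theorem isBounded_iInter_cthickening {N : Fin n → Set M} {R : ℝ}
    (h : (∀ i, (N i).Nonempty) → Bornology.IsBounded (⋂ i, Metric.cthickening R (N i))) :
    Bornology.IsBounded (⋂ i, Metric.cthickening R (N i)) := by
  by_cases hN : ∀ i, (N i).Nonempty
  · exact h hN
  · obtain ⟨i, hi⟩ := not_forall.1 hN
    refine (Bornology.isBounded_empty (α := M)).subset fun x hx => ?_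
    have := Set.mem_iInter.1 hx i
    rw [Set.not_nonempty_iff_eq_empty.1 hi, Metric.cthickening_empty] at this
    exact this

/-- For a partition a nonzero pattern determinant means that the patterns are a permutation of
those of `A₀, …, Aₙ`. -/
theorem IsCoarselyTransversePartition.isTransverse {A : Fin (n + 1) → Set M}
    (hA : IsCoarselyTransversePartition A) : IsTransverse A where
  measurableSet := hA.measurableSet
  bounded e he R := by
    refine isBounded_iInter_cthickening fun hne => ?_
    choose y hy using hne
    have hex : ∀ i, ∃ k, y i ∈ A k := fun i => by
      have : y i ∈ ⋃ k, A k := by rw [hA.iUnion_eq]; trivial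
      exact Set.mem_iUnion.1 this
    choose k hk using hex
    have hsub : ∀ i, atom A (e i) ⊆ A (k i) := fun i z hz =>
      (hz (k i)).2 ((hy i (k i)).1 (hk i))
    have hinj : Function.Injective k := by
      intro i j hij
      by_contra hne
      refine he (patternDet_eq_zero_of_eq hne ?_)
      have hpat : ∀ {z w : M} {l : Fin (n + 1)}, z ∈ A l → w ∈ A l → pattern A z = pattern A w := by
        intro z w l hz hw
        ext1 m
        have : z ∈ A m ↔ w ∈ A m := by
          by_cases hml : m = l
          · subst hml; exact iff_of_true hz hw
          · exact iff_of_false (fun h => Set.disjoint_left.1 (hA.disjoint hml) h hz)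
              fun h => Set.disjoint_left.1 (hA.disjoint hml) h hw
        simp [pattern, this]
      rw [← mem_atom_iff.1 (hy i), ← mem_atom_iff.1 (hy j)]
      exact hpat (hk i) (hij ▸ hk j)
    have hsurj := Finite.injective_iff_surjective.1 hinj
    refine (hA.bounded R).subset fun x hx => Set.mem_iInter.2 fun l => ?_
    obtain ⟨i, rfl⟩ := hsurj l
    exact Metric.cthickening_subset_of_subset R (hsub i) (Set.mem_iInter.1 hx i)
  one_mem_span := by
    refine ⟨fun _ => 1, fun y => ?_⟩
    have : y ∈ ⋃ k, A k := by rw [hA.iUnion_eq]; trivial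
    obtain ⟨k, hk⟩ := Set.mem_iUnion.1 this
    rw [Finset.sum_eq_single k]
    · simp [hk]
    · intro j _ hj
      have : y ∉ A j := fun h => Set.disjoint_left.1 (hA.disjoint hj) h hk
      simp [this]
    · simp

/-- For half spaces a nonzero pattern determinant means that no `Xⱼ` contains all the atoms, and
none is disjoint from all of them. -/
theorem IsCoarselyTransverseHalfSpaces.isTransverse {X : Fin n → Set M}
    (hX : IsCoarselyTransverseHalfSpaces X) : IsTransverse (withOne X) where
  measurableSet i := by
    refine Fin.cases ?_ (fun i => ?_) i
    · exact MeasurableSet.univ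
    · exact hX.measurableSet i
  bounded e he R := by
    refine isBounded_iInter_cthickening fun hne => ?_
    choose y hy using hne
    have h0 : ∀ i, e i 0 = true := fun i => (hy i 0).1 (by simp [withOne])
    refine (hX.bounded R).subset fun x hx => Set.mem_iInter.2 fun j => ⟨?_, ?_⟩
    · have hex : ∃ i, e i j.succ = true := by
        by_contra! hcon
        refine he (Matrix.det_eq_zero_of_row_eq_zero j.succ fun i => ?_)
        simp [hcon i]
      obtain ⟨i, hi⟩ := hex
      refine Metric.cthickening_subset_of_subset R (fun z hz => ?_) (Set.mem_iInter.1 hx i)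
      simpa [withOne] using (hz j.succ).2 hi
    · have hex : ∃ i, e i j.succ = false := by
        by_contra! hcon
        refine he (Matrix.det_zero_of_row_eq (Fin.succ_ne_zero j) ?_)
        ext i
        simp [h0 i, hcon i]
      obtain ⟨i, hi⟩ := hex
      refine Metric.cthickening_subset_of_subset R (fun z hz => ?_) (Set.mem_iInter.1 hx i)
      have := hz j.succ
      rw [hi] at this
      simpa [withOne] using this
  one_mem_span := by
    refine ⟨Fin.cons 1 0, fun y => ?_⟩
    rw [Fin.sum_univ_succ]
    simp [withOne]

variable {Y : Fin (n + 1) → Set M}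

theorem wedge_perm (σ : Equiv.Perm (Fin (n + 1))) (x : Fin (n + 1) → M) :
    wedge Y (fun i => x (σ i)) = ((Equiv.Perm.sign σ : ℤ) : ℂ) * wedge Y x := by
  rw [wedge_eq_patternDet, wedge_eq_patternDet, patternDet, patternDet, ← Matrix.det_permute']
  rfl

theorem norm_wedge_le (x : Fin (n + 1) → M) : ‖wedge Y x‖ ≤ (n + 1)! := by
  rw [wedge]
  refine (norm_sum_le _ _).trans ?_
  have : ∀ σ : Equiv.Perm (Fin (n + 1)), ‖((Equiv.Perm.sign σ : ℤ) : ℂ) *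
      ∏ i, (Y (σ i)).indicator (fun _ => (1 : ℂ)) (x i)‖ ≤ 1 := fun σ => by
    rw [norm_mul, norm_prod]
    have h1 : ‖((Equiv.Perm.sign σ : ℤ) : ℂ)‖ = 1 := by
      rcases Int.units_eq_one_or (Equiv.Perm.sign σ) with h | h <;> simp [h]
    rw [h1, one_mul]
    refine Finset.prod_le_one (fun _ _ => norm_nonneg _) fun i _ => ?_
    by_cases h : x i ∈ Y (σ i) <;> simp [h]
  refine (Finset.sum_le_sum fun σ _ => this σ).trans ?_
  simp [Fintype.card_perm]

theorem measurable_wedge (hY : ∀ i, MeasurableSet (Y i)) : Measurable (wedge Y) := by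
  refine Finset.measurable_fun_sum _ fun σ _ => Measurable.const_mul ?_ _
  exact Finset.measurable_fun_prod _ fun i _ =>
    (measurable_const.indicator (hY (σ i))).comp (measurable_pi_apply i)

/-- The coboundary is the expansion, along a row of ones, of a determinant that contains the incidence
matrix of `n + 2` points; the row of ones is a combination of the others. -/
theorem IsTransverse.coboundary_wedge (hY : IsTransverse Y) : coboundary M n (wedge Y) = 0 := by
  obtain ⟨c, hc⟩ := hY.one_mem_span
  ext x
  let A : Matrix (Fin (n + 2)) (Fin (n + 2)) ℂ := Matrix.of fun j i =>
    (Fin.cons 1 (fun k : Fin (n + 1) => (Y k).indicator (fun _ => (1 : ℂ)) (x i)) :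
      Fin (n + 2) → ℂ) j
  have hdet : A.det = 0 := by
    refine Matrix.exists_vecMul_eq_zero_iff.1 ⟨Fin.cons 1 fun k => -c k, fun h => ?_, ?_⟩
    · have := congrFun h 0
      simp at this
    · ext i
      simp only [Matrix.vecMul, dotProduct, A, Matrix.of_apply, Pi.zero_apply]
      rw [Fin.sum_univ_succ]
      simp only [Fin.cons_zero, Fin.cons_succ, neg_mul, Finset.sum_neg_distrib, hc, mul_one]
      ring
  rw [Matrix.det_succ_row_zero] at hdet
  rw [Pi.zero_apply, ← hdet]
  change (∑ i : Fin (n + 2), (-1 : ℂ) ^ (i : ℕ) * wedge Y fun j => x (i.succAbove j)) = _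
  refine Finset.sum_congr rfl fun i _ => ?_
  have h0 : A 0 i = 1 := rfl
  rw [h0, mul_one, wedge, Matrix.det_apply']
  rfl

theorem isBounded_of_proj {D : Set M} (hD : Bornology.IsBounded D) {R : ℝ}
    {s : Set (Fin (n + 1) → M)} (hR : 0 ≤ R) (h0 : ∀ x ∈ s, x 0 ∈ D)
    (hs : s ⊆ diagThickening M n R) : Bornology.IsBounded s := by
  refine (isBounded_univ_pi fun _ => hD.cthickening (δ := 2 * R + 2)).subset fun x hx i _ => ?_
  exact Metric.mem_cthickening_of_dist_le _ _ _ _ (h0 x hx)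
    (dist_le_of_mem_diagThickening hR (hs hx) i 0)

/-- A point of the support of the wedge near the diagonal lies close to all the atoms of a pattern family
with nonzero determinant. -/
theorem IsTransverse.isBounded_tsupport (hY : IsTransverse Y) (R : ℝ) :
    Bornology.IsBounded (tsupport (wedge Y) ∩ diagThickening M n R) := by
  classical
  set D := ⋃ e : {e : Fin (n + 1) → Fin (n + 1) → Bool // patternDet e ≠ 0},
    ⋂ i, Metric.cthickening (2 * max R 0 + 3) (atom Y (e.1 i)) with hD
  have hDb : Bornology.IsBounded D := (Bornology.isBounded_iUnion).2 fun e => hY.bounded e.1 e.2 _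
  refine isBounded_of_proj hDb (le_max_right R 0) ?_ fun x hx =>
    Metric.cthickening_mono (le_max_left R 0) _ hx.2
  rintro x ⟨hx, hxR⟩
  have hxR' : x ∈ diagThickening M n (max R 0) := Metric.cthickening_mono (le_max_left R 0) _ hxR
  obtain ⟨x', hx', hd⟩ := Metric.mem_closure_iff.1 hx 1 one_pos
  rw [Function.mem_support, wedge_eq_patternDet] at hx'
  refine Set.mem_iUnion.2 ⟨⟨_, hx'⟩, Set.mem_iInter.2 fun i => ?_⟩
  refine Metric.mem_cthickening_of_dist_le (x 0) (x' i) _ _ (mem_atom_iff.2 rfl) ?_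
  have h1 := dist_le_of_mem_diagThickening (le_max_right R 0) hxR' 0 i
  have h2 := (dist_le_pi_dist x x' i).trans hd.le
  have h3 := dist_triangle (x 0) (x i) (x' i)
  linarith

theorem IsTransverse.wedge_mem (hY : IsTransverse Y) : wedge Y ∈ coarseCocycles M n :=
  ⟨⟨measurable_wedge hY.measurableSet, fun _ => ⟨Set.univ, univ_mem, _, fun y _ => norm_wedge_le y⟩,
    hY.isBounded_tsupport, wedge_perm⟩, LinearMap.mem_ker.2 hY.coboundary_wedge⟩

end Transverse

/-! ### Chern characters are cycles -/

section ChernCycles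

variable {A : Type*} [NonUnitalRing A] [Module ℂ A] [IsScalarTower ℂ A A] [SMulCommClass ℂ A A]
variable {n k : ℕ}

theorem trTensor_update (S : Fin (n + 1) → Matrix (Fin k) (Fin k) A) (i : Fin (n + 1))
    (x : Matrix (Fin k) (Fin k) A) : trTensor (Function.update S i x) =
      ∑ a : Fin (n + 1) → Fin k, PiTensorProduct.tprod ℂ
        (Function.update (fun j => S j (a j) (a (j + 1))) i (x (a i) (a (i + 1)))) := by
  refine Finset.sum_congr rfl fun a _ => congrArg _ ?_
  ext1 j
  by_cases h : j = i
  · subst h; simp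
  · simp [h]

theorem trTensor_update_add (S : Fin (n + 1) → Matrix (Fin k) (Fin k) A) (i : Fin (n + 1))
    (x y : Matrix (Fin k) (Fin k) A) : trTensor (Function.update S i (x + y)) =
      trTensor (Function.update S i x) + trTensor (Function.update S i y) := by
  simp only [trTensor_update, Matrix.add_apply, MultilinearMap.map_update_add,
    Finset.sum_add_distrib]

theorem trTensor_update_neg (S : Fin (n + 1) → Matrix (Fin k) (Fin k) A) (i : Fin (n + 1))
    (x : Matrix (Fin k) (Fin k) A) : trTensor (Function.update S i (-x)) =
      -trTensor (Function.update S i x) := by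
  simp only [trTensor_update, Matrix.neg_apply, MultilinearMap.map_update_neg,
    Finset.sum_neg_distrib]

theorem contractNth_eq_update {α : Type*} (f : α → α → α) (i : Fin (n + 1)) (a : Fin (n + 2) → α) :
    Fin.contractNth i.castSucc f a =
      Function.update (fun j => a (i.succ.succAbove j)) i (f (a i.castSucc) (a i.succ)) := by
  ext1 j
  rcases lt_trichotomy (j : ℕ) i with h | h | h
  · have h1 : i.succ.succAbove j = j.castSucc :=
      Fin.succAbove_of_castSucc_lt _ _ (by rw [Fin.lt_def]; simp; omega)
    rw [Fin.contractNth_apply_of_lt _ _ _ _ h,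
      Function.update_of_ne (fun e => h.ne (congrArg Fin.val e)), h1]
  · obtain rfl : j = i := Fin.ext h
    rw [Fin.contractNth_apply_of_eq _ _ _ _ rfl, Function.update_self]
  · have h1 : i.succ.succAbove j = j.succ :=
      Fin.succAbove_of_le_castSucc _ _ (by rw [Fin.le_def]; simp; omega)
    rw [Fin.contractNth_apply_of_gt _ _ _ _ h,
      Function.update_of_ne (fun e => h.ne' (congrArg Fin.val e)), h1]

theorem succAbove_succ_add_one (i j : Fin (n + 1)) (h : j ≠ i) :
    i.succ.succAbove j + 1 = i.succ.succAbove (j + 1) := by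
  have hn : NeZero (n + 1) := ⟨by omega⟩
  rcases Nat.lt_or_ge j n with hj | hj
  · have e : ((j + 1 : Fin (n + 1)) : ℕ) = j + 1 := Fin.val_add_one_of_lt (by rw [Fin.lt_def, Fin.val_last]; exact hj)
    have hji : (j : ℕ) ≠ i := fun e => h (Fin.ext e)
    have hs : i.succ.succAbove j < Fin.last (n + 1) := by
      rw [Fin.lt_def]
      simp only [Fin.succAbove, Fin.lt_def]
      split_ifs <;> simp <;> omega
    apply Fin.ext
    rw [Fin.val_add_one_of_lt hs]
    simp only [Fin.succAbove, Fin.lt_def, Fin.val_castSucc, Fin.val_succ, e]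
    split_ifs <;> simp <;> omega
  · obtain rfl : j = Fin.last n := Fin.ext (by simp; omega)
    have hi : (i : ℕ) ≠ n := fun e => h (Fin.ext (by simp [e]))
    have h1 : i.succ.succAbove (Fin.last n) = Fin.last (n + 1) := by
      apply Fin.ext
      simp only [Fin.succAbove, Fin.lt_def]
      split_ifs with hh <;> simp at hh ⊢
      omega
    rw [h1, Fin.last_add_one, Fin.last_add_one]
    exact (Fin.succAbove_ne_zero_zero (Fin.succ_ne_zero i)).symm

theorem succ_add_one (i : Fin (n + 1)) : i.succ + 1 = i.succ.succAbove (i + 1) := by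
  rcases Nat.lt_or_ge i n with hj | hj
  · have e : ((i + 1 : Fin (n + 1)) : ℕ) = i + 1 := Fin.val_add_one_of_lt (by rw [Fin.lt_def, Fin.val_last]; exact hj)
    have hs : i.succ < Fin.last (n + 1) := by rw [Fin.lt_def]; simpa
    apply Fin.ext
    rw [Fin.val_add_one_of_lt hs]
    simp only [Fin.succAbove, Fin.lt_def, Fin.val_castSucc, Fin.val_succ, e]
    simp [e]
  · obtain rfl : i = Fin.last n := Fin.ext (by simp; omega)
    rw [Fin.succ_last, Fin.last_add_one, Fin.last_add_one]
    exact (Fin.succAbove_ne_zero_zero (by simp [Fin.ext_iff])).symm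

/-- The faces of `tr(S₀ ⊗ ⋯ ⊗ Sₙ₊₁)` multiply adjacent matrices. -/
theorem faceMap_trTensor (i : Fin (n + 1)) (S : Fin (n + 2) → Matrix (Fin k) (Fin k) A) :
    faceMap A n i (trTensor S) =
      trTensor (Function.update (fun j => S (i.succ.succAbove j)) i (S i.castSucc * S i.succ)) := by
  rw [trTensor_update, trTensor, map_sum,
    ← (Fin.insertNthEquiv (fun _ => Fin k) i.succ).sum_comp, Fintype.sum_prod_type_right]
  refine Finset.sum_congr rfl fun b _ => ?_
  rw [Matrix.mul_apply, MultilinearMap.map_update_sum]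
  refine Finset.sum_congr rfl fun c _ => ?_
  rw [faceMap_tprod, contractNth_eq_update]
  congr 1
  have hins : ∀ q, (Fin.insertNthEquiv (fun _ => Fin k) i.succ) (c, b) (i.succ.succAbove q) = b q :=
    fun q => Fin.insertNth_apply_succAbove (α := fun _ => Fin k) i.succ c b q
  have hsame : (Fin.insertNthEquiv (fun _ => Fin k) i.succ) (c, b) i.succ = c :=
    Fin.insertNth_apply_same (α := fun _ => Fin k) i.succ c b
  have hi : i.castSucc = i.succ.succAbove i :=
    (Fin.succAbove_of_castSucc_lt _ _ (by rw [Fin.lt_def]; simp)).symm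
  have hi' : i.castSucc + 1 = i.succ := by
    have : (i.castSucc : Fin (n + 2)) < Fin.last (n + 1) := Fin.castSucc_lt_last i
    apply Fin.ext
    rw [Fin.val_add_one_of_lt this]
    simp
  ext1 j
  by_cases h : j = i
  · subst h
    rw [Function.update_self, Function.update_self, hi', hsame, succ_add_one, hins, hi, hins]
  · rw [Function.update_of_ne h, Function.update_of_ne h, succAbove_succ_add_one _ _ h, hins, hins]

/-- Cyclic symmetry of the generalized trace. -/
theorem rotateMap_trTensor (S : Fin (n + 1) → Matrix (Fin k) (Fin k) A) :
    rotateMap A n (trTensor S) = trTensor fun i => S ((finRotate (n + 1)).symm i) := by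
  rw [trTensor, map_sum, trTensor,
    ← (Equiv.arrowCongr (finRotate (n + 1)).symm (Equiv.refl (Fin k))).sum_comp]
  refine Finset.sum_congr rfl fun a _ => ?_
  rw [rotateMap_tprod]
  congr 1
  ext1 i
  have h1 : finRotate (n + 1) ((finRotate (n + 1)).symm i + 1) = i + 1 := by
    rw [finRotate_apply, ← finRotate_apply (i := (finRotate _).symm i), Equiv.apply_symm_apply]
  change S _ (a (finRotate (n + 1) ((finRotate (n + 1)).symm i)))
    (a (finRotate (n + 1) ((finRotate (n + 1)).symm i + 1))) = _
  rw [h1, Equiv.apply_symm_apply]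

theorem mem_cyclicCycles_succ {z : Chains A (n + 1)} :
    z ∈ cyclicCycles A (n + 1) ↔ ∃ w, w - cyclicOp A n w = hochschild A n z := Iff.rfl

/-- The boundary of `tr(P ⊗ ⋯ ⊗ P)` is the same chain in one degree less, on which the signed
rotation acts by `-1`. -/
theorem trTensor_idem_mem {P : Matrix (Fin k) (Fin k) A} (hP : P * P = P) (hn : Odd n) :
    (trTensor fun _ => P : Chains A (n + 1)) ∈ cyclicCycles A (n + 1) := by
  have hf : ∀ i, faceMap A n i (trTensor fun _ => P) = trTensor fun _ => P := fun i => by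
    rw [faceMap_trTensor, hP, Function.update_eq_self]
  refine mem_cyclicCycles_succ.2 ⟨(2⁻¹ : ℂ) • trTensor fun _ => P, ?_⟩
  rw [hochschild_apply, rotateMap_trTensor]
  simp only [hf]
  rw [cyclicOp, LinearMap.smul_apply, map_smul, rotateMap_trTensor, ← Finset.sum_smul,
    Fin.sum_univ_eq_sum_range (fun i => (-1 : ℂ) ^ i), pow_succ, hn.neg_one_pow]
  have : ∑ i ∈ Finset.range (n + 1), (-1 : ℂ) ^ i = 0 := by
    rw [neg_one_geom_sum, if_pos hn.add_one]
  rw [this]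
  module

theorem chernIdem_mem (m : ℕ) {P : Matrix (Fin k) (Fin k) A} (hP : P * P = P) :
    chernIdem m P ∈ cyclicCycles A (2 * m) := by
  refine Submodule.smul_mem _ _ ?_
  cases m with
  | zero => exact Submodule.mem_top
  | succ m => exact trTensor_idem_mem (n := 2 * m + 1) hP ⟨m, rfl⟩

/-- Multiplying two adjacent factors whose product is minus their sum amounts to omitting either
factor. -/
theorem faceMap_trTensor_of_mul_eq (i : Fin (n + 1)) (S : Fin (n + 2) → Matrix (Fin k) (Fin k) A)
    (h : S i.castSucc * S i.succ = -S i.castSucc - S i.succ) : faceMap A n i (trTensor S) =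
      -(trTensor (fun j => S (i.castSucc.succAbove j)) +
        trTensor fun j => S (i.succ.succAbove j)) := by
  rw [faceMap_trTensor, h, sub_eq_add_neg, trTensor_update_add, trTensor_update_neg,
    trTensor_update_neg, add_comm, neg_add]
  have h1 : Function.update (fun j => S (i.succ.succAbove j)) i (S i.succ) =
      fun j => S (i.castSucc.succAbove j) := by
    ext1 j
    by_cases hj : j = i
    · subst hj; simp
    · rw [Function.update_of_ne hj]
      congr 1
      have : (j : ℕ) ≠ i := fun e => hj (Fin.ext e)
      apply Fin.ext
      simp only [Fin.succAbove, Fin.lt_def, Fin.val_castSucc, Fin.val_succ]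
      split_ifs <;> first | rfl | omega
  have h2 : Function.update (fun j => S (i.succ.succAbove j)) i (S i.castSucc) =
      fun j => S (i.succ.succAbove j) := by
    ext1 j
    by_cases hj : j = i
    · subst hj; simp
    · rw [Function.update_of_ne hj]
  rw [h1, h2]

/-- The faces of `tr(u ⊗ v ⊗ ⋯ ⊗ u ⊗ v)` telescope to `λ - 1` applied to
`tr(v ⊗ u ⊗ ⋯ ⊗ u ⊗ v)`. -/
theorem chernInv_mem (m : ℕ) {u v : Matrix (Fin k) (Fin k) A} (huv : u * v = -u - v)
    (hvu : v * u = -u - v) : chernInv m u v ∈ cyclicCycles A (2 * m + 1) := by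
  refine Submodule.smul_mem _ _ (mem_cyclicCycles_succ.2 ?_)
  set S : Fin (2 * m + 2) → Matrix (Fin k) (Fin k) A := fun i => if Even (i : ℕ) then u else v
    with hS
  set S' : Fin (2 * m + 2) → Matrix (Fin k) (Fin k) A := fun i => if Even (i : ℕ) then v else u
    with hS'
  have hvu' : v * u = -v - u := by rw [hvu]; abel
  have huv' : u * v = -v - u := by rw [huv]; abel
  have hrot : (fun i => S ((finRotate (2 * m + 2)).symm i)) = S' := by
    ext1 i
    obtain ⟨j, rfl⟩ := (finRotate (2 * m + 2)).surjective i
    rw [Equiv.symm_apply_apply, finRotate_apply]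
    simp only [hS, hS']
    rcases Nat.lt_or_ge j (2 * m + 1) with hj | hj
    · rw [Fin.val_add_one_of_lt (by rw [Fin.lt_def, Fin.val_last]; exact hj)]
      by_cases h : Even (j : ℕ) <;> simp [h, Nat.even_add_one]
    · obtain rfl : j = Fin.last (2 * m + 1) := Fin.ext (by simp; omega)
      simp [Fin.last_add_one]
  -- `z p` omits the `p`-th factor of `u ⊗ v ⊗ ⋯ ⊗ u ⊗ v`
  set z : ℕ → Chains A (2 * m) := fun p =>
    trTensor fun j : Fin (2 * m + 1) => if (j : ℕ) < p then S j.castSucc else S j.succ with hz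
  have hzs : ∀ p : Fin (2 * m + 2), (trTensor fun j => S (p.succAbove j)) = z p := fun p => by
    simp only [hz]
    congr 1
    ext1 j
    simp only [Fin.succAbove, Fin.lt_def, Fin.val_castSucc]
    split_ifs <;> rfl
  have hface : ∀ i : Fin (2 * m + 1), faceMap A (2 * m) i (trTensor S) = -(z i + z (i + 1)) := by
    intro i
    rw [faceMap_trTensor_of_mul_eq, hzs, hzs]
    · rfl
    · simp only [hS, Fin.val_castSucc, Fin.val_succ, Nat.even_add_one]
      by_cases h : Even (i : ℕ) <;> simp [h, huv, hvu']
  have hface' : faceMap A (2 * m) 0 (trTensor S') = -(z (2 * m + 1) + rotateMap A _ (z 0)) := by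
    rw [faceMap_trTensor_of_mul_eq]
    · congr 2
      · simp only [hz]
        congr 1
        ext1 j
        simp only [hS, hS', j.2, if_true, Fin.castSucc_zero, Fin.succAbove_zero, Fin.val_succ,
          Nat.even_add_one, Fin.val_castSucc]
        by_cases h : Even (j : ℕ) <;> simp [h]
      · simp only [hz, rotateMap_trTensor]
        congr 1
        ext1 i
        obtain ⟨j, rfl⟩ := (finRotate (2 * m + 1)).surjective i
        rw [Equiv.symm_apply_apply, finRotate_apply]
        simp only [hS, hS', Nat.not_lt_zero, if_false, Fin.val_succ, Nat.even_add_one]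
        rcases Nat.lt_or_ge j (2 * m) with hj | hj
        · have e : ((j + 1 : Fin (2 * m + 1)) : ℕ) = j + 1 :=
            Fin.val_add_one_of_lt (by rw [Fin.lt_def, Fin.val_last]; exact hj)
          have : (Fin.succAbove (Fin.succ 0) (j + 1 : Fin (2 * m + 1)) : ℕ) = j + 2 := by
            simp only [Fin.succAbove, Fin.lt_def, Fin.val_castSucc, Fin.val_succ, e]
            simp [e]
          rw [this]
          by_cases h : Even (j : ℕ) <;> simp [h, Nat.even_add]
        · obtain rfl : j = Fin.last (2 * m) := Fin.ext (by simp; omega)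
          rw [Fin.last_add_one]
          have : (Fin.succAbove (Fin.succ 0) (0 : Fin (2 * m + 1)) : ℕ) = 0 := by
            simp [Fin.succAbove]
          rw [this]
          simp
    · simp [hS', hvu']
  refine ⟨-z 0, ?_⟩
  have hodd : (-1 : ℂ) ^ (2 * m + 1) = -1 := Odd.neg_one_pow ⟨m, rfl⟩
  have heven : (-1 : ℂ) ^ (2 * m) = 1 := Even.neg_one_pow ⟨m, two_mul m⟩
  rw [hochschild_apply, rotateMap_trTensor, hrot, hface']
  simp only [hface, smul_neg, Finset.sum_neg_distrib]
  have ht := alternating_sum_add_succ fun p : Fin (2 * m + 2) => z p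
  simp only [Fin.val_castSucc, Fin.val_succ, Fin.val_zero, Fin.val_last] at ht
  rw [ht, cyclicOp, LinearMap.smul_apply, hodd, heven, map_neg]
  module

end ChernCycles

section Unitization

variable {M : Type*} [MetricSpace M] [MeasurableSpace M] [BorelSpace M]
variable {H : Type*} [NormedAddCommGroup H] [InnerProductSpace ℂ H] [CompleteSpace H]
variable (ρ : C₀(M, ℂ) →⋆ₙₐ[ℂ] (H →L[ℂ] H)) {n k : ℕ}

theorem dropScalars_trTensor (S : Fin (n + 1) → Matrix (Fin k) (Fin k) (algBPlus ρ)) :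
    dropScalars ρ n (trTensor S) = trTensor fun i => nonscalarPart ρ (S i) := by
  rw [trTensor, map_sum]
  exact Finset.sum_congr rfl fun a _ => PiTensorProduct.map_tprod _ _

/-- From `(1 + u)(1 + v) = 1`. -/
theorem nonscalarPart_mul_nonscalarPart {P Q : Matrix (Fin k) (Fin k) (algBPlus ρ)}
    (hPQ : P * Q = 1) (hP : P.map (fun x => x.fst) = 1) (hQ : Q.map (fun x => x.fst) = 1) :
    nonscalarPart ρ P * nonscalarPart ρ Q = -nonscalarPart ρ P - nonscalarPart ρ Q := by
  have h1 : ∀ a b, (P a b).fst = (1 : Matrix (Fin k) (Fin k) ℂ) a b := fun a b => congrFun₂ hP a b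
  have h2 : ∀ a b, (Q a b).fst = (1 : Matrix (Fin k) (Fin k) ℂ) a b := fun a b => congrFun₂ hQ a b
  ext1 a b
  have h : ((P * Q) a b).snd = 0 := by
    rw [hPQ, Matrix.one_apply]
    split_ifs <;> simp
  rw [Matrix.mul_apply, ← Unitization.sndHom_apply (R := ℂ) (S := ℂ), map_sum] at h
  simp only [Unitization.sndHom_apply, Unitization.snd_mul, h1, h2, Finset.sum_add_distrib,
    Matrix.one_apply, ite_smul, one_smul, zero_smul, Finset.sum_ite_eq, Finset.sum_ite_eq',
    Finset.mem_univ, if_true] at h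
  simp only [Matrix.mul_apply, nonscalarPart, Matrix.map_apply, Matrix.sub_apply, Matrix.neg_apply]
  rw [eq_sub_iff_add_eq, eq_neg_iff_add_eq_zero, ← h]
  abel

theorem chernInv_nonscalarPart_mem (m : ℕ) (U : (Matrix (Fin k) (Fin k) (algBPlus ρ))ˣ)
    (hU : (U : Matrix (Fin k) (Fin k) (algBPlus ρ)).map (fun x => x.fst) = 1) :
    chernInv m (nonscalarPart ρ (U : Matrix (Fin k) (Fin k) (algBPlus ρ)))
      (nonscalarPart ρ (U⁻¹ : (Matrix (Fin k) (Fin k) (algBPlus ρ))ˣ).val) ∈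
      cyclicCycles (algB ρ) (2 * m + 1) := by
  have hV : (U⁻¹ : (Matrix (Fin k) (Fin k) (algBPlus ρ))ˣ).val.map (fun x => x.fst) = 1 := by
    have h := congrArg (RingHom.mapMatrix (m := Fin k)
      (Unitization.fstHom ℂ (algB ρ) : algBPlus ρ →+* ℂ)) U.mul_inv
    rw [map_mul, map_one] at h
    have h' : RingHom.mapMatrix (m := Fin k)
      (Unitization.fstHom ℂ (algB ρ) : algBPlus ρ →+* ℂ) U.val = 1 := hU
    rw [h', one_mul] at h
    exact h
  refine chernInv_mem m (nonscalarPart_mul_nonscalarPart ρ U.mul_inv hU hV) ?_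
  rw [nonscalarPart_mul_nonscalarPart ρ U.inv_mul hV hU]
  abel

end Unitization

/-! ### Localization of operator products -/

section Localization

variable {M : Type*} [MetricSpace M] [MeasurableSpace M] {R : Type*} [Ring R]

/-- A finitely additive projection-valued set function with values in a ring. -/
structure IsProjectionValued (E : Set M → R) : Prop where
  mul : ∀ {A B : Set M}, MeasurableSet A → MeasurableSet B → E A * E B = E (A ∩ B)
  add_sdiff : ∀ {A B : Set M}, MeasurableSet A → MeasurableSet B → E A = E (A ∩ B) + E (A \ B)

/-- The product `E(B₀) T₀ E(B₁) T₁ ⋯ Tₙ₋₁ E(Bₙ)`. -/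
def chainProd (E : Set M → R) {n : ℕ} (T : Fin n → R) (B : Fin (n + 1) → Set M) : R :=
  (List.ofFn fun i : Fin n => E (B i.castSucc) * T i).prod * E (B (Fin.last n))

variable {E : Set M → R} {n : ℕ}

theorem chainProd_succ (T : Fin (n + 1) → R) (B : Fin (n + 2) → Set M) :
    chainProd E T B = chainProd E (fun i => T i.castSucc) (fun i => B i.castSucc) *
      T (Fin.last n) * E (B (Fin.last (n + 1))) := by
  rw [chainProd, List.ofFn_succ_last, List.prod_append, List.prod_singleton, chainProd]
  simp only [mul_assoc]

theorem chainProd_succ' (T : Fin (n + 1) → R) (B : Fin (n + 2) → Set M) :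
    chainProd E T B = E (B 0) * T 0 * chainProd E (fun i => T i.succ) fun i => B i.succ := by
  rw [chainProd, List.ofFn_succ, List.prod_cons, chainProd]
  simp only [mul_assoc]
  rfl

variable (hE : IsProjectionValued E)
include hE

theorem IsProjectionValued.chainProd_mul_last (T : Fin n → R) {B : Fin (n + 1) → Set M}
    (hB : ∀ i, MeasurableSet (B i)) :
    chainProd E T B * E (B (Fin.last n)) = chainProd E T B := by
  rw [chainProd, mul_assoc, hE.mul (hB _) (hB _), Set.inter_self]

theorem IsProjectionValued.zero_mul_chainProd (T : Fin n → R) {B : Fin (n + 1) → Set M}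
    (hB : ∀ i, MeasurableSet (B i)) : E (B 0) * chainProd E T B = chainProd E T B := by
  cases n with
  | zero =>
    simp only [chainProd, List.ofFn_zero, List.prod_nil, one_mul]
    exact (hE.mul (hB _) (hB _)).trans (by rw [show Fin.last 0 = 0 from rfl, Set.inter_self])
  | succ n => rw [chainProd_succ', ← mul_assoc, ← mul_assoc, hE.mul (hB _) (hB _), Set.inter_self]

/-- The factors `Tᵢ` matter only between the sets `Bᵢ` and `Bᵢ₊₁`. -/
theorem IsProjectionValued.chainProd_congr {T T' : Fin n → R} {B : Fin (n + 1) → Set M}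
    (hB : ∀ i, MeasurableSet (B i))
    (h : ∀ i, E (B i.castSucc) * T i * E (B i.succ) = E (B i.castSucc) * T' i * E (B i.succ)) :
    chainProd E T B = chainProd E T' B := by
  induction n with
  | zero => rw [Subsingleton.elim T T']
  | succ n ih =>
    have hl := h (Fin.last n)
    rw [Fin.succ_last] at hl
    rw [chainProd_succ, chainProd_succ, ih (fun i => hB i.castSucc) fun i => h i.castSucc,
      ← hE.chainProd_mul_last _ fun i => hB i.castSucc]
    simp only [mul_assoc] at hl ⊢
    rw [hl]

/-- If every `Tᵢ` maps `Bᵢ₊₁ \ Lᵢ₊₁` away from `Bᵢ ∩ Lᵢ`, then the sets `Bᵢ` can be replaced by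
`Bᵢ ∩ Lᵢ`, from left to right. -/
theorem IsProjectionValued.chainProd_inter_of_forward {T : Fin n → R} {B L : Fin (n + 1) → Set M}
    (hB : ∀ i, MeasurableSet (B i)) (hL : ∀ i, MeasurableSet (L i)) (h0 : B 0 ⊆ L 0)
    (h : ∀ i : Fin n, E (B i.castSucc ∩ L i.castSucc) * T i * E (B i.succ \ L i.succ) = 0) :
    chainProd E T B = chainProd E T fun i => B i ∩ L i := by
  induction n with
  | zero =>
    have : B = fun i => B i ∩ L i := by
      ext1 i
      rw [Fin.fin_one_eq_zero i, Set.inter_eq_left.2 h0]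
    rw [← this]
  | succ n ih =>
    rw [chainProd_succ, chainProd_succ,
      ih (B := fun i => B i.castSucc) (L := fun i => L i.castSucc) (fun i => hB i.castSucc)
        (fun i => hL i.castSucc) h0 fun i => h i.castSucc,
      hE.add_sdiff (hB (Fin.last (n + 1))) (hL (Fin.last (n + 1))), mul_add, add_eq_left,
      ← hE.chainProd_mul_last _ fun i => (hB i.castSucc).inter (hL i.castSucc), mul_assoc, mul_assoc,
      ← mul_assoc (E _)]
    have := h (Fin.last n)
    rw [Fin.succ_last] at this
    rw [this, mul_zero]

/-- The mirror image of `chainProd_inter_of_forward`. -/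
theorem IsProjectionValued.chainProd_inter_of_backward {T : Fin n → R} {B L : Fin (n + 1) → Set M}
    (hB : ∀ i, MeasurableSet (B i)) (hL : ∀ i, MeasurableSet (L i))
    (h0 : B (Fin.last n) ⊆ L (Fin.last n))
    (h : ∀ i : Fin n, E (B i.castSucc \ L i.castSucc) * T i * E (B i.succ ∩ L i.succ) = 0) :
    chainProd E T B = chainProd E T fun i => B i ∩ L i := by
  induction n with
  | zero =>
    have : B = fun i => B i ∩ L i := by
      ext1 i
      rw [Fin.fin_one_eq_zero i, Set.inter_eq_left.2 (show B 0 ⊆ L 0 from h0)]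
    rw [← this]
  | succ n ih =>
    rw [chainProd_succ', chainProd_succ',
      ih (B := fun i => B i.succ) (L := fun i => L i.succ) (fun i => hB i.succ)
        (fun i => hL i.succ) h0 fun i => h i.succ,
      hE.add_sdiff (hB 0) (hL 0), add_mul, add_mul, add_eq_left,
      ← hE.zero_mul_chainProd _ fun i => (hB i.succ).inter (hL i.succ), ← mul_assoc]
    have := h 0
    rw [Fin.castSucc_zero] at this
    rw [this, zero_mul]

/-- When the `Tᵢ` have propagation at most `r`, the sets `Nᵢ` can be cut down to any set that
contains the points close to all of them. -/
theorem IsProjectionValued.chainProd_inter [BorelSpace M] {T : Fin n → R} {r : ℝ} (hr : 0 ≤ r)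
    (hT : ∀ i {A B : Set M}, MeasurableSet A → MeasurableSet B →
      (∀ x ∈ A, ∀ y ∈ B, r ≤ dist x y) → E A * T i * E B = 0)
    {N : Fin (n + 1) → Set M} (hN : ∀ i, MeasurableSet (N i)) {K : Set M} (hK : MeasurableSet K)
    (hNK : ⋂ i, Metric.cthickening (n * r) (N i) ⊆ K) :
    chainProd E T N = chainProd E T fun i => N i ∩ K := by
  have hstep : ∀ {x y : M} {s : Set M} {a b : ℝ}, 0 ≤ a → a + r = b → dist x y < r →
      x ∈ Metric.cthickening a s → y ∈ Metric.cthickening b s := by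
    intro x y s a b ha hab hxy hx
    rw [Metric.mem_cthickening_iff] at hx ⊢
    calc Metric.infEDist y s ≤ Metric.infEDist x s + edist y x := Metric.infEDist_le_infEDist_add_edist
      _ ≤ ENNReal.ofReal a + ENNReal.ofReal r := by
        gcongr
        rw [edist_dist, dist_comm]
        exact ENNReal.ofReal_le_ofReal hxy.le
      _ = ENNReal.ofReal b := by rw [← ENNReal.ofReal_add ha hr, hab]
  -- `L i` collects the constraints from the sets to the left of `i`, and the second family those
  -- from the sets to the right
  set L : Fin (n + 1) → Set M := fun i =>
    ⋂ j : {j : Fin (n + 1) // j ≤ i}, Metric.cthickening (((i : ℕ) - (j.1 : ℕ) : ℝ) * r) (N j) with hL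
  set L' : Fin (n + 1) → Set M := fun i =>
    ⋂ j : {j : Fin (n + 1) // i ≤ j}, Metric.cthickening (((j.1 : ℕ) - (i : ℕ) : ℝ) * r) (N j) with hL'
  have hLm : ∀ i, MeasurableSet (L i) := fun i =>
    MeasurableSet.iInter fun _ => Metric.isClosed_cthickening.measurableSet
  have hLm' : ∀ i, MeasurableSet (L' i) := fun i =>
    MeasurableSet.iInter fun _ => Metric.isClosed_cthickening.measurableSet
  have key : ∀ B : Fin (n + 1) → Set M, (∀ i, MeasurableSet (B i)) → (∀ i, B i ⊆ N i) →
      chainProd E T B = chainProd E T fun i => (B i ∩ L i) ∩ L' i := by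
    intro B hB hBN
    rw [hE.chainProd_inter_of_forward hB hLm, hE.chainProd_inter_of_backward
      (fun i => (hB i).inter (hLm i)) hLm']
    · refine fun x hx => Set.mem_iInter.2 fun j => ?_
      obtain ⟨j, hj⟩ := j
      obtain rfl : j = Fin.last n := le_antisymm (Fin.le_last j) hj
      exact Metric.self_subset_cthickening _ (hBN _ hx.1)
    · refine fun i => hT i (((hB _).inter (hLm _)).diff (hLm' _))
        (((hB _).inter (hLm _)).inter (hLm' _)) fun x hx y hy => ?_
      by_contra! hxy
      refine hx.2 (Set.mem_iInter.2 fun j => ?_)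
      obtain ⟨j, hj⟩ := j
      rcases hj.eq_or_lt with rfl | hj'
      · exact Metric.self_subset_cthickening _ (hBN _ hx.1.1)
      · have hj2 : i.succ ≤ j := hj'
        have hj3 : ((i : ℕ) : ℝ) + 1 ≤ (j : ℕ) := by exact_mod_cast hj2
        refine hstep (a := (((j : ℕ) : ℝ) - (i.succ : ℕ)) * r) ?_ ?_ (by rwa [dist_comm])
          (Set.mem_iInter.1 hy.2 ⟨j, hj2⟩)
        · rw [Fin.val_succ]
          push_cast
          exact mul_nonneg (by linarith) hr
        · simp only [Fin.val_succ, Fin.val_castSucc]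
          push_cast
          ring
    · refine fun x hx => Set.mem_iInter.2 fun j => ?_
      obtain ⟨j, hj⟩ := j
      obtain rfl : j = 0 := le_antisymm hj (Fin.zero_le j)
      exact Metric.self_subset_cthickening _ (hBN _ hx)
    · refine fun i => hT i ((hB _).inter (hLm _)) ((hB _).diff (hLm _)) fun x hx y hy => ?_
      by_contra! hxy
      refine hy.2 (Set.mem_iInter.2 fun j => ?_)
      obtain ⟨j, hj⟩ := j
      rcases hj.eq_or_lt with rfl | hj'
      · exact Metric.self_subset_cthickening _ (hBN _ hy.1)
      · have hj2 : j ≤ i.castSucc := Fin.le_castSucc_iff.2 hj'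
        have hj3 : ((j : ℕ) : ℝ) ≤ (i : ℕ) := by exact_mod_cast hj2
        refine hstep (a := (((i.castSucc : ℕ) : ℝ) - (j : ℕ)) * r) ?_ ?_ hxy
          (Set.mem_iInter.1 hx.2 ⟨j, hj2⟩)
        · exact mul_nonneg (by simpa using hj3) hr
        · simp only [Fin.val_succ, Fin.val_castSucc]
          push_cast
          ring
  rw [key N hN fun _ => le_rfl, key (fun i => N i ∩ K) (fun i => (hN i).inter hK)
    fun _ => Set.inter_subset_left]
  congr 1
  ext1 i
  have hsub : N i ∩ L i ∩ L' i ⊆ K := by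
    refine fun x hx => hNK (Set.mem_iInter.2 fun j => ?_)
    have hi : ((i : ℕ) : ℝ) ≤ n := by exact_mod_cast Nat.lt_succ_iff.1 i.2
    have hj : ((j : ℕ) : ℝ) ≤ n := by exact_mod_cast Nat.lt_succ_iff.1 j.2
    rcases le_total j i with h | h
    · refine Metric.cthickening_mono ?_ _ (Set.mem_iInter.1 hx.1.2 ⟨j, h⟩)
      refine mul_le_mul_of_nonneg_right ?_ hr
      have : (0 : ℝ) ≤ (j : ℕ) := Nat.cast_nonneg _
      change ((i : ℕ) : ℝ) - (j : ℕ) ≤ n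
      linarith
    · refine Metric.cthickening_mono ?_ _ (Set.mem_iInter.1 hx.2 ⟨j, h⟩)
      refine mul_le_mul_of_nonneg_right ?_ hr
      have : (0 : ℝ) ≤ (i : ℕ) := Nat.cast_nonneg _
      change ((j : ℕ) : ℝ) - (i : ℕ) ≤ n
      linarith
  ext x
  exact ⟨fun hx => ⟨⟨⟨hx.1.1, hsub hx⟩, hx.1.2⟩, hx.2⟩, fun hx => ⟨⟨hx.1.1.1, hx.1.2⟩, hx.2⟩⟩

end Localization

section Expansion

variable {R : Type*} [Ring R]

/-- The entries of a product of matrices are sums over paths. -/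
theorem prod_ofFn_matrix_apply {κ : Type*} [Fintype κ] [DecidableEq κ] {n : ℕ}
    (A : Fin (n + 1) → Matrix κ κ R) (a b : κ) : (List.ofFn A).prod a b =
      ∑ q : Fin n → κ, (List.ofFn fun i => A i ((Fin.cons a q : Fin (n + 1) → κ) i)
        ((Fin.snoc q b : Fin (n + 1) → κ) i)).prod := by
  induction n generalizing a with
  | zero => simp [Fin.snoc]
  | succ n ih =>
    rw [List.ofFn_succ, List.prod_cons, Matrix.mul_apply,
      ← (Fin.consEquiv fun _ => κ).sum_comp, Fintype.sum_prod_type]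
    refine Finset.sum_congr rfl fun c _ => ?_
    rw [ih, Finset.mul_sum]
    refine Finset.sum_congr rfl fun q _ => ?_
    rw [List.ofFn_succ (n := n + 1), List.prod_cons]
    have h1 : (Fin.snoc ((Fin.consEquiv fun _ => κ) (c, q)) b : Fin (n + 2) → κ) =
        Fin.cons c (Fin.snoc q b : Fin (n + 1) → κ) :=
      (Fin.cons_snoc_eq_snoc_cons c q b).symm
    rw [h1]
    rfl

/-- A closed path is the same as a cyclic sequence of vertices. -/
theorem sum_prod_ofFn_matrix_apply_self {κ : Type*} [Fintype κ] [DecidableEq κ] {n : ℕ}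
    {V : Type*} [AddCommMonoid V] (F : (Fin (n + 1) → κ) → (Fin (n + 1) → κ) → V) :
    ∑ a : κ, ∑ q : Fin n → κ, F (Fin.cons a q) (Fin.snoc q a) =
      ∑ a : Fin (n + 1) → κ, F a fun i => a (i + 1) := by
  rw [← (Fin.consEquiv fun _ => κ).sum_comp, Fintype.sum_prod_type]
  refine Finset.sum_congr rfl fun a _ => Finset.sum_congr rfl fun q _ => ?_
  congr 1
  ext1 i
  induction i using Fin.lastCases with
  | last => rw [Fin.snoc_last, Fin.last_add_one]; rfl
  | cast i => rw [Fin.snoc_castSucc, Fin.coeSucc_eq_succ]; rfl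

/-- Expansion of a product of sums. -/
theorem prod_ofFn_sum {R : Type*} [Ring R] [Algebra ℂ R] {ι : Type*} [Fintype ι] {n : ℕ}
    (c : Fin n → ι → ℂ) (E : ι → R) (S : Fin n → R) :
    (List.ofFn fun i => (∑ q, c i q • E q) * S i).prod =
      ∑ e : Fin n → ι, (∏ i, c i (e i)) • (List.ofFn fun i => E (e i) * S i).prod := by
  classical
  have h := (MultilinearMap.mkPiAlgebraFin ℂ n R).map_sum
    (g := fun (i : Fin n) (q : ι) => c i q • (E q * S i))
  simp only [MultilinearMap.map_smul_univ, MultilinearMap.mkPiAlgebraFin_apply] at h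
  rw [← h]
  congr 2
  ext1 i
  rw [Finset.sum_mul]
  exact Finset.sum_congr rfl fun q _ => smul_mul_assoc _ _ _

end Expansion

/-! ### Traces of alternating sums -/

section TraceSide

variable {M : Type*} [MetricSpace M] [ProperSpace M] [MeasurableSpace M] [BorelSpace M]
variable {H : Type*} [NormedAddCommGroup H] [InnerProductSpace ℂ H] [CompleteSpace H]
variable (ρ : C₀(M, ℂ) →⋆ₙₐ[ℂ] (H →L[ℂ] H)) {n k : ℕ}

/-- The indicator function of a set, acting diagonally. -/
def diagSet (k : ℕ) (A : Set M) : Matrix (Fin k) (Fin k) (H →L[ℂ] H) :=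
  Matrix.diagonal fun _ => setOp ρ A

/-- A matrix over `ℬ(M)` as a matrix of operators. -/
def toOps (T : Matrix (Fin k) (Fin k) (algB ρ)) : Matrix (Fin k) (Fin k) (H →L[ℂ] H) :=
  T.map fun x => (x : H →L[ℂ] H)

theorem isProjectionValued_diagSet : IsProjectionValued (diagSet ρ k) where
  mul hA hB := by simp only [diagSet, Matrix.diagonal_mul_diagonal, setOp_mul ρ hA hB]
  add_sdiff {A B} hA hB := by
    rw [diagSet, diagSet, diagSet, Matrix.diagonal_add, ← setOp_union ρ (hA.inter hB) (hA.diff hB)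
      (Set.disjoint_left.2 fun x hx hx' => hx'.2 hx.2), Set.inter_union_sdiff]

/-- Finite propagation for matrices. -/
theorem diagSet_mul_toOps_mul_diagSet {T : Matrix (Fin k) (Fin k) (algB ρ)} {r : ℝ}
    (hT : ∀ a b, HasPropagationBound ρ (T a b : H →L[ℂ] H) r) {A B : Set M} (hA : MeasurableSet A)
    (hB : MeasurableSet B) (h : ∀ x ∈ A, ∀ y ∈ B, r ≤ dist x y) :
    diagSet ρ k A * toOps ρ T * diagSet ρ k B = 0 := by
  ext1 a b
  rw [diagSet, diagSet, Matrix.mul_diagonal, Matrix.diagonal_mul]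
  exact (hT a b).setOp_mul_mul_setOp hA hB h

/-- Between disjoint sets a scalar matrix vanishes. -/
theorem diagSet_mul_actMatrix_mul_diagSet (S : Matrix (Fin k) (Fin k) (algBPlus ρ))
    {A B : Set M} (hA : MeasurableSet A) (hB : MeasurableSet B) (h : Disjoint A B) :
    diagSet ρ k A * actMatrix ρ S * diagSet ρ k B =
      diagSet ρ k A * toOps ρ (nonscalarPart ρ S) * diagSet ρ k B := by
  ext1 a b
  rw [diagSet, diagSet, Matrix.mul_diagonal, Matrix.diagonal_mul, Matrix.mul_diagonal,
    Matrix.diagonal_mul, actMatrix, Matrix.map_apply, NonUnitalSubalgebra.unitization_apply,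
    mul_add, add_mul, ← Algebra.commutes, mul_assoc, setOp_mul ρ hA hB, h.inter_eq, setOp_empty,
    mul_zero, zero_add]
  rfl

theorem isTraceClass_matrix_mul_right {T : Matrix (Fin k) (Fin k) (H →L[ℂ] H)}
    (hT : ∀ a b, IsTraceClass (T a b)) (S : Matrix (Fin k) (Fin k) (H →L[ℂ] H)) (a b : Fin k) :
    IsTraceClass ((T * S) a b) := by
  rw [Matrix.mul_apply]
  exact isTraceClass_sum _ fun c _ => (hT a c).mul_right _

theorem sum_trace_mul_comm {T : Matrix (Fin k) (Fin k) (H →L[ℂ] H)}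
    (hT : ∀ a b, IsTraceClass (T a b)) (S : Matrix (Fin k) (Fin k) (H →L[ℂ] H)) :
    ∑ a, trace ((S * T) a a) = ∑ a, trace ((T * S) a a) := by
  simp only [Matrix.mul_apply]
  rw [Finset.sum_congr rfl fun a _ => trace_sum _ fun c _ => (hT c a).mul_left (S a c),
    Finset.sum_congr rfl fun a _ => trace_sum _ fun c _ => (hT a c).mul_right (S c a),
    Finset.sum_comm]
  exact Finset.sum_congr rfl fun a _ => Finset.sum_congr rfl fun c _ => (hT a c).trace_mul_comm _

variable (hρ : ∀ v : H, (∀ f : C₀(M, ℂ), ρ f v = 0) → v = 0)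
include hρ

theorem isTraceClass_diagSet_mul_toOps (T : Matrix (Fin k) (Fin k) (algB ρ)) {A : Set M}
    (hA : MeasurableSet A) (hb : Bornology.IsBounded A) (a b : Fin k) :
    IsTraceClass ((diagSet ρ k A * toOps ρ T) a b) := by
  rw [diagSet, Matrix.diagonal_mul]
  exact (algB_spec hρ (T a b)).1.setOp_mul hA hb

/-- The matrix trace of `B₀ T₀ ⋯ Bₙ Tₙ` is `∫ 1_B dχ(tr(T₀ ⊗ ⋯ ⊗ Tₙ))`. -/
theorem sum_trace_prod_diagSet (T : Fin (n + 1) → Matrix (Fin k) (Fin k) (algB ρ))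
    {B : Fin (n + 1) → Set M} (hB : ∀ i, MeasurableSet (B i))
    (hb : ∀ i, Bornology.IsBounded (B i)) :
    ∑ a, trace ((List.ofFn fun i => diagSet ρ k (B i) * toOps ρ (T i)).prod a a) =
      boxTrace ρ (trTensor T) B := by
  have hentry : ∀ i a b, (diagSet ρ k (B i) * toOps ρ (T i)) a b =
      setOp ρ (B i) * (T i a b : H →L[ℂ] H) := fun i a b => by
    rw [diagSet, Matrix.diagonal_mul]; rfl
  have htc : ∀ p q : Fin (n + 1) → Fin k, IsTraceClass (List.ofFn fun i =>
      setOp ρ (B i) * (T i (p i) (q i) : H →L[ℂ] H)).prod := fun p q => by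
    rw [List.ofFn_succ, List.prod_cons]
    exact ((algB_spec hρ _).1.setOp_mul (hB 0) (hb 0)).mul_right _
  simp only [prod_ofFn_matrix_apply, hentry]
  rw [Finset.sum_congr rfl fun a _ => trace_sum _ fun q _ => htc (Fin.cons a q) (Fin.snoc q a),
    sum_prod_ofFn_matrix_apply_self fun p q => trace (List.ofFn fun i =>
      setOp ρ (B i) * (T i (p i) (q i) : H →L[ℂ] H)).prod, trTensor, boxTrace, map_sum, trace_sum]
  · exact Finset.sum_congr rfl fun a _ => (boxTrace_tprod ρ _ B).symm
  · exact fun a _ => isTraceClass_sandwich ρ hρ (f := fun i => (B i).indicator fun _ => 1)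
      (isBoundedBorel_indicator (hB 0)) (hasCompactSupport_indicator (hb 0)) _

theorem exists_propagationBound_matrix (T : Fin n → Matrix (Fin k) (Fin k) (algB ρ)) :
    ∃ r, 0 ≤ r ∧ ∀ i a b, HasPropagationBound ρ (T i a b : H →L[ℂ] H) r := by
  obtain ⟨r, hr, h⟩ := exists_propagationBound hρ
    fun x : Fin n × Fin k × Fin k => T x.1 x.2.1 x.2.2
  exact ⟨r, hr, fun i a b => h (i, a, b)⟩

/-- For disjoint sets `Nᵢ` that are coarsely transverse, the product `N₀ S₀ ⋯ Nₙ Sₙ` is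
trace-class, and its trace sees neither the scalar parts of the `Sᵢ` nor what is far from some
`Nᵢ`. -/
theorem sum_trace_prod_actMatrix (S : Fin (n + 2) → Matrix (Fin k) (Fin k) (algBPlus ρ)) {r : ℝ}
    (hr : 0 ≤ r)
    (hS : ∀ i a b, HasPropagationBound ρ (nonscalarPart ρ (S i) a b : H →L[ℂ] H) r)
    {N : Fin (n + 2) → Set M} (hN : ∀ i, MeasurableSet (N i))
    (hdisj : Pairwise fun i j => Disjoint (N i) (N j)) {K : Set M} (hK : MeasurableSet K)
    (hKb : Bornology.IsBounded K)
    (hNK : ⋂ i, Metric.cthickening ((n + 1 : ℕ) * r) (N i) ⊆ K) :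
    (∀ a b, IsTraceClass
      ((List.ofFn fun i => diagSet ρ k (N i) * actMatrix ρ (S i)).prod a b)) ∧
    ∑ a, trace ((List.ofFn fun i => diagSet ρ k (N i) * actMatrix ρ (S i)).prod a a) =
      boxTrace ρ (trTensor fun i => nonscalarPart ρ (S i)) fun i => N i ∩ K := by
  have hE := isProjectionValued_diagSet (k := k) ρ
  set t : Fin (n + 2) → Matrix (Fin k) (Fin k) (H →L[ℂ] H) := fun i =>
    toOps ρ (nonscalarPart ρ (S i)) with ht
  set N' : Fin (n + 2) → Set M := fun i => N i ∩ K with hN'd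
  have hN' : ∀ i, MeasurableSet (N' i) := fun i => (hN i).inter hK
  set C := chainProd (diagSet ρ k) (fun i : Fin (n + 1) => t i.castSucc) N' with hC
  have e1 : (List.ofFn fun i => diagSet ρ k (N i) * actMatrix ρ (S i)).prod =
      C * actMatrix ρ (S (Fin.last _)) := by
    rw [List.ofFn_succ_last, List.prod_append, List.prod_singleton, ← mul_assoc]
    congr 1
    change chainProd (diagSet ρ k) (fun i : Fin (n + 1) => actMatrix ρ (S i.castSucc)) N = C
    rw [hE.chainProd_congr (T' := fun i : Fin (n + 1) => t i.castSucc) hN fun i =>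
      diagSet_mul_actMatrix_mul_diagSet ρ _ (hN _) (hN _)
        (hdisj (Fin.castSucc_lt_succ (i := i)).ne)]
    exact hE.chainProd_inter hr
      (fun i A B hA hB h => diagSet_mul_toOps_mul_diagSet ρ (hS _) hA hB h) hN hK hNK
  have e2 : C * t (Fin.last _) = (List.ofFn fun i => diagSet ρ k (N' i) * t i).prod := by
    rw [List.ofFn_succ_last, List.prod_append, List.prod_singleton, ← mul_assoc]
    rfl
  have hCtc : ∀ a b, IsTraceClass (C a b) := by
    rw [hC, chainProd_succ']
    exact isTraceClass_matrix_mul_right (isTraceClass_diagSet_mul_toOps ρ hρ _ (hN' 0)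
      (hKb.subset Set.inter_subset_right)) _
  rw [e1]
  refine ⟨isTraceClass_matrix_mul_right hCtc _, ?_⟩
  have h0 : diagSet ρ k (N' 0) * C = C := hE.zero_mul_chainProd _ hN'
  have hl : C * diagSet ρ k (N' (Fin.last _)) = C := hE.chainProd_mul_last _ hN'
  -- cyclicity inserts the indicator functions of the first and last sets around the last factor
  have key : ∀ X : Matrix (Fin k) (Fin k) (H →L[ℂ] H), ∑ a, trace ((C * X) a a) =
      ∑ a, trace ((C * (diagSet ρ k (N' (Fin.last _)) * X * diagSet ρ k (N' 0))) a a) := fun X => by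
    rw [← mul_assoc, ← mul_assoc, hl,
      ← sum_trace_mul_comm (isTraceClass_matrix_mul_right hCtc X), ← mul_assoc, h0]
  rw [key, diagSet_mul_actMatrix_mul_diagSet ρ _ (hN' _) (hN' _)
    ((hdisj (Fin.last_pos).ne').mono Set.inter_subset_left Set.inter_subset_left), ← key, e2]
  exact sum_trace_prod_diagSet ρ hρ _ hN' fun i => hKb.subset Set.inter_subset_right

omit hρ in
/-- Every `Yⱼ` is a disjoint union of atoms. -/
theorem setOp_eq_sum_atom {Y : Fin n → Set M} (hY : ∀ j, MeasurableSet (Y j)) (j : Fin n) :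
    setOp ρ (Y j) = ∑ q : Fin n → Bool, (if q j then (1 : ℂ) else 0) • setOp ρ (atom Y q) := by
  classical
  have key : ∀ s : Finset (Fin n → Bool),
      setOp ρ (⋃ q ∈ s, atom Y q) = ∑ q ∈ s, setOp ρ (atom Y q) := by
    intro s
    induction s using Finset.induction_on with
    | empty => simp [setOp_empty]
    | insert q s hq ih =>
      rw [Finset.sum_insert hq, ← ih, Finset.set_biUnion_insert,
        setOp_union ρ (measurableSet_atom hY q)
          (Finset.measurableSet_biUnion _ fun q _ => measurableSet_atom hY q)]
      rw [Set.disjoint_iUnion₂_right]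
      exact fun q' hq' => disjoint_atom fun e => hq (e ▸ hq')
  have hu : Y j = ⋃ q ∈ Finset.univ.filter fun q : Fin n → Bool => q j = true, atom Y q := by
    ext y
    simp only [Finset.mem_filter, Finset.mem_univ, true_and, Set.mem_iUnion, exists_prop]
    refine ⟨fun hy => ⟨pattern Y y, by simpa [pattern] using hy, mem_atom_iff.2 rfl⟩, ?_⟩
    rintro ⟨q, hq, hy⟩
    exact (hy j).2 hq
  simp only [ite_smul, one_smul, zero_smul]
  rw [hu, key, Finset.sum_filter]

omit hρ in
/-- The alternating sum in terms of atoms. -/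
theorem altSum_eq_sum_patternDet {Y : Fin (n + 1) → Set M} (hY : ∀ j, MeasurableSet (Y j))
    (S : Fin (n + 1) → Matrix (Fin k) (Fin k) (H →L[ℂ] H)) : altSum ρ Y S =
      ∑ e : Fin (n + 1) → Fin (n + 1) → Bool, patternDet e •
        (List.ofFn fun i => diagSet ρ k (atom Y (e i)) * S i).prod := by
  have hd : ∀ j, Matrix.diagonal (fun _ : Fin k => setOp ρ (Y j)) =
      ∑ q : Fin (n + 1) → Bool, (if q j then (1 : ℂ) else 0) • diagSet ρ k (atom Y q) := fun j => by
    ext1 a b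
    rw [setOp_eq_sum_atom ρ hY j, Matrix.sum_apply]
    by_cases h : a = b
    · subst h; simp [diagSet]
    · simp [diagSet, h]
  simp only [altSum, hd, prod_ofFn_sum, Finset.smul_sum, patternDet_eq_sum, Finset.sum_smul]
  rw [Finset.sum_comm]
  refine Finset.sum_congr rfl fun e _ => Finset.sum_congr rfl fun σ _ => ?_
  rw [mul_smul, Int.cast_smul_eq_zsmul]

/-- The alternating sum is trace-class, and its trace is a combination of integrals over boxes. -/
theorem trace_altSum {Y : Fin (n + 2) → Set M} (hY : IsTransverse Y)
    (S : Fin (n + 2) → Matrix (Fin k) (Fin k) (algBPlus ρ)) :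
    IsTraceClass (matrixOp (altSum ρ Y fun i => actMatrix ρ (S i))) ∧
    ∃ R, ∀ K : Set M, MeasurableSet K → Bornology.IsBounded K →
      (∀ e, patternDet e ≠ 0 → ⋂ i, Metric.cthickening R (atom Y (e i)) ⊆ K) →
      trace (matrixOp (altSum ρ Y fun i => actMatrix ρ (S i))) = ∑ e, patternDet e *
        boxTrace ρ (trTensor fun i => nonscalarPart ρ (S i)) fun i => atom Y (e i) ∩ K := by
  obtain ⟨r, hr, hS⟩ := exists_propagationBound_matrix ρ hρ fun i => nonscalarPart ρ (S i)
  have hspec : ∀ e, patternDet e ≠ 0 → ∀ K : Set M, MeasurableSet K → Bornology.IsBounded K →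
      ⋂ i, Metric.cthickening ((n + 1 : ℕ) * r) (atom Y (e i)) ⊆ K → _ := fun e he K hK hKb hsub =>
    sum_trace_prod_actMatrix ρ hρ S hr hS (fun i => measurableSet_atom hY.measurableSet (e i))
      (fun i j hij => disjoint_atom fun h => he (patternDet_eq_zero_of_eq hij h)) hK hKb hsub
  have htc : ∀ e a b, IsTraceClass ((patternDet e • (List.ofFn fun i =>
      diagSet ρ k (atom Y (e i)) * actMatrix ρ (S i)).prod) a b) := by
    intro e a b
    by_cases he : patternDet e = 0
    · rw [he, zero_smul]
      exact isTraceClass_zero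
    · have hb := hY.bounded e he ((n + 1 : ℕ) * r)
      exact ((hspec e he _ (isClosed_iInter fun i => Metric.isClosed_cthickening).measurableSet hb
        le_rfl).1 a b).smul _
  have htc' : ∀ a b, IsTraceClass (altSum ρ Y (fun i => actMatrix ρ (S i)) a b) := by
    intro a b
    rw [altSum_eq_sum_patternDet ρ hY.measurableSet, Matrix.sum_apply]
    exact isTraceClass_sum _ fun e _ => htc e a b
  refine ⟨isTraceClass_matrixOp htc', (n + 1 : ℕ) * r, fun K hK hKb hsub => ?_⟩
  rw [trace_matrixOp htc', altSum_eq_sum_patternDet ρ hY.measurableSet]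
  simp only [Matrix.sum_apply]
  rw [Finset.sum_congr rfl fun a _ => trace_sum _ fun e _ => htc e a a, Finset.sum_comm]
  refine Finset.sum_congr rfl fun e _ => ?_
  by_cases he : patternDet e = 0
  · simp [he, trace_zero]
  · rw [← (hspec e he K hK hKb (hsub e he)).2, Finset.mul_sum]
    exact Finset.sum_congr rfl fun a _ => trace_smul _ _

end TraceSide

/-! ### Comparison of the trace with the pairing -/

section Comparison

variable {M : Type*} [MetricSpace M] [ProperSpace M] [MeasurableSpace M] [BorelSpace M]
variable {H : Type*} [NormedAddCommGroup H] [InnerProductSpace ℂ H] [CompleteSpace H]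
variable (ρ : C₀(M, ℂ) →⋆ₙₐ[ℂ] (H →L[ℂ] H)) {n k : ℕ}

/-- On a cube the wedge is a combination of indicator functions of boxes. -/
theorem indicator_wedge_eq_sum (Y : Fin (n + 1) → Set M) (K : Set M) :
    (Set.univ.pi fun _ : Fin (n + 1) => K).indicator (wedge Y) =
      ∑ e : Fin (n + 1) → Fin (n + 1) → Bool, patternDet e •
        (Set.univ.pi fun i => atom Y (e i) ∩ K).indicator fun _ => (1 : ℂ) := by
  ext1 x
  rw [Finset.sum_apply]
  by_cases hx : x ∈ Set.univ.pi fun _ : Fin (n + 1) => K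
  · rw [Set.indicator_of_mem hx, Finset.sum_eq_single fun i => pattern Y (x i)]
    · have : x ∈ Set.univ.pi fun i => atom Y (pattern Y (x i)) ∩ K := fun i hi =>
        ⟨mem_atom_iff.2 rfl, hx i hi⟩
      rw [Pi.smul_apply, Set.indicator_of_mem this, wedge_eq_patternDet, smul_eq_mul, mul_one]
    · intro e _ he
      have : x ∉ Set.univ.pi fun i => atom Y (e i) ∩ K := fun h =>
        he (funext fun i => (mem_atom_iff.1 (h i trivial).1).symm)
      rw [Pi.smul_apply, Set.indicator_of_notMem this, smul_zero]
    · exact fun h => absurd (Finset.mem_univ _) h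
  · rw [Set.indicator_of_notMem hx, eq_comm]
    refine Finset.sum_eq_zero fun e _ => ?_
    have : x ∉ Set.univ.pi fun i => atom Y (e i) ∩ K := fun h => hx fun i hi => (h i hi).2
    rw [Pi.smul_apply, Set.indicator_of_notMem this, smul_zero]

variable (hρ : ∀ v : H, (∀ f : C₀(M, ℂ), ρ f v = 0) → v = 0)
include hρ

/-- The pairing with a wedge is a combination of the values of `χ` on boxes, cut off by any set that
contains the relevant part of the support. -/
theorem exists_pairing_wedge_eq_sum {Y : Fin (n + 1) → Set M} (hY : IsTransverse Y)
    (z : Chains (algB ρ) n) : ∃ D : Set M, Bornology.IsBounded D ∧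
      ∀ K : Set M, MeasurableSet K → Bornology.IsBounded K → D ⊆ K →
        pairingBilin ⟨wedge Y, hY.wedge_mem.1⟩ ⟨chi ρ hρ z, chi_mem_coarseChains ρ hρ z⟩ =
          ∑ e, patternDet e * boxTrace ρ z fun i => atom Y (e i) ∩ K := by
  obtain ⟨R, hR⟩ := (chi_mem_coarseChains ρ hρ z).2
  obtain ⟨D, -, hDb, hsub⟩ := exists_isOpen_pi_superset (hY.isBounded_tsupport R)
  refine ⟨D, hDb, fun K hK hKb hDK => ?_⟩
  have hQ : MeasurableSet (Set.univ.pi fun _ : Fin (n + 1) => K) :=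
    MeasurableSet.univ_pi fun _ => hK
  have hQb : Bornology.IsBounded (Set.univ.pi fun _ : Fin (n + 1) => K) :=
    isBounded_univ_pi fun _ => hKb
  have hN : ∀ (e : Fin (n + 1) → Fin (n + 1) → Bool) i, MeasurableSet (atom Y (e i) ∩ K) :=
    fun e i => (measurableSet_atom hY.measurableSet _).inter hK
  have hbox : ∀ e : Fin (n + 1) → Fin (n + 1) → Bool,
      MeasurableSet (Set.univ.pi fun i => atom Y (e i) ∩ K) := fun e =>
    MeasurableSet.univ_pi (hN e)
  have hpair := chainPairing_eq_cint ⟨wedge Y, hY.wedge_mem.1⟩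
    ⟨chi ρ hρ z, chi_mem_coarseChains ρ hρ z⟩ hR hQ hQb
    (hsub.trans (Set.pi_mono fun _ _ => hDK))
  rw [pairingBilin_apply]
  refine hpair.trans ?_
  rw [indicator_wedge_eq_sum, cint_sum _ _ fun e => (isBoundedBorel_indicator (hbox e)).smul _]
  refine Finset.sum_congr rfl fun e _ => ?_
  rw [cint_smul, cint_indicator _ (hbox e), restrictTo_apply _ hQ hQb (hbox e),
    ← chi_box ρ hρ z (hN e) fun i => hKb.subset Set.inter_subset_right]
  have hle : (Set.univ.pi fun i => atom Y (e i) ∩ K) ⊆ Set.univ.pi fun _ : Fin (n + 1) => K :=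
    Set.pi_mono fun _ _ => Set.inter_subset_right
  rw [Set.inter_eq_left.2 hle]

omit hρ in
/-- A single bounded set serves all pattern families. -/
theorem exists_superset_atoms {Y : Fin (n + 1) → Set M} (hY : IsTransverse Y) {D : Set M}
    (hD : Bornology.IsBounded D) (R : ℝ) : ∃ K, MeasurableSet K ∧ Bornology.IsBounded K ∧ D ⊆ K ∧
      ∀ e, patternDet e ≠ 0 → ⋂ i, Metric.cthickening R (atom Y (e i)) ⊆ K := by
  obtain ⟨U, hU, hsub⟩ : ∃ U : Set M, Bornology.IsBounded U ∧
      ∀ e, patternDet e ≠ 0 → ⋂ i, Metric.cthickening R (atom Y (e i)) ⊆ U :=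
    ⟨⋃ e : {e : Fin (n + 1) → Fin (n + 1) → Bool // patternDet e ≠ 0},
      ⋂ i, Metric.cthickening R (atom Y (e.1 i)),
      Bornology.isBounded_iUnion.2 fun e => hY.bounded e.1 e.2 R,
      fun e he => Set.subset_iUnion_of_subset ⟨e, he⟩ le_rfl⟩
  have hm : MeasurableSet (closure (D ∪ U)) := measurableSet_closure
  exact ⟨_, hm, (hD.union hU).closure, Set.subset_union_left.trans subset_closure,
    fun e he => (hsub e he).trans (Set.subset_union_right.trans subset_closure)⟩

/-- Both sides are the same finite combination of integrals over bounded boxes. -/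
theorem trace_altSum_eq_pairing {Y : Fin (n + 2) → Set M} (hY : IsTransverse Y)
    (S : Fin (n + 2) → Matrix (Fin k) (Fin k) (algBPlus ρ)) :
    IsTraceClass (matrixOp (altSum ρ Y fun i => actMatrix ρ (S i))) ∧
    trace (matrixOp (altSum ρ Y fun i => actMatrix ρ (S i))) =
      pairingBilin ⟨wedge Y, hY.wedge_mem.1⟩
        ⟨chi ρ hρ (trTensor fun i => nonscalarPart ρ (S i)), chi_mem_coarseChains ρ hρ _⟩ := by
  obtain ⟨htc, R, hR⟩ := trace_altSum ρ hρ hY S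
  obtain ⟨D, hDb, hD⟩ := exists_pairing_wedge_eq_sum ρ hρ hY
    (trTensor fun i => nonscalarPart ρ (S i))
  refine ⟨htc, ?_⟩
  obtain ⟨K, hK, hKb, hDK, hRK⟩ := exists_superset_atoms hY hDb R
  exact (hR K hK hKb hRK).trans (hD K hK hKb hDK).symm

/-- In degree zero `M` itself is bounded. -/
theorem trace_nonscalarPart_eq_pairing {Y : Fin 1 → Set M} (hY : IsTransverse Y)
    (h0 : Y 0 = Set.univ) (P : Matrix (Fin k) (Fin k) (algBPlus ρ)) :
    IsTraceClass (matrixOp (toOps ρ (nonscalarPart ρ P))) ∧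
    trace (matrixOp (toOps ρ (nonscalarPart ρ P))) =
      pairingBilin ⟨wedge Y, hY.wedge_mem.1⟩
        ⟨chi ρ hρ (trTensor fun _ => nonscalarPart ρ P), chi_mem_coarseChains ρ hρ _⟩ := by
  have hatom : atom Y (fun _ => true) = Set.univ := by
    refine Set.eq_univ_of_forall fun y j => ?_
    rw [Fin.fin_one_eq_zero j, h0]
    simp
  have hdet : patternDet (fun _ _ : Fin 1 => true) = 1 := by simp [patternDet]
  have hb : Bornology.IsBounded (Set.univ : Set M) := by
    have := hY.bounded (fun _ _ => true) (by simp [hdet]) 0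
    rw [hatom] at this
    refine this.subset fun x _ => Set.mem_iInter.2 fun _ => ?_
    exact Metric.self_subset_cthickening _ (Set.mem_univ x)
  have h1 : diagSet ρ k Set.univ = 1 := by
    rw [diagSet, setOp_univ ρ hρ, Matrix.diagonal_one]
  have htc : ∀ a b, IsTraceClass (toOps ρ (nonscalarPart ρ P) a b) := by
    have := isTraceClass_diagSet_mul_toOps ρ hρ (nonscalarPart ρ P) MeasurableSet.univ hb
    rwa [h1, one_mul] at this
  refine ⟨isTraceClass_matrixOp htc, ?_⟩
  obtain ⟨D, hDb, hD⟩ := exists_pairing_wedge_eq_sum ρ hρ hY (trTensor fun _ => nonscalarPart ρ P)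
  rw [hD Set.univ MeasurableSet.univ hb (Set.subset_univ D), trace_matrixOp htc,
    Finset.sum_eq_single fun _ _ => true]
  · rw [hdet, one_mul]
    simp only [hatom, Set.inter_univ]
    rw [← sum_trace_prod_diagSet ρ hρ (fun _ => nonscalarPart ρ P) (fun _ => MeasurableSet.univ)
      fun _ => hb]
    simp [h1]
  · intro e _ he
    have : e 0 0 = false := by
      by_contra hcon
      refine he (funext fun i => funext fun j => ?_)
      rw [Fin.fin_one_eq_zero i, Fin.fin_one_eq_zero j]
      simpa using hcon
    simp [patternDet, this]
  · exact fun h => absurd (Finset.mem_univ _) h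

theorem trace_idemOperator_eq_pairing {Y : Fin (n + 1) → Set M} (hY : IsTransverse Y)
    (h0 : n = 0 → Y 0 = Set.univ) (P : Matrix (Fin k) (Fin k) (algBPlus ρ)) :
    IsTraceClass (idemOperator ρ Y P) ∧ trace (idemOperator ρ Y P) =
      pairingBilin ⟨wedge Y, hY.wedge_mem.1⟩
        ⟨chi ρ hρ (trTensor fun _ => nonscalarPart ρ P), chi_mem_coarseChains ρ hρ _⟩ := by
  cases n with
  | zero =>
    rw [idemOperator, if_pos rfl]
    exact trace_nonscalarPart_eq_pairing ρ hρ hY (h0 rfl) P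
  | succ n =>
    rw [idemOperator, if_neg n.succ_ne_zero]
    exact trace_altSum_eq_pairing ρ hρ hY fun _ => P

theorem trace_invOperator_eq_pairing {Y : Fin (n + 2) → Set M} (hY : IsTransverse Y)
    (U : (Matrix (Fin k) (Fin k) (algBPlus ρ))ˣ) :
    IsTraceClass (invOperator ρ Y U) ∧ trace (invOperator ρ Y U) =
      pairingBilin ⟨wedge Y, hY.wedge_mem.1⟩
        ⟨chi ρ hρ (trTensor fun i => if Even (i : ℕ) then nonscalarPart ρ U.val
          else nonscalarPart ρ (U⁻¹ : (Matrix (Fin k) (Fin k) (algBPlus ρ))ˣ).val),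
          chi_mem_coarseChains ρ hρ _⟩ := by
  have h := trace_altSum_eq_pairing ρ hρ hY fun i => if Even (i : ℕ) then U.val
    else (U⁻¹ : (Matrix (Fin k) (Fin k) (algBPlus ρ))ˣ).val
  simp only [apply_ite (actMatrix ρ), apply_ite (nonscalarPart ρ)] at h
  exact h

/-- The pairing with an idempotent, for partitions and half spaces alike. -/
theorem idemOperator_eq_classPairing {m : ℕ} {Y : Fin (2 * m + 1) → Set M} (hY : IsTransverse Y)
    (h0 : m = 0 → Y 0 = Set.univ) {P : Matrix (Fin k) (Fin k) (algBPlus ρ)} (hP : P * P = P) :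
    IsTraceClass (idemOperator ρ Y P) ∧
    ∃ (hP : chernIdem m P ∈ cyclicCycles (algBPlus ρ) (2 * m))
      (hY : wedge Y ∈ coarseCocycles M (2 * m)),
      trace (idemOperator ρ Y P) = (-1 : ℂ) ^ m * ((m ! : ℂ) / ((2 * m)! : ℂ)) *
        classPairing M (2 * m) (HXCoh.mk (wedge Y) hY)
          (coarseCharacterPlus ρ (2 * m) (HC.mk (chernIdem m P) hP)) := by
  obtain ⟨htc, htr⟩ := trace_idemOperator_eq_pairing ρ hρ hY (fun h => h0 (by omega)) P
  refine ⟨htc, chernIdem_mem m hP, hY.wedge_mem, ?_⟩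
  rw [coarseCharacterPlus_mk ρ hρ, classPairing_mk, htr]
  have hz : chi ρ hρ (dropScalars ρ (2 * m) (chernIdem m P)) =
      ((-1 : ℂ) ^ m * ((2 * m)! / m ! : ℂ)) •
        chi ρ hρ (trTensor fun _ : Fin (2 * m + 1) => nonscalarPart ρ P) := by
    rw [chernIdem, map_smul, dropScalars_trTensor, map_smul]
  have hsub : ∀ h, (⟨chi ρ hρ (dropScalars ρ (2 * m) (chernIdem m P)), h⟩ :
      coarseChains M (2 * m)) = ((-1 : ℂ) ^ m * ((2 * m)! / m ! : ℂ)) •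
        ⟨chi ρ hρ (trTensor fun _ : Fin (2 * m + 1) => nonscalarPart ρ P),
          chi_mem_coarseChains ρ hρ _⟩ := fun _ => Subtype.ext hz
  rw [hsub, map_smul, smul_eq_mul, ← mul_assoc]
  have h1 : (m ! : ℂ) ≠ 0 := Nat.cast_ne_zero.2 m.factorial_ne_zero
  have h2 : ((2 * m)! : ℂ) ≠ 0 := Nat.cast_ne_zero.2 (2 * m).factorial_ne_zero
  have h3 : ((-1 : ℂ) ^ m) * (-1) ^ m = 1 := by rw [← mul_pow]; simp
  have h4 : (-1 : ℂ) ^ m * ((m ! : ℂ) / ((2 * m)! : ℂ)) *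
      ((-1 : ℂ) ^ m * ((2 * m)! / m ! : ℂ)) = 1 := by
    rw [mul_mul_mul_comm, h3, one_mul]
    field_simp
  rw [h4, one_mul]

/-- The pairing with an invertible, for partitions and half spaces alike. -/
theorem invOperator_eq_classPairing {m : ℕ} {Y : Fin (2 * m + 1 + 1) → Set M} (hY : IsTransverse Y)
    {U : (Matrix (Fin k) (Fin k) (algBPlus ρ))ˣ}
    (hU : (U : Matrix (Fin k) (Fin k) (algBPlus ρ)).map (fun x => x.fst) = 1) :
    IsTraceClass (invOperator ρ Y U) ∧
    ∃ (hU : chernInv m (nonscalarPart ρ (U : Matrix (Fin k) (Fin k) (algBPlus ρ)))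
          (nonscalarPart ρ (U⁻¹ : (Matrix (Fin k) (Fin k) (algBPlus ρ))ˣ).val) ∈
          cyclicCycles (algB ρ) (2 * m + 1))
      (hY : wedge Y ∈ coarseCocycles M (2 * m + 1)),
      trace (invOperator ρ Y U) = 1 / (m ! : ℂ) *
        classPairing M (2 * m + 1) (HXCoh.mk (wedge Y) hY)
          (coarseCharacter ρ (2 * m + 1) (HC.mk _ hU)) := by
  obtain ⟨htc, htr⟩ := trace_invOperator_eq_pairing ρ hρ hY U
  refine ⟨htc, chernInv_nonscalarPart_mem ρ m U hU, hY.wedge_mem, ?_⟩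
  rw [coarseCharacter_mk ρ hρ, classPairing_mk, htr]
  have hsub : ∀ h, (⟨chi ρ hρ (chernInv m (nonscalarPart ρ U.val)
      (nonscalarPart ρ (U⁻¹ : (Matrix (Fin k) (Fin k) (algBPlus ρ))ˣ).val)), h⟩ :
      coarseChains M (2 * m + 1)) = (m ! : ℂ) • ⟨chi ρ hρ (trTensor fun i => if Even (i : ℕ)
        then nonscalarPart ρ U.val
        else nonscalarPart ρ (U⁻¹ : (Matrix (Fin k) (Fin k) (algBPlus ρ))ˣ).val),
        chi_mem_coarseChains ρ hρ _⟩ := fun _ => Subtype.ext (map_smul _ _ _)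
  rw [hsub, map_smul, smul_eq_mul, ← mul_assoc, one_div_mul_cancel, one_mul]
  exact Nat.cast_ne_zero.2 m.factorial_ne_zero

end Comparison

end CoarsePairing

end

open CoarsePairing in
theorem lemma4p9 {M : Type*} [MetricSpace M] [ProperSpace M] [MeasurableSpace M] [BorelSpace M]
    {H : Type*} [NormedAddCommGroup H] [InnerProductSpace ℂ H] [CompleteSpace H]
    [TopologicalSpace.SeparableSpace H]
    (ρ : C₀(M, ℂ) →⋆ₙₐ[ℂ] (H →L[ℂ] H))
    (hρ : ∀ v : H, (∀ f : C₀(M, ℂ), ρ f v = 0) → v = 0) :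
    -- the maps on homology that occur below are well defined
    (∀ n : ℕ, IsInducedCharacter ρ (coarseCharacter ρ n) ∧
      IsInducedCharacterPlus ρ (coarseCharacterPlus ρ n) ∧
      IsInducedPairing (classPairing M n)) ∧
    ∀ (m k : ℕ),
      (∀ (A : Fin (2 * m + 1) → Set M), IsCoarselyTransversePartition A →
        ∀ P : Matrix (Fin k) (Fin k) (algBPlus ρ), P * P = P →
        IsTraceClass (idemOperator ρ A P) ∧
        ∃ (hP : chernIdem m P ∈ cyclicCycles (algBPlus ρ) (2 * m))
          (hA : wedge A ∈ coarseCocycles M (2 * m)),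
          kitaevIdem ρ P A = (-1 : ℂ) ^ m * ((m ! : ℂ) / ((2 * m)! : ℂ)) *
            classPairing M (2 * m) (HXCoh.mk (wedge A) hA)
              (coarseCharacterPlus ρ (2 * m) (HC.mk (chernIdem m P) hP))) ∧
      (∀ (A : Fin (2 * m + 1 + 1) → Set M), IsCoarselyTransversePartition A →
        ∀ U : (Matrix (Fin k) (Fin k) (algBPlus ρ))ˣ,
          (U : Matrix (Fin k) (Fin k) (algBPlus ρ)).map (fun x => x.fst) = 1 →
        IsTraceClass (invOperator ρ A U) ∧
        ∃ (hU : chernInv m (nonscalarPart ρ (U : Matrix (Fin k) (Fin k) (algBPlus ρ)))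
              (nonscalarPart ρ (U⁻¹ : (Matrix (Fin k) (Fin k) (algBPlus ρ))ˣ).val) ∈
              cyclicCycles (algB ρ) (2 * m + 1))
          (hA : wedge A ∈ coarseCocycles M (2 * m + 1)),
          kitaevInv ρ U A = 1 / (m ! : ℂ) *
            classPairing M (2 * m + 1) (HXCoh.mk (wedge A) hA)
              (coarseCharacter ρ (2 * m + 1) (HC.mk _ hU))) ∧
      (∀ (X : Fin (2 * m) → Set M), IsCoarselyTransverseHalfSpaces X →
        ∀ P : Matrix (Fin k) (Fin k) (algBPlus ρ), P * P = P →
        IsTraceClass (idemOperator ρ (withOne X) P) ∧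
        ∃ (hP : chernIdem m P ∈ cyclicCycles (algBPlus ρ) (2 * m))
          (hX : wedge (withOne X) ∈ coarseCocycles M (2 * m)),
          kuboIdem ρ P X = (-1 : ℂ) ^ m * ((m ! : ℂ) / ((2 * m)! : ℂ)) *
            classPairing M (2 * m) (HXCoh.mk (wedge (withOne X)) hX)
              (coarseCharacterPlus ρ (2 * m) (HC.mk (chernIdem m P) hP))) ∧
      (∀ (X : Fin (2 * m + 1) → Set M), IsCoarselyTransverseHalfSpaces X →
        ∀ U : (Matrix (Fin k) (Fin k) (algBPlus ρ))ˣ,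
          (U : Matrix (Fin k) (Fin k) (algBPlus ρ)).map (fun x => x.fst) = 1 →
        IsTraceClass (invOperator ρ (withOne X) U) ∧
        ∃ (hU : chernInv m (nonscalarPart ρ (U : Matrix (Fin k) (Fin k) (algBPlus ρ)))
              (nonscalarPart ρ (U⁻¹ : (Matrix (Fin k) (Fin k) (algBPlus ρ))ˣ).val) ∈
              cyclicCycles (algB ρ) (2 * m + 1))
          (hX : wedge (withOne X) ∈ coarseCocycles M (2 * m + 1)),
          kuboInv ρ U X = 1 / (m ! : ℂ) *
            classPairing M (2 * m + 1) (HXCoh.mk (wedge (withOne X)) hX)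
              (coarseCharacter ρ (2 * m + 1) (HC.mk _ hU))) := by
  have hpart : ∀ {A : Fin 1 → Set M}, IsCoarselyTransversePartition A → A 0 = Set.univ :=
    fun {A} hA => by
      rw [← hA.iUnion_eq]
      ext x
      rw [Set.mem_iUnion, Fin.exists_fin_one]
  refine ⟨fun n => ⟨isInducedCharacter_coarseCharacter ρ hρ,
    isInducedCharacterPlus_coarseCharacterPlus ρ hρ, isInducedPairing_classPairing⟩,
    fun m k => ⟨fun A hA P hP => ?_, fun A hA U hU => ?_, fun X hX P hP => ?_,
      fun X hX U hU => ?_⟩⟩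
  · refine idemOperator_eq_classPairing ρ hρ hA.isTransverse (fun h => ?_) hP
    subst h
    exact hpart hA
  · exact invOperator_eq_classPairing ρ hρ hA.isTransverse hU
  · exact idemOperator_eq_classPairing ρ hρ hX.isTransverse (fun _ => rfl) hP
  · exact invOperator_eq_classPairing ρ hρ hX.isTransverse hU
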